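/- All algebras are complex, associative, not necessarily unital, and $\odot$ is the algebraic tensor product. An algebra $X$ is non-degenerate if $xX=0$ or $Xx=0$ implies $x=0$; $M(X)$ is its algebra of two-sided multipliers. A linear map $\pi:X\to M(Y)$ is non-degenerate if $\pi(X)Y=Y=Y\pi(X)$ (linear spans). A $^*$-algebraic quantum group is a pair $(A,\Delta)$ of a non-degenerate $^*$-algebra $A$ and a non-degenerate coassociative $^*$-homomorphism $\Delta:A\to M(A\odot A)$ such that $a\otimes b\mapsto\Delta(a)(b\otimes 1)$ and $a\otimes b\mapsto\Delta(a)(1\otimes b)$ are bijections of $A\odot A$ onto $A\odot A$, and such that there is a non-zero functional $\varphi$ on $A$ with $(\iota\odot\varphi)\Delta(a)=\varphi(a)1$ for all $a\in A$ (a left Haar functional). Fix such $(A,\Delta)$ and a self-adjoint left Haar functional $\varphi$ (i.e. $\varphi(a^*)=\overline{\varphi(a)}$). Let $(\varphi a)(x)=\varphi(ax)$, $(a\varphi)(x)=\varphi(xa)$, and let $\hat A=\{\varphi a\mid a\in A\}\subseteq A'$ with product $(\omega\eta)(x)=\omega((\iota\odot\eta)\Delta(x))$. For a non-degenerate algebra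 $B$, a corepresentation of $(A,\Delta)$ on $B$ is $V\in M(A\odot B)$ with $(\Delta\odot\iota)(V)=V_{13}V_{23}$; it is non-degenerate if $V$ is invertible, and, if $B$ is a $^*$-algebra, unitary if $V$ is a unitary of $M(A\odot B)$. For $V\in M(A\odot B)$ let $\pi_V:\hat A\to M(B)$, $\pi_V(\omega)=(\omega\odot\iota)(V)$, be the map with $\pi_V(a\varphi)\,b=(\varphi\odot\iota)(V(a\otimes b))$ and $b\,\pi_V(\varphi a)=(\varphi\odot\iota)((a\otimes b)V)$. Then there is a unique antipode $S$: an anti-automorphism of $A$ with $m(S\odot\iota)(\Delta(a)(1\otimes b))=\varepsilon(a)b=m(\iota\odot S)((b\otimes1)\Delta(a))$, where $m$ is the multiplication map and $\varepsilon$ is the counit, i.e. a non-zero homomorphism $A\to\mathbb C$ with $(\varepsilon\odot\iota)\Delta=(\iota\odot\varepsilon)\Delta=\iota$. One has $\hat A=\{a\varphi\mid a\in A\}$, and $\hat A$ is a non-degenerate associative $^*$-algebra with the involution $\omega^*(x)=\overline{\omega(S(x)^*)}$, and $M(\hat A)$ is identified with the space of those $\theta\in A'$ for which $(\theta\odot\iota)\Delta(a)$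 and $(\iota\odot\theta)\Delta(a)$ belong to $A$ for all $a\in A$, through $(\theta\omega)(x)=\theta((\iota\odot\omega)\Delta(x))$ and $(\omega\theta)(x)=\theta((\omega\odot\iota)\Delta(x))$ for $\omega\in\hat A$, $x\in A$. Moreover: 1. The adjoint of $\omega\in M(\hat A)$ is given by $\omega^*(x)=\overline{\omega(S(x)^*)}$ for all $x\in A$. 2. For every non-degenerate $^*$-algebra $B$, the map $\pi_V$ is well defined for every $V\in M(A\odot B)$, and a non-degenerate corepresentation $V$ of $(A,\Delta)$ on $B$ is unitary if and only if $\pi_V$ is a $^*$-homomorphism. 3. There is a unique $U\in M(A\odot\hat A)$ such that, viewing $x\otimes\omega\in A\odot\hat A$ as the operator $y\mapsto\omega(y)x$ on $A$, $[U(x\otimes\omega)](y)=(\iota\odot\omega)(\Delta(y)(x\otimes1))$ and $[(x\otimes\omega)U](y)=(\omega\odot\iota)((1\otimes x)\Delta(y))$ for all $x,y\in A$, $\omega\in\hat A$. It is a unitary corepresentation of $(A,\Delta)$ on $\hat A$ with $\pi_U(\omega)=\omega$ for all $\omega\in\hat A$. 4. For every non-degenerate $^*$-algebra $B$, $V\mapsto\pi_V$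 is a bijection from the unitary corepresentations of $(A,\Delta)$ on $B$ onto the non-degenerate $^*$-homomorphisms $\hat A\to M(B)$, and $V=(\iota\odot\pi_V)(U)$ for every unitary corepresentation $V$ on $B$. -/

import Mathlib

open scoped TensorProduct

namespace QuantumGroup

/-! ### Non-degenerate algebras and multiplier algebras

All algebras are complex and need not have a unit. The tensor product `X ⊗[ℂ] Y` carries the
usual product `(x ⊗ y)(x' ⊗ y') = x x' ⊗ y y'` and, if `X` and `Y` are `*`-algebras, the usual
involution `(x ⊗ y)* = x* ⊗ y*`. -/

/-- An algebra is non-degenerate if `x X = 0` implies `x = 0`, and `X x = 0` implies `x = 0`. -/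
structure NonDegenerate (X : Type*) [NonUnitalNonAssocRing X] : Prop where
  left : ∀ x : X, (∀ y : X, x * y = 0) → x = 0
  right : ∀ x : X, (∀ y : X, y * x = 0) → x = 0

section Multiplier

variable (X : Type*) [NonUnitalNonAssocRing X] [Module ℂ X] [IsScalarTower ℂ X X]
  [SMulCommClass ℂ X X]

/-- The pairs `(L, R)` of linear maps on `X` with `R(x) y = x L(y)`, as a subalgebra of
`End(X) × End(X)ᵒᵖ`. -/
def multSubalgebra : Subalgebra ℂ (Module.End ℂ X × (Module.End ℂ X)ᵐᵒᵖ) where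
  carrier := {p | ∀ x y : X, p.2.unop x * y = x * p.1 y}
  mul_mem' := by
    intro p q hp hq x y
    have h1 := hp x (q.1 y)
    have h2 := hq (p.2.unop x) y
    simp only [Prod.fst_mul, Prod.snd_mul, MulOpposite.unop_mul, Module.End.mul_apply]
    rw [h2, h1]
  add_mem' := by
    intro p q hp hq x y
    simp only [Prod.fst_add, Prod.snd_add, MulOpposite.unop_add, LinearMap.add_apply, add_mul,
      mul_add]
    rw [hp, hq]
  algebraMap_mem' := by
    intro c x y
    simp [Module.algebraMap_end_apply, smul_mul_assoc, mul_smul_comm]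

/-- The multiplier algebra `M(X)` of a non-degenerate algebra `X`, i.e. the algebra of two-sided
multipliers: `m` is given by `x ↦ m x` (`Mult.L m`) and `x ↦ x m` (`Mult.R m`), subject to
`(x m) y = x (m y)`. -/
def Mult : Type _ := multSubalgebra X

noncomputable instance : Ring (Mult X) := inferInstanceAs (Ring (multSubalgebra X))

noncomputable instance : Algebra ℂ (Mult X) := inferInstanceAs (Algebra ℂ (multSubalgebra X))

end Multiplier

namespace Mult

section Basic

variable {X : Type*} [NonUnitalNonAssocRing X] [Module ℂ X] [IsScalarTower ℂ X X]
  [SMulCommClass ℂ X X]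

/-- `m.L x` is the product `m x` in `X`. -/
def L (m : Mult X) : X →ₗ[ℂ] X := m.1.1

/-- `m.R x` is the product `x m` in `X`. -/
def R (m : Mult X) : X →ₗ[ℂ] X := m.1.2.unop

/-- Constructor for multipliers. -/
def mk (l r : X →ₗ[ℂ] X) (h : ∀ x y, r x * y = x * l y) : Mult X :=
  ⟨(l, MulOpposite.op r), h⟩

theorem central (m : Mult X) (x y : X) : m.R x * y = x * m.L y := m.2 x y

@[ext] theorem ext {m n : Mult X} (h1 : m.L = n.L) (h2 : m.R = n.R) : m = n :=
  Subtype.ext (Prod.ext h1 (MulOpposite.unop_injective h2))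

@[simp] theorem L_mk (l r : X →ₗ[ℂ] X) (h) : (mk l r h).L = l := rfl
@[simp] theorem R_mk (l r : X →ₗ[ℂ] X) (h) : (mk l r h).R = r := rfl
@[simp] theorem L_one (x : X) : (1 : Mult X).L x = x := rfl
@[simp] theorem R_one (x : X) : (1 : Mult X).R x = x := rfl
@[simp] theorem L_mul (m n : Mult X) (x : X) : (m * n).L x = m.L (n.L x) := rfl
@[simp] theorem R_mul (m n : Mult X) (x : X) : (m * n).R x = n.R (m.R x) := rfl
@[simp] theorem L_add (m n : Mult X) : (m + n).L = m.L + n.L := rfl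
@[simp] theorem R_add (m n : Mult X) : (m + n).R = m.R + n.R := rfl
@[simp] theorem L_smul (c : ℂ) (m : Mult X) : (c • m).L = c • m.L := rfl
@[simp] theorem R_smul (c : ℂ) (m : Mult X) : (c • m).R = c • m.R := rfl

/-- In the multiplier algebra of a `*`-algebra, `m* x = (x* m)*` and `x m* = (m x*)*`. -/
noncomputable instance [StarRing X] [StarModule ℂ X] : Star (Mult X) where
  star m := mk
    ((starLinearEquiv ℂ (A := X)).toLinearMap.comp
      (m.R.comp (starLinearEquiv ℂ (A := X)).toLinearMap))
    ((starLinearEquiv ℂ (A := X)).toLinearMap.comp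
      (m.L.comp (starLinearEquiv ℂ (A := X)).toLinearMap))
    (by
      intro x y
      have h := congrArg star (m.central (star y) (star x))
      simpa using h.symm)

@[simp] theorem L_star [StarRing X] [StarModule ℂ X] (m : Mult X) (x : X) :
    (star m).L x = star (m.R (star x)) := rfl

@[simp] theorem R_star [StarRing X] [StarModule ℂ X] (m : Mult X) (x : X) :
    (star m).R x = star (m.L (star x)) := rfl

noncomputable instance [StarRing X] [StarModule ℂ X] : StarRing (Mult X) where
  star_involutive m := by ext x <;> simp
  star_mul m n := by ext x <;> simp
  star_add m n := by ext x <;> simp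

/-- The linear map `m ↦ m x`. -/
def applyL (x : X) : Mult X →ₗ[ℂ] X where
  toFun m := m.L x
  map_add' _ _ := rfl
  map_smul' _ _ := rfl

/-- The linear map `m ↦ x m`. -/
def applyR (x : X) : Mult X →ₗ[ℂ] X where
  toFun m := m.R x
  map_add' _ _ := rfl
  map_smul' _ _ := rfl

end Basic

section Embedding

variable {X : Type*} [NonUnitalRing X] [Module ℂ X] [IsScalarTower ℂ X X]
  [SMulCommClass ℂ X X]

/-- The canonical embedding of an (associative) algebra into its multiplier algebra. -/
def emb : X →ₗ[ℂ] Mult X where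
  toFun x := mk (LinearMap.mulLeft ℂ x) (LinearMap.mulRight ℂ x) (by simp [mul_assoc])
  map_add' x y := ext (LinearMap.ext fun z => add_mul x y z) (LinearMap.ext fun z => mul_add z x y)
  map_smul' c x := ext (LinearMap.ext fun z => smul_mul_assoc c x z)
    (LinearMap.ext fun z => mul_smul_comm c z x)

@[simp] theorem L_emb (x y : X) : (emb x).L y = x * y := rfl
@[simp] theorem R_emb (x y : X) : (emb x).R y = y * x := rfl

theorem emb_injective (h : NonDegenerate X) : Function.Injective (emb : X →ₗ[ℂ] Mult X) := by
  rw [injective_iff_map_eq_zero]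
  intro x hx
  refine h.left x fun y => ?_
  rw [← L_emb, hx]; rfl

theorem ext_L (h : NonDegenerate X) {m n : Mult X} (hl : ∀ x, m.L x = n.L x) : m = n := by
  refine ext (LinearMap.ext hl) (LinearMap.ext fun x => ?_)
  rw [← sub_eq_zero]
  refine h.left _ fun y => ?_
  rw [sub_mul, central, central, hl, sub_self]

theorem mul_emb (h : NonDegenerate X) (m : Mult X) (x : X) : m * emb x = emb (m.L x) := by
  refine ext_L h fun y => ?_
  simp only [L_mul, L_emb]
  rw [← sub_eq_zero]
  refine h.right _ fun z => ?_
  rw [mul_sub, ← central, ← mul_assoc, ← mul_assoc, central, sub_self]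

theorem emb_mul (h : NonDegenerate X) (m : Mult X) (x : X) : emb x * m = emb (m.R x) := by
  refine ext_L h fun y => ?_
  simp [central]

end Embedding

section Tensor

variable {X Y : Type*} [NonUnitalNonAssocRing X] [Module ℂ X] [IsScalarTower ℂ X X]
  [SMulCommClass ℂ X X] [NonUnitalNonAssocRing Y] [Module ℂ Y] [IsScalarTower ℂ Y Y]
  [SMulCommClass ℂ Y Y]

set_option linter.unusedSectionVars false in
theorem bilin_central {Z : Type*} [NonUnitalNonAssocRing Z] [Module ℂ Z] [IsScalarTower ℂ Z Z]
    [SMulCommClass ℂ Z Z] (l r : X ⊗[ℂ] Y →ₗ[ℂ] Z) (e f : X ⊗[ℂ] Y →ₗ[ℂ] Z)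
    (h : ∀ x y x' y', r (x ⊗ₜ[ℂ] y) * e (x' ⊗ₜ[ℂ] y') = f (x ⊗ₜ[ℂ] y) * l (x' ⊗ₜ[ℂ] y'))
    (s t : X ⊗[ℂ] Y) : r s * e t = f s * l t := by
  induction s with
  | zero => simp
  | add s s' hs hs' => simp [add_mul, hs, hs']
  | tmul x y =>
    induction t with
    | zero => simp
    | add t t' ht ht' => simp [mul_add, ht, ht']
    | tmul x' y' => exact h x y x' y'

/-- The multiplier `m ⊗ n` of `X ⊗ Y` for multipliers `m` of `X` and `n` of `Y`. -/
noncomputable def tmul (m : Mult X) (n : Mult Y) : Mult (X ⊗[ℂ] Y) :=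
  mk (TensorProduct.map m.L n.L) (TensorProduct.map m.R n.R) fun s t =>
    bilin_central (TensorProduct.map m.L n.L) (TensorProduct.map m.R n.R) LinearMap.id
      LinearMap.id (by intro x y x' y'; simp [central]) s t

@[simp] theorem L_tmul (m : Mult X) (n : Mult Y) :
    (tmul m n).L = TensorProduct.map m.L n.L := rfl
@[simp] theorem R_tmul (m : Mult X) (n : Mult Y) :
    (tmul m n).R = TensorProduct.map m.R n.R := rfl

/-- Transport of multipliers along an isomorphism of algebras. -/
noncomputable def congr (e : X ≃ₗ[ℂ] Y) (he : ∀ x y, e (x * y) = e x * e y) (m : Mult X) :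
    Mult Y :=
  mk (e.toLinearMap ∘ₗ m.L ∘ₗ e.symm.toLinearMap) (e.toLinearMap ∘ₗ m.R ∘ₗ e.symm.toLinearMap)
    (by
      intro x y
      have h := congrArg e (m.central (e.symm x) (e.symm y))
      simpa [he] using h)

end Tensor

end Mult

section Legs

variable {X Y Z : Type*} [NonUnitalNonAssocRing X] [Module ℂ X] [IsScalarTower ℂ X X]
  [SMulCommClass ℂ X X] [NonUnitalNonAssocRing Y] [Module ℂ Y] [IsScalarTower ℂ Y Y]
  [SMulCommClass ℂ Y Y] [NonUnitalNonAssocRing Z] [Module ℂ Z] [IsScalarTower ℂ Z Z]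
  [SMulCommClass ℂ Z Z]

theorem assoc_mul (s t : (X ⊗[ℂ] Y) ⊗[ℂ] Z) :
    TensorProduct.assoc ℂ X Y Z (s * t) =
      TensorProduct.assoc ℂ X Y Z s * TensorProduct.assoc ℂ X Y Z t := by
  have h : (LinearMap.mul ℂ ((X ⊗[ℂ] Y) ⊗[ℂ] Z)).compr₂ (TensorProduct.assoc ℂ X Y Z).toLinearMap
      = (LinearMap.mul ℂ (X ⊗[ℂ] (Y ⊗[ℂ] Z))).compl₁₂ (TensorProduct.assoc ℂ X Y Z).toLinearMap
        (TensorProduct.assoc ℂ X Y Z).toLinearMap := by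
    ext x y z x' y' z'
    simp
  exact LinearMap.congr_fun (LinearMap.congr_fun h s) t

theorem rightComm_mul (s t : (X ⊗[ℂ] Y) ⊗[ℂ] Z) :
    TensorProduct.rightComm ℂ X Y Z (s * t) =
      TensorProduct.rightComm ℂ X Y Z s * TensorProduct.rightComm ℂ X Y Z t := by
  have h : (LinearMap.mul ℂ ((X ⊗[ℂ] Y) ⊗[ℂ] Z)).compr₂
        (TensorProduct.rightComm ℂ X Y Z).toLinearMap
      = (LinearMap.mul ℂ ((X ⊗[ℂ] Z) ⊗[ℂ] Y)).compl₁₂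
        (TensorProduct.rightComm ℂ X Y Z).toLinearMap
        (TensorProduct.rightComm ℂ X Y Z).toLinearMap := by
    ext x y z x' y' z'
    simp
  exact LinearMap.congr_fun (LinearMap.congr_fun h s) t

/-- The identification `M((X ⊗ Y) ⊗ Z) = M(X ⊗ (Y ⊗ Z))`. -/
noncomputable def Mult.assoc (m : Mult ((X ⊗[ℂ] Y) ⊗[ℂ] Z)) : Mult (X ⊗[ℂ] (Y ⊗[ℂ] Z)) :=
  m.congr (TensorProduct.assoc ℂ X Y Z) assoc_mul

/-- The leg-numbering `V₁₃ ∈ M(X ⊗ Y ⊗ Z)` of `V ∈ M(X ⊗ Z)`. -/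
noncomputable def leg13 (V : Mult (X ⊗[ℂ] Z)) : Mult ((X ⊗[ℂ] Y) ⊗[ℂ] Z) :=
  (Mult.tmul V (1 : Mult Y)).congr (TensorProduct.rightComm ℂ X Z Y) rightComm_mul

/-- The leg-numbering `V₂₃ = 1 ⊗ V ∈ M(X ⊗ Y ⊗ Z)` of `V ∈ M(Y ⊗ Z)`. -/
noncomputable def leg23 (V : Mult (Y ⊗[ℂ] Z)) : Mult ((X ⊗[ℂ] Y) ⊗[ℂ] Z) :=
  (Mult.tmul (1 : Mult X) V).congr (TensorProduct.assoc ℂ X Y Z).symm (by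
    intro s t
    apply (TensorProduct.assoc ℂ X Y Z).injective
    rw [assoc_mul]
    simp)

/-- A linear map `π : X → M(Y)` is non-degenerate if `π(X) Y = Y` and `Y π(X) = Y` (linear
spans). -/
def IsNonDegenerate (π : X →ₗ[ℂ] Mult Y) : Prop :=
  Submodule.span ℂ {z : Y | ∃ x y, z = (π x).L y} = ⊤ ∧
    Submodule.span ℂ {z : Y | ∃ x y, z = (π x).R y} = ⊤

/-- `W = (π ⊙ ι)(V)` in `M(Z ⊗ Y)`, for a non-degenerate homomorphism `π : X → M(Z)` and
`V ∈ M(X ⊗ Y)`. The extension of `π ⊙ ι` to multipliers is determined by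
`(π ⊙ ι)(V) (π(x) z ⊗ y) = (π ⊙ ι)(V (x ⊗ y)) (z ⊗ 1)` and
`(z π(x) ⊗ y) (π ⊙ ι)(V) = (z ⊗ 1) (π ⊙ ι)((x ⊗ y) V)`, because the elements `π(x) z`, as well as
the elements `z π(x)`, span `Z`. -/
def IsMapFst (π : X →ₗ[ℂ] Mult Z) (V : Mult (X ⊗[ℂ] Y)) (W : Mult (Z ⊗[ℂ] Y)) : Prop :=
  ∀ (x : X) (z : Z) (y : Y),
    W.L ((π x).L z ⊗ₜ[ℂ] y) = LinearMap.rTensor Y (Mult.applyL z ∘ₗ π) (V.L (x ⊗ₜ[ℂ] y)) ∧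
    W.R ((π x).R z ⊗ₜ[ℂ] y) = LinearMap.rTensor Y (Mult.applyR z ∘ₗ π) (V.R (x ⊗ₜ[ℂ] y))

/-- `W = (ι ⊙ π)(V)` in `M(Y ⊗ Z)`, for a non-degenerate homomorphism `π : X → M(Z)` and
`V ∈ M(Y ⊗ X)`; the mirror image of `IsMapFst`. -/
def IsMapSnd (π : X →ₗ[ℂ] Mult Z) (V : Mult (Y ⊗[ℂ] X)) (W : Mult (Y ⊗[ℂ] Z)) : Prop :=
  ∀ (x : X) (z : Z) (y : Y),
    W.L (y ⊗ₜ[ℂ] (π x).L z) = LinearMap.lTensor Y (Mult.applyL z ∘ₗ π) (V.L (y ⊗ₜ[ℂ] x)) ∧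
    W.R (y ⊗ₜ[ℂ] (π x).R z) = LinearMap.lTensor Y (Mult.applyR z ∘ₗ π) (V.R (y ⊗ₜ[ℂ] x))

end Legs

section Slices

variable {X Y : Type*} [AddCommGroup X] [Module ℂ X] [AddCommGroup Y] [Module ℂ Y]

/-- `ω ⊙ ι : X ⊗ Y → Y`. -/
noncomputable def sliceFst (ω : Module.Dual ℂ X) : X ⊗[ℂ] Y →ₗ[ℂ] Y :=
  (TensorProduct.lid ℂ Y).toLinearMap ∘ₗ LinearMap.rTensor Y ω

/-- `ι ⊙ ω : X ⊗ Y → X`. -/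
noncomputable def sliceSnd (ω : Module.Dual ℂ Y) : X ⊗[ℂ] Y →ₗ[ℂ] X :=
  (TensorProduct.rid ℂ X).toLinearMap ∘ₗ LinearMap.lTensor X ω

@[simp] theorem sliceFst_tmul (ω : Module.Dual ℂ X) (x : X) (y : Y) :
    sliceFst ω (x ⊗ₜ[ℂ] y) = ω x • y := by simp [sliceFst]

@[simp] theorem sliceSnd_tmul (ω : Module.Dual ℂ Y) (x : X) (y : Y) :
    sliceSnd ω (x ⊗ₜ[ℂ] y) = ω y • x := by simp [sliceSnd]

theorem eq_zero_of_sliceSnd (t : X ⊗[ℂ] Y) (h : ∀ ω : Module.Dual ℂ Y, sliceSnd ω t = 0) :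
    t = 0 := by
  classical
  let b := Module.Basis.ofVectorSpace ℂ Y
  apply (TensorProduct.equivFinsuppOfBasisRight (M := X) b).injective
  rw [map_zero]
  ext i
  rw [TensorProduct.equivFinsuppOfBasisRight_apply]
  exact h (b.coord i)

theorem eq_zero_of_sliceFst (t : X ⊗[ℂ] Y) (h : ∀ ω : Module.Dual ℂ X, sliceFst ω t = 0) :
    t = 0 := by
  classical
  let b := Module.Basis.ofVectorSpace ℂ X
  apply (TensorProduct.equivFinsuppOfBasisLeft (N := Y) b).injective
  rw [map_zero]
  ext i
  rw [TensorProduct.equivFinsuppOfBasisLeft_apply]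
  exact h (b.coord i)

end Slices

section SlicesMul

variable {X Y : Type*} [NonUnitalNonAssocRing X] [Module ℂ X] [IsScalarTower ℂ X X]
  [SMulCommClass ℂ X X] [NonUnitalNonAssocRing Y] [Module ℂ Y] [IsScalarTower ℂ Y Y]
  [SMulCommClass ℂ Y Y]

set_option linter.unusedSectionVars false in
theorem eq_zero_of_maps (ls : Set (X →ₗ[ℂ] X)) (hl : ∀ x, (∀ l ∈ ls, l x = 0) → x = 0)
    (rs : Set (Y →ₗ[ℂ] Y)) (hr : ∀ y, (∀ r ∈ rs, r y = 0) → y = 0) (t : X ⊗[ℂ] Y)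
    (h : ∀ l ∈ ls, ∀ r ∈ rs, TensorProduct.map l r t = 0) : t = 0 := by
  refine eq_zero_of_sliceFst t fun ω => hr _ fun r hr' => ?_
  have h1 : LinearMap.lTensor X r t = 0 := by
    refine eq_zero_of_sliceSnd _ fun η => hl _ fun l hl' => ?_
    have h2 : l ∘ₗ sliceSnd η ∘ₗ LinearMap.lTensor X r
        = sliceSnd η ∘ₗ TensorProduct.map l r := by
      ext x y; simp
    have h3 := LinearMap.congr_fun h2 t
    simpa [h l hl' r hr'] using h3
  have h4 : r ∘ₗ sliceFst ω = sliceFst ω ∘ₗ LinearMap.lTensor X r := by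
    ext x y; simp
  have h5 := LinearMap.congr_fun h4 t
  simpa [h1] using h5

theorem NonDegenerate.tensor (hX : NonDegenerate X) (hY : NonDegenerate Y) :
    NonDegenerate (X ⊗[ℂ] Y) where
  left t ht := by
    refine eq_zero_of_maps (Set.range fun x => LinearMap.mulRight ℂ x)
      (fun x hx => hX.left x fun y => hx _ ⟨y, rfl⟩) (Set.range fun y => LinearMap.mulRight ℂ y)
      (fun x hx => hY.left x fun y => hx _ ⟨y, rfl⟩) t ?_
    rintro _ ⟨x, rfl⟩ _ ⟨y, rfl⟩
    rw [← ht (x ⊗ₜ y)]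
    exact (LinearMap.congr_fun (LinearMap.mulRight_tmul x y) t).symm
  right t ht := by
    refine eq_zero_of_maps (Set.range fun x => LinearMap.mulLeft ℂ x)
      (fun x hx => hX.right x fun y => hx _ ⟨y, rfl⟩) (Set.range fun y => LinearMap.mulLeft ℂ y)
      (fun x hx => hY.right x fun y => hx _ ⟨y, rfl⟩) t ?_
    rintro _ ⟨x, rfl⟩ _ ⟨y, rfl⟩
    rw [← ht (x ⊗ₜ y)]
    exact (LinearMap.congr_fun (LinearMap.mulLeft_tmul x y) t).symm

end SlicesMul

/-! ### `*`-algebraic quantum groups -/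

/-- A multiplier Hopf `*`-algebra structure on the `*`-algebra `A`: a non-degenerate
`*`-homomorphism `Δ : A → M(A ⊗ A)` (with `A` non-degenerate) which is coassociative and for which
`a ⊗ b ↦ Δ(a)(b ⊗ 1)` and `a ⊗ b ↦ Δ(a)(1 ⊗ b)` are bijections from `A ⊗ A` to `A ⊗ A`. -/
structure MultiplierHopfStar (A : Type*) [NonUnitalRing A] [Module ℂ A] [IsScalarTower ℂ A A]
    [SMulCommClass ℂ A A] [StarRing A] [StarModule ℂ A] where
  /-- the comultiplication `Δ` -/
  comul : A →⋆ₙₐ[ℂ] Mult (A ⊗[ℂ] A)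
  nonDegenerate : NonDegenerate A
  comul_nonDegenerate : IsNonDegenerate (comul : A →ₗ[ℂ] Mult (A ⊗[ℂ] A))
  /-- `(Δ ⊙ ι)(Δ(a)) = (ι ⊙ Δ)(Δ(a))` in `M(A ⊗ A ⊗ A)` -/
  coassoc : ∀ a, ∃ W : Mult ((A ⊗[ℂ] A) ⊗[ℂ] A),
    IsMapFst (comul : A →ₗ[ℂ] Mult (A ⊗[ℂ] A)) (comul a) W ∧
      IsMapSnd (comul : A →ₗ[ℂ] Mult (A ⊗[ℂ] A)) (comul a) W.assoc
  exists_T1 : ∃ T : A ⊗[ℂ] A ≃ₗ[ℂ] A ⊗[ℂ] A, ∀ a b,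
    Mult.emb (T (a ⊗ₜ b)) = comul a * Mult.tmul (Mult.emb b) 1
  exists_T2 : ∃ T : A ⊗[ℂ] A ≃ₗ[ℂ] A ⊗[ℂ] A, ∀ a b,
    Mult.emb (T (a ⊗ₜ b)) = comul a * Mult.tmul 1 (Mult.emb b)

namespace MultiplierHopfStar

variable {A : Type*} [NonUnitalRing A] [Module ℂ A] [IsScalarTower ℂ A A]
  [SMulCommClass ℂ A A] [StarRing A] [StarModule ℂ A] (G : MultiplierHopfStar A)

/-- `T1 (a ⊗ b) = Δ(a)(b ⊗ 1)` in `A ⊗ A`. -/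
noncomputable def T1 : A ⊗[ℂ] A ≃ₗ[ℂ] A ⊗[ℂ] A := G.exists_T1.choose

/-- `T2 (a ⊗ b) = Δ(a)(1 ⊗ b)` in `A ⊗ A`. -/
noncomputable def T2 : A ⊗[ℂ] A ≃ₗ[ℂ] A ⊗[ℂ] A := G.exists_T2.choose

/-- `T3 (a ⊗ b) = (b ⊗ 1)Δ(a) = (Δ(a*)(b* ⊗ 1))*` in `A ⊗ A`. -/
noncomputable def T3 : A ⊗[ℂ] A →ₗ[ℂ] A ⊗[ℂ] A :=
  (starLinearEquiv ℂ (A := A ⊗[ℂ] A)).toLinearMap.comp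
    (G.T1.toLinearMap.comp (starLinearEquiv ℂ (A := A ⊗[ℂ] A)).toLinearMap)

/-- `T4 (a ⊗ b) = (1 ⊗ b)Δ(a) = (Δ(a*)(1 ⊗ b*))*` in `A ⊗ A`. -/
noncomputable def T4 : A ⊗[ℂ] A →ₗ[ℂ] A ⊗[ℂ] A :=
  (starLinearEquiv ℂ (A := A ⊗[ℂ] A)).toLinearMap.comp
    (G.T2.toLinearMap.comp (starLinearEquiv ℂ (A := A ⊗[ℂ] A)).toLinearMap)

theorem emb_T1 (a b : A) :
    Mult.emb (G.T1 (a ⊗ₜ b)) = G.comul a * Mult.tmul (Mult.emb b) 1 := G.exists_T1.choose_spec a b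

theorem emb_T2 (a b : A) :
    Mult.emb (G.T2 (a ⊗ₜ b)) = G.comul a * Mult.tmul 1 (Mult.emb b) := G.exists_T2.choose_spec a b

theorem emb_star {X : Type*} [NonUnitalRing X] [Module ℂ X] [IsScalarTower ℂ X X]
    [SMulCommClass ℂ X X] [StarRing X] [StarModule ℂ X] (x : X) :
    Mult.emb (star x) = star (Mult.emb x) :=
  Mult.ext (LinearMap.ext fun y => by simp) (LinearMap.ext fun y => by simp)

theorem star_tmul {X Y : Type*} [NonUnitalRing X] [Module ℂ X] [IsScalarTower ℂ X X]
    [SMulCommClass ℂ X X] [StarRing X] [StarModule ℂ X] [NonUnitalRing Y] [Module ℂ Y]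
    [IsScalarTower ℂ Y Y] [SMulCommClass ℂ Y Y] [StarRing Y] [StarModule ℂ Y]
    (m : Mult X) (n : Mult Y) : star (Mult.tmul m n) = Mult.tmul (star m) (star n) := by
  refine Mult.ext (TensorProduct.ext' fun x y => ?_) (TensorProduct.ext' fun x y => ?_) <;> simp

theorem emb_T3 (a b : A) :
    Mult.emb (G.T3 (a ⊗ₜ b)) = Mult.tmul (Mult.emb b) 1 * G.comul a := by
  have h : G.T3 (a ⊗ₜ b) = star (G.T1 (star a ⊗ₜ star b)) := rfl
  rw [h, emb_star, emb_T1, star_mul, star_tmul, emb_star, map_star, star_star, star_star, star_one]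

theorem emb_T4 (a b : A) :
    Mult.emb (G.T4 (a ⊗ₜ b)) = Mult.tmul 1 (Mult.emb b) * G.comul a := by
  have h : G.T4 (a ⊗ₜ b) = star (G.T2 (star a ⊗ₜ star b)) := rfl
  rw [h, emb_star, emb_T2, star_mul, star_tmul, emb_star, map_star, star_star, star_star, star_one]

theorem embAA_injective (G : MultiplierHopfStar A) :
    Function.Injective (Mult.emb : A ⊗[ℂ] A →ₗ[ℂ] Mult (A ⊗[ℂ] A)) :=
  Mult.emb_injective (G.nonDegenerate.tensor G.nonDegenerate)

theorem central12 (a b c : A) :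
    (Mult.tmul 1 (Mult.emb c)).R (G.T4 (a ⊗ₜ b)) =
      (Mult.tmul 1 (Mult.emb b)).L (G.T2 (a ⊗ₜ c)) := by
  apply G.embAA_injective
  have h := G.nonDegenerate.tensor G.nonDegenerate
  rw [← Mult.emb_mul h, ← Mult.mul_emb h, emb_T4, emb_T2, mul_assoc]

theorem central13 (a b c : A) :
    (Mult.tmul (Mult.emb c) 1).R (G.T3 (a ⊗ₜ b)) =
      (Mult.tmul (Mult.emb b) 1).L (G.T1 (a ⊗ₜ c)) := by
  apply G.embAA_injective
  have h := G.nonDegenerate.tensor G.nonDegenerate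
  rw [← Mult.emb_mul h, ← Mult.mul_emb h, emb_T3, emb_T1, mul_assoc]

/-- `(ω ⊙ ι)Δ(a) ∈ M(A)`: `[(ω ⊙ ι)Δ(a)] b = (ω ⊙ ι)(Δ(a)(1 ⊗ b))` and
`b [(ω ⊙ ι)Δ(a)] = (ω ⊙ ι)((1 ⊗ b)Δ(a))`. -/
noncomputable def sliceL (ω : Module.Dual ℂ A) (a : A) : Mult A :=
  Mult.mk (sliceFst ω ∘ₗ G.T2.toLinearMap ∘ₗ TensorProduct.mk ℂ A A a)
    (sliceFst ω ∘ₗ G.T4 ∘ₗ TensorProduct.mk ℂ A A a) (by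
      intro x y
      have h1 : LinearMap.mulRight ℂ y ∘ₗ sliceFst ω
          = sliceFst ω ∘ₗ (Mult.tmul 1 (Mult.emb y)).R := by
        ext p q; simp
      have h2 : LinearMap.mulLeft ℂ x ∘ₗ sliceFst ω
          = sliceFst ω ∘ₗ (Mult.tmul 1 (Mult.emb x)).L := by
        ext p q; simp
      have h3 := LinearMap.congr_fun h1 (G.T4 (a ⊗ₜ x))
      have h4 := LinearMap.congr_fun h2 (G.T2 (a ⊗ₜ y))
      simp only [LinearMap.comp_apply, LinearMap.mulRight_apply, LinearMap.mulLeft_apply] at h3 h4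
      simp only [LinearMap.comp_apply, TensorProduct.mk_apply, LinearEquiv.coe_coe]
      rw [h3, h4, central12])

/-- `(ι ⊙ ω)Δ(a) ∈ M(A)`: `[(ι ⊙ ω)Δ(a)] b = (ι ⊙ ω)(Δ(a)(b ⊗ 1))` and
`b [(ι ⊙ ω)Δ(a)] = (ι ⊙ ω)((b ⊗ 1)Δ(a))`. -/
noncomputable def sliceR (ω : Module.Dual ℂ A) (a : A) : Mult A :=
  Mult.mk (sliceSnd ω ∘ₗ G.T1.toLinearMap ∘ₗ TensorProduct.mk ℂ A A a)
    (sliceSnd ω ∘ₗ G.T3 ∘ₗ TensorProduct.mk ℂ A A a) (by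
      intro x y
      have h1 : LinearMap.mulRight ℂ y ∘ₗ sliceSnd ω
          = sliceSnd ω ∘ₗ (Mult.tmul (Mult.emb y) 1).R := by
        ext p q; simp
      have h2 : LinearMap.mulLeft ℂ x ∘ₗ sliceSnd ω
          = sliceSnd ω ∘ₗ (Mult.tmul (Mult.emb x) 1).L := by
        ext p q; simp
      have h3 := LinearMap.congr_fun h1 (G.T3 (a ⊗ₜ x))
      have h4 := LinearMap.congr_fun h2 (G.T1 (a ⊗ₜ y))
      simp only [LinearMap.comp_apply, LinearMap.mulRight_apply, LinearMap.mulLeft_apply] at h3 h4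
      simp only [LinearMap.comp_apply, TensorProduct.mk_apply, LinearEquiv.coe_coe]
      rw [h3, h4, central13])

/-- `ε` is the counit: a non-zero homomorphism `A → ℂ` with `(ε ⊙ ι)Δ = (ι ⊙ ε)Δ = ι`. -/
def IsCounit (ε : A →ₙₐ[ℂ] ℂ) : Prop :=
  ε ≠ 0 ∧ ∀ a, G.sliceL (ε : A →ₗ[ℂ] ℂ) a = Mult.emb a ∧ G.sliceR (ε : A →ₗ[ℂ] ℂ) a = Mult.emb a

/-- `S` is the antipode: an anti-automorphism of the algebra `A` such that, for the counit `ε`,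
`m(S ⊙ ι)(Δ(a)(1 ⊗ b)) = ε(a) b` and `m(ι ⊙ S)((b ⊗ 1)Δ(a)) = ε(a) b`, where `m` is the
multiplication map. -/
def IsAntipode (S : A ≃ₗ[ℂ] A) : Prop :=
  (∀ a b, S (a * b) = S b * S a) ∧ ∃ ε : A →ₙₐ[ℂ] ℂ, G.IsCounit ε ∧ ∀ a b,
    LinearMap.mul' ℂ A (LinearMap.rTensor A S.toLinearMap (G.T2 (a ⊗ₜ b))) = ε a • b ∧
      LinearMap.mul' ℂ A (LinearMap.lTensor A S.toLinearMap (G.T3 (a ⊗ₜ b))) = ε a • b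

end MultiplierHopfStar

/-- A `*`-algebraic quantum group `(A, Δ)` together with a self-adjoint left Haar functional, i.e.
a non-zero functional `φ` with `(ι ⊙ φ)Δ(a) = φ(a) 1` and `φ(a*) = conj (φ(a))`. -/
structure StarQuantumGroup (A : Type*) [NonUnitalRing A] [Module ℂ A] [IsScalarTower ℂ A A]
    [SMulCommClass ℂ A A] [StarRing A] [StarModule ℂ A] extends MultiplierHopfStar A where
  /-- the left Haar functional `φ` -/
  haar : Module.Dual ℂ A
  haar_ne_zero : haar ≠ 0
  haar_leftInvariant : ∀ a, toMultiplierHopfStar.sliceR haar a = haar a • 1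
  haar_selfAdjoint : ∀ a, haar (star a) = starRingEnd ℂ (haar a)

namespace StarQuantumGroup

variable {A : Type*} [NonUnitalRing A] [Module ℂ A] [IsScalarTower ℂ A A]
  [SMulCommClass ℂ A A] [StarRing A] [StarModule ℂ A] (G : StarQuantumGroup A)

/-- The linear map `a ↦ φ a` from `A` to its algebraic dual, where `(φ a)(x) = φ(a x)`. -/
def haarMul : A →ₗ[ℂ] Module.Dual ℂ A := (LinearMap.mul ℂ A).compr₂ G.haar

@[simp] theorem haarMul_apply (a x : A) : G.haarMul a x = G.haar (a * x) := rfl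

/-- The dual space `Â = {φ a | a ∈ A}`. -/
abbrev Dual : Type _ := ↥(LinearMap.range G.haarMul)

theorem emb_slice_T4 (a x : A) :
    Mult.emb (sliceSnd G.haar (G.T4 (x ⊗ₜ a))) = G.sliceR (G.haarMul a) x := by
  refine Mult.ext_L G.nonDegenerate fun b => ?_
  have h1 : LinearMap.mulRight ℂ b ∘ₗ sliceSnd G.haar
      = sliceSnd G.haar ∘ₗ (Mult.tmul (Mult.emb b) 1).R := by
    ext p q; simp
  have h2 : sliceSnd (X := A) (G.haarMul a)
      = sliceSnd G.haar ∘ₗ (Mult.tmul (1 : Mult A) (Mult.emb a)).L := by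
    ext p q; simp
  have h3 := LinearMap.congr_fun h1 (G.T4 (x ⊗ₜ a))
  have h5 : (Mult.tmul (Mult.emb b) 1).R (G.T4 (x ⊗ₜ a)) =
      (Mult.tmul 1 (Mult.emb a)).L (G.T1 (x ⊗ₜ b)) := by
    apply G.embAA_injective
    have h := G.nonDegenerate.tensor G.nonDegenerate
    rw [← Mult.emb_mul h, ← Mult.mul_emb h, G.emb_T4, G.emb_T1, mul_assoc]
  simp only [LinearMap.comp_apply, LinearMap.mulRight_apply] at h3
  simp only [Mult.L_emb, MultiplierHopfStar.sliceR, Mult.L_mk, LinearMap.comp_apply,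
    TensorProduct.mk_apply, LinearEquiv.coe_coe]
  rw [h3, h5, h2]; rfl

theorem exists_slice (ω : G.Dual) (x : A) :
    ∃ y, Mult.emb y = G.sliceR (ω : Module.Dual ℂ A) x := by
  obtain ⟨_, a, rfl⟩ := ω
  exact ⟨_, G.emb_slice_T4 a x⟩

/-- `(ι ⊙ ω)Δ(x)` as an element of `A`, for `ω ∈ Â`. -/
noncomputable def sliceElem (ω : G.Dual) (x : A) : A := (G.exists_slice ω x).choose

theorem emb_sliceElem (ω : G.Dual) (x : A) :
    Mult.emb (G.sliceElem ω x) = G.sliceR (ω : Module.Dual ℂ A) x := (G.exists_slice ω x).choose_spec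

theorem sliceElem_eq (ω : G.Dual) (x y : A)
    (h : ∀ b, y * b = sliceSnd (ω : Module.Dual ℂ A) (G.T1 (x ⊗ₜ b))) :
    G.sliceElem ω x = y := by
  apply Mult.emb_injective G.nonDegenerate
  rw [emb_sliceElem]
  exact Mult.ext_L G.nonDegenerate fun b => (h b).symm

theorem sliceElem_mul (ω : G.Dual) (x b : A) :
    G.sliceElem ω x * b = sliceSnd (ω : Module.Dual ℂ A) (G.T1 (x ⊗ₜ b)) := by
  rw [← Mult.L_emb, emb_sliceElem]; rfl

theorem sliceSnd_add {X Y : Type*} [AddCommGroup X] [Module ℂ X] [AddCommGroup Y] [Module ℂ Y]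
    (ω η : Module.Dual ℂ Y) (t : X ⊗[ℂ] Y) :
    sliceSnd (ω + η) t = sliceSnd ω t + sliceSnd η t := by
  simp [sliceSnd, LinearMap.lTensor_add]

theorem sliceSnd_smul {X Y : Type*} [AddCommGroup X] [Module ℂ X] [AddCommGroup Y] [Module ℂ Y]
    (c : ℂ) (ω : Module.Dual ℂ Y) (t : X ⊗[ℂ] Y) :
    sliceSnd (c • ω) t = c • sliceSnd ω t := by
  simp [sliceSnd, LinearMap.lTensor_smul]

/-- The bilinear map `(ω, x) ↦ (ι ⊙ ω)Δ(x)`. -/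
noncomputable def sliceElemLinear : G.Dual →ₗ[ℂ] A →ₗ[ℂ] A :=
  LinearMap.mk₂ ℂ G.sliceElem
    (fun ω η x => G.sliceElem_eq _ _ _ fun b => by
      simp [add_mul, sliceElem_mul, sliceSnd_add])
    (fun c ω x => G.sliceElem_eq _ _ _ fun b => by
      simp [smul_mul_assoc, sliceElem_mul, sliceSnd_smul])
    (fun ω x y => G.sliceElem_eq _ _ _ fun b => by
      simp [add_mul, sliceElem_mul, TensorProduct.add_tmul])
    (fun c ω x => G.sliceElem_eq _ _ _ fun b => by
      simp [smul_mul_assoc, sliceElem_mul, ← TensorProduct.smul_tmul'])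

theorem haar_slice_T3 (t : A ⊗[ℂ] A) :
    sliceSnd G.haar (G.T3 t) = sliceFst G.haar t := by
  have h : sliceSnd G.haar ∘ₗ G.T3 = sliceFst G.haar := by
    refine TensorProduct.ext' fun a b => ?_
    have h1 := LinearMap.congr_fun (congrArg Mult.R (G.haar_leftInvariant a)) b
    simpa [MultiplierHopfStar.sliceR] using h1
  exact LinearMap.congr_fun h t

theorem T3_surjective : Function.Surjective G.T3 := by
  intro t
  refine ⟨star (G.T1.symm (star t)), ?_⟩
  have h : ∀ s, G.T3 s = star (G.T1 (star s)) := fun s => rfl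
  rw [h]; simp

theorem mul_mem (ω η : G.Dual) :
    (ω : Module.Dual ℂ A) ∘ₗ G.sliceElemLinear η ∈ LinearMap.range G.haarMul := by
  obtain ⟨_, a, rfl⟩ := ω
  obtain ⟨_, b, rfl⟩ := η
  obtain ⟨s, hs⟩ := G.T3_surjective (a ⊗ₜ b)
  refine ⟨sliceSnd G.haar s, LinearMap.ext fun x => ?_⟩
  have hnd := G.nonDegenerate.tensor G.nonDegenerate
  have hy : G.sliceElem ⟨G.haarMul b, b, rfl⟩ x = sliceSnd G.haar (G.T4 (x ⊗ₜ b)) := by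
    apply Mult.emb_injective G.nonDegenerate
    rw [emb_sliceElem, emb_slice_T4]
  change G.haar (sliceSnd G.haar s * x) = G.haar (a * G.sliceElem ⟨G.haarMul b, b, rfl⟩ x)
  have h1 : LinearMap.mulLeft ℂ a ∘ₗ sliceSnd G.haar
      = sliceSnd G.haar ∘ₗ (Mult.tmul (Mult.emb a) 1).L := by
    ext p q; simp
  have h2 : a * sliceSnd G.haar (G.T4 (x ⊗ₜ b))
      = sliceSnd G.haar ((Mult.tmul (Mult.emb a) 1).L (G.T4 (x ⊗ₜ b))) :=
    LinearMap.congr_fun h1 _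
  have h3 : (Mult.tmul (Mult.emb a) 1).L (G.T4 (x ⊗ₜ b)) = (G.comul x).R (a ⊗ₜ b) := by
    apply G.embAA_injective
    rw [← Mult.mul_emb hnd, ← Mult.emb_mul hnd, G.emb_T4, ← mul_assoc]
    congr 1
    refine Mult.ext_L hnd fun t => ?_
    induction t with
    | zero => simp
    | add t t' ht ht' => rw [map_add, map_add, ht, ht']
    | tmul p q => simp
  have h4 : (G.comul x).R ∘ₗ G.T3 = G.T3 ∘ₗ LinearMap.rTensor A (LinearMap.mulRight ℂ x) := by
    refine TensorProduct.ext' fun p q => G.embAA_injective ?_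
    simp only [LinearMap.comp_apply, LinearMap.rTensor_tmul, LinearMap.mulRight_apply]
    rw [← Mult.emb_mul hnd, G.emb_T3, G.emb_T3, map_mul, mul_assoc]
  have h5 : (G.comul x).R (a ⊗ₜ b)
      = G.T3 (LinearMap.rTensor A (LinearMap.mulRight ℂ x) s) := by
    rw [← hs]; exact LinearMap.congr_fun h4 s
  rw [hy, h2, h3, h5, haar_slice_T3]
  have h6 : G.haar ∘ₗ LinearMap.mulRight ℂ x ∘ₗ sliceSnd G.haar
      = G.haar ∘ₗ sliceFst G.haar ∘ₗ LinearMap.rTensor A (LinearMap.mulRight ℂ x) := by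
    ext p q; simp [mul_comm]
  exact LinearMap.congr_fun h6 s

/-- The product of `Â`: `(ω η)(x) = ω((ι ⊙ η)Δ(x))`. -/
noncomputable instance : NonUnitalNonAssocRing G.Dual where
  mul ω η := ⟨(ω : Module.Dual ℂ A) ∘ₗ G.sliceElemLinear η, G.mul_mem ω η⟩
  left_distrib ω η θ := Subtype.ext (LinearMap.ext fun x => by
    change ω.1 (G.sliceElemLinear (η + θ) x)
      = ω.1 (G.sliceElemLinear η x) + ω.1 (G.sliceElemLinear θ x)
    simp)
  right_distrib _ _ _ := rfl
  zero_mul _ := rfl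
  mul_zero ω := Subtype.ext (LinearMap.ext fun x => by
    change ω.1 (G.sliceElemLinear 0 x) = 0
    simp)

theorem mul_apply (ω η : G.Dual) (x : A) :
    (ω * η : G.Dual).1 x = ω.1 (G.sliceElem η x) := rfl

instance : IsScalarTower ℂ G.Dual G.Dual := ⟨fun _ _ _ => rfl⟩

instance : SMulCommClass ℂ G.Dual G.Dual := ⟨fun c ω η => Subtype.ext (LinearMap.ext fun x => by
  change c • ω.1 (G.sliceElemLinear η x) = ω.1 (G.sliceElemLinear (c • η) x)
  simp)⟩

/-- The multiplier `T` of `Â` is implemented by the functional `θ` on `A`: for all `ω ∈ Â` and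
`x ∈ A`, `(T ω)(x) = θ((ι ⊙ ω)Δ(x))` and `(ω T)(x) = θ((ω ⊙ ι)Δ(x))`. -/
def IsImplementedBy (T : Mult G.Dual) (θ : Module.Dual ℂ A) : Prop :=
  ∀ (ω : G.Dual) (x y : A),
    (Mult.emb y = G.sliceR (ω : Module.Dual ℂ A) x → (T.L ω).1 x = θ y) ∧
    (Mult.emb y = G.sliceL (ω : Module.Dual ℂ A) x → (T.R ω).1 x = θ y)

/-- The space of functionals `θ` on `A` such that `(θ ⊙ ι)Δ(a)` and `(ι ⊙ θ)Δ(a)` belong to `A`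
for all `a ∈ A`. -/
def IsDualMultiplier (θ : Module.Dual ℂ A) : Prop :=
  ∀ a, (∃ y, Mult.emb y = G.sliceL θ a) ∧ ∃ y, Mult.emb y = G.sliceR θ a

section Corepresentations

variable {B : Type*} [NonUnitalNonAssocRing B] [Module ℂ B] [IsScalarTower ℂ B B]
  [SMulCommClass ℂ B B]

/-- `V ∈ M(A ⊗ B)` is a corepresentation of `(A, Δ)` on `B`: `(Δ ⊙ ι)(V) = V₁₃ V₂₃`. -/
def IsCorep (V : Mult (A ⊗[ℂ] B)) : Prop :=
  IsMapFst (G.comul : A →ₗ[ℂ] Mult (A ⊗[ℂ] A)) V (leg13 V * leg23 V)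

/-- A unitary corepresentation on a `*`-algebra: a corepresentation that is a unitary element of
the `*`-algebra `M(A ⊗ B)`. -/
def IsUnitaryCorep [StarRing B] [StarModule ℂ B] (V : Mult (A ⊗[ℂ] B)) : Prop :=
  G.IsCorep V ∧ V ∈ unitary (Mult (A ⊗[ℂ] B))

/-- `m = (ω ⊙ ι)(V)` in `M(B)`, for `V ∈ M(A ⊗ B)` and `ω ∈ Â`: writing `ω = a φ` one has
`m b = (φ ⊙ ι)(V (a ⊗ b))`, and writing `ω = φ a` one has `b m = (φ ⊙ ι)((a ⊗ b) V)`. -/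
def IsSlice (V : Mult (A ⊗[ℂ] B)) (ω : G.Dual) (m : Mult B) : Prop :=
  (∀ a, (∀ x, ω.1 x = G.haar (x * a)) → ∀ b, m.L b = sliceFst G.haar (V.L (a ⊗ₜ b))) ∧
    ∀ a, (∀ x, ω.1 x = G.haar (a * x)) → ∀ b, m.R b = sliceFst G.haar (V.R (a ⊗ₜ b))

open Classical in
/-- The map `π_V : Â → M(B)`, `π_V(ω) = (ω ⊙ ι)(V)`. -/
noncomputable def pi (V : Mult (A ⊗[ℂ] B)) (ω : G.Dual) : Mult B :=
  if h : ∃ m, G.IsSlice V ω m then h.choose else 0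

end Corepresentations

/-- The inclusion of `A ⊗ Â` into the linear operators on `A`: `(x ⊗ ω)(y) = ω(y) x`. -/
noncomputable def toOperator : A ⊗[ℂ] G.Dual →ₗ[ℂ] A →ₗ[ℂ] A :=
  TensorProduct.lift (LinearMap.mk₂ ℂ
    (fun (x : A) (ω : G.Dual) => LinearMap.smulRight (ω : Module.Dual ℂ A) x)
    (fun x x' ω => by ext y; simp) (fun c x ω => LinearMap.ext fun y => smul_comm (ω.1 y) c x)
    (fun x ω ω' => by ext y; simp [add_smul]) (fun c x ω => by ext y; simp [mul_smul]))

/-- `U` is the universal corepresentation: the element of `M(A ⊗ Â)` with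
`[U(x ⊗ ω)](y) = (ι ⊙ ω)(Δ(y)(x ⊗ 1))` and `[(x ⊗ ω)U](y) = (ω ⊙ ι)((1 ⊗ x)Δ(y))`. -/
def IsUniversal (U : Mult (A ⊗[ℂ] G.Dual)) : Prop :=
  ∀ (x : A) (ω : G.Dual) (y : A),
    G.toOperator (U.L (x ⊗ₜ ω)) y = sliceSnd (ω : Module.Dual ℂ A) (G.T1 (y ⊗ₜ x)) ∧
    G.toOperator (U.R (x ⊗ₜ ω)) y = sliceFst (ω : Module.Dual ℂ A) (G.T4 (y ⊗ₜ x))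

end StarQuantumGroup

end QuantumGroup

set_option linter.unusedSectionVars false

namespace QuantumGroup

/-! ### Slice maps on algebraic tensor products. -/

section SliceCalculus

variable {X Y Z : Type*} [AddCommGroup X] [Module ℂ X] [AddCommGroup Y] [Module ℂ Y]
  [AddCommGroup Z] [Module ℂ Z]

/-! The analysis of `A` rests on slices of `Δ`. Coassociativity says that slicing the left leg
commutes with slicing the right leg (`slice1_slice2`), so left slices are left covariant and right
slices are right covariant. Commuting `T2⁻¹` past left slices shows that `m(T2⁻¹(x ⊗ y))` is a
scalar multiple of `y`; the scalar is `ε(x)`. The antipode is defined by `S(x)c = (ε ⊙ ι)T2⁻¹(x ⊗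
c)`, and left invariance of `φ` yields strong invariance, `S((ι ⊙ φ)(Δ(a)(1 ⊗ b))) = (ι ⊙ φ)((1 ⊗
a)Δ(b))` (`antipodeLin_slice2`). Such slices span `A`, so this one formula puts `S(x)` in `A` rather
than in `M(A)`, makes `S` bijective because `* S * S = ι`, and shows that `S` reverses `Δ`
(`T2_antipode`). It also gives that `φ` is faithful, and that `φ` and `ψ = φ S` have the same
translates, whence `φ(a x) = φ(x σ(a))` for a modular map `σ` and `{φ a} = {a φ}`.

The product of `Â` is dual to slicing, and the slices `(ι ⊙ ω)Δ(x)` and `(ω ⊙ ι)Δ(x)` with `ω ∈ Â`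
span `A`. This gives associativity, non-degeneracy and, since `x ↦ S(x)*` reverses `Δ`, the
involution. It also recovers the functional behind a multiplier from its values on slices
(`exists_implementing`).

A corepresentation satisfies `V₁₃V₂₃(T2 ⊙ ι) = (T2 ⊙ ι)V₁₃`. Integrating `V₁₃V₂₃` with `φ ⊙ φ` makes
`π_V` multiplicative (`pi_mul`). Applying `ε` to the first leg gives `(ε ⊙ ι)(V) = 1` when `V` is
invertible, and applying `(ε ⊙ ι)T2⁻¹` to the first two legs then gives `(S ⊙ ι)(V) = V⁻¹`
(`antipode_corep`). Since `(φ a*)* = (a φ)S`, it follows that `π_V((φ a*)*) = π_{V⁻¹}(a φ)`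
(`pi_star_eq_inv`), while always `π_V(φ a*)* = π_{V*}(a φ)` (`star_pi`). As `V ↦ π_V` is injective,
`π_V` preserves adjoints exactly when `V⁻¹ = V*`.

Strong invariance exhibits `U` as `T3` and `T2` conjugated by linear isomorphisms, so it is an
invertible multiplier, and `π_U` is the inclusion of `Â` in `M(Â)`. For a non-degenerate
`*`-homomorphism `π`, the transported `V = (ι ⊙ π)(U)` is an invertible corepresentation with `π_V =
π`, hence unitary; injectivity of `V ↦ π_V` gives both the bijection and the formula for `V`. -/

theorem ext_sliceFst {s t : X ⊗[ℂ] Y}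
    (h : ∀ f : Module.Dual ℂ X, sliceFst f s = sliceFst f t) : s = t :=
  sub_eq_zero.1 (eq_zero_of_sliceFst _ fun f => by rw [map_sub, h, sub_self])

theorem ext_sliceSnd {s t : X ⊗[ℂ] Y}
    (h : ∀ g : Module.Dual ℂ Y, sliceSnd g s = sliceSnd g t) : s = t :=
  sub_eq_zero.1 (eq_zero_of_sliceSnd _ fun f => by rw [map_sub, h, sub_self])

theorem sliceFst_lTensor (f : Module.Dual ℂ X) (h : Y →ₗ[ℂ] Z) (t : X ⊗[ℂ] Y) :
    sliceFst f (LinearMap.lTensor X h t) = h (sliceFst f t) := by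
  have : sliceFst f ∘ₗ LinearMap.lTensor X h = h ∘ₗ sliceFst f := by ext; simp
  exact LinearMap.congr_fun this t

theorem sliceFst_rTensor (f : Module.Dual ℂ Z) (h : X →ₗ[ℂ] Z) (t : X ⊗[ℂ] Y) :
    sliceFst f (LinearMap.rTensor Y h t) = sliceFst (f ∘ₗ h) t := by
  have : sliceFst f ∘ₗ LinearMap.rTensor Y h = sliceFst (f ∘ₗ h) := by ext; simp
  exact LinearMap.congr_fun this t

theorem sliceSnd_rTensor (g : Module.Dual ℂ Y) (h : X →ₗ[ℂ] Z) (t : X ⊗[ℂ] Y) :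
    sliceSnd g (LinearMap.rTensor Y h t) = h (sliceSnd g t) := by
  have : sliceSnd g ∘ₗ LinearMap.rTensor Y h = h ∘ₗ sliceSnd g := by ext; simp
  exact LinearMap.congr_fun this t

theorem sliceSnd_lTensor (g : Module.Dual ℂ Z) (h : Y →ₗ[ℂ] Z) (t : X ⊗[ℂ] Y) :
    sliceSnd g (LinearMap.lTensor X h t) = sliceSnd (g ∘ₗ h) t := by
  have : sliceSnd g ∘ₗ LinearMap.lTensor X h = sliceSnd (g ∘ₗ h) := by ext; simp
  exact LinearMap.congr_fun this t

theorem slice_slice (f : Module.Dual ℂ X) (g : Module.Dual ℂ Y) (t : X ⊗[ℂ] Y) :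
    f (sliceSnd g t) = g (sliceFst f t) := by
  have : f ∘ₗ sliceSnd g = g ∘ₗ sliceFst f := by ext; simp [mul_comm]
  exact LinearMap.congr_fun this t

theorem rTensor_lTensor (h : X →ₗ[ℂ] X) (k : Y →ₗ[ℂ] Y) (t : X ⊗[ℂ] Y) :
    LinearMap.rTensor Y h (LinearMap.lTensor X k t)
      = LinearMap.lTensor X k (LinearMap.rTensor Y h t) := by
  rw [← LinearMap.comp_apply, ← LinearMap.comp_apply, LinearMap.rTensor_comp_lTensor,
    LinearMap.lTensor_comp_rTensor]

theorem sliceFst_surjective {f : Module.Dual ℂ X} (hf : f ≠ 0) :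
    Function.Surjective (sliceFst (Y := Y) f) := by
  obtain ⟨x, hx⟩ : ∃ x, f x ≠ 0 := by
    by_contra! h
    exact hf (LinearMap.ext h)
  exact fun y => ⟨(f x)⁻¹ • x ⊗ₜ y, by simp [smul_smul, hx]⟩

theorem sliceSnd_surjective {g : Module.Dual ℂ Y} (hg : g ≠ 0) :
    Function.Surjective (sliceSnd (X := X) g) := by
  obtain ⟨x, hx⟩ : ∃ x, g x ≠ 0 := by
    by_contra! h
    exact hg (LinearMap.ext h)
  exact fun y => ⟨(g x)⁻¹ • y ⊗ₜ x, by simp [smul_smul, hx]⟩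

end SliceCalculus

/-! ### Cancellation in a non-degenerate tensor leg. -/

section Cancel

theorem NonDegenerate.ext_left {X : Type*} [NonUnitalRing X] (hX : NonDegenerate X)
    {x y : X} (h : ∀ z, x * z = y * z) :
    x = y :=
  sub_eq_zero.1 (hX.left _ fun z => by rw [sub_mul, h, sub_self])

theorem NonDegenerate.ext_right {X : Type*} [NonUnitalRing X] (hX : NonDegenerate X)
    {x y : X} (h : ∀ z, z * x = z * y) :
    x = y :=
  sub_eq_zero.1 (hX.right _ fun z => by rw [mul_sub, h, sub_self])

variable {X Y : Type*} [NonUnitalRing X] [Module ℂ X] [IsScalarTower ℂ X X]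
  [SMulCommClass ℂ X X] [AddCommGroup Y] [Module ℂ Y]

/-- Slicing the other leg reduces this to cancellation in `X`. Identities between the canonical maps
are checked this way, because multiplying one leg turns one canonical map into another. -/
theorem NonDegenerate.ext_rTensor_mulRight (hX : NonDegenerate X) {s t : X ⊗[ℂ] Y}
    (h : ∀ z, LinearMap.rTensor Y (LinearMap.mulRight ℂ z) s
      = LinearMap.rTensor Y (LinearMap.mulRight ℂ z) t) : s = t :=
  ext_sliceSnd fun g => hX.ext_left fun z => by
    simpa [sliceSnd_rTensor] using congrArg (sliceSnd g) (h z)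

theorem NonDegenerate.ext_rTensor_mulLeft (hX : NonDegenerate X) {s t : X ⊗[ℂ] Y}
    (h : ∀ z, LinearMap.rTensor Y (LinearMap.mulLeft ℂ z) s
      = LinearMap.rTensor Y (LinearMap.mulLeft ℂ z) t) : s = t :=
  ext_sliceSnd fun g => hX.ext_right fun z => by
    simpa [sliceSnd_rTensor] using congrArg (sliceSnd g) (h z)

theorem NonDegenerate.ext_lTensor_mulRight (hX : NonDegenerate X) {s t : Y ⊗[ℂ] X}
    (h : ∀ z, LinearMap.lTensor Y (LinearMap.mulRight ℂ z) s
      = LinearMap.lTensor Y (LinearMap.mulRight ℂ z) t) : s = t :=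
  ext_sliceFst fun g => hX.ext_left fun z => by
    simpa [sliceFst_lTensor] using congrArg (sliceFst g) (h z)

end Cancel

/-! ### Elementary tensors as products of one-legged multipliers. -/

section Tmul

variable {A : Type*} [NonUnitalRing A] [Module ℂ A] [IsScalarTower ℂ A A] [SMulCommClass ℂ A A]

theorem tmul_emb_one_mul (p q : A) :
    Mult.tmul (Mult.emb p) 1 * Mult.tmul 1 (Mult.emb q) = Mult.emb (p ⊗ₜ[ℂ] q) := by
  refine Mult.ext (TensorProduct.ext' fun x y => ?_) (TensorProduct.ext' fun x y => ?_) <;> simp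

theorem tmul_one_emb_mul (p q : A) :
    Mult.tmul 1 (Mult.emb q) * Mult.tmul (Mult.emb p) 1 = Mult.emb (p ⊗ₜ[ℂ] q) := by
  refine Mult.ext (TensorProduct.ext' fun x y => ?_) (TensorProduct.ext' fun x y => ?_) <;> simp

end Tmul

namespace MultiplierHopfStar

variable {A : Type*} [NonUnitalRing A] [Module ℂ A] [IsScalarTower ℂ A A]
  [SMulCommClass ℂ A A] [StarRing A] [StarModule ℂ A] (G : MultiplierHopfStar A)

open LinearMap (mulLeft mulRight rTensor lTensor)

theorem nonDegenerate_tensor (G : MultiplierHopfStar A) : NonDegenerate (A ⊗[ℂ] A) :=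
  G.nonDegenerate.tensor G.nonDegenerate

/-! ### Relations between the four canonical maps -/

theorem emb_rTensor_mulRight (G : MultiplierHopfStar A) (p : A) (t : A ⊗[ℂ] A) :
    Mult.emb (rTensor A (mulRight ℂ p) t) = Mult.emb t * Mult.tmul (Mult.emb p) 1 := by
  rw [Mult.emb_mul G.nonDegenerate_tensor]; rfl

theorem emb_rTensor_mulLeft (G : MultiplierHopfStar A) (p : A) (t : A ⊗[ℂ] A) :
    Mult.emb (rTensor A (mulLeft ℂ p) t) = Mult.tmul (Mult.emb p) 1 * Mult.emb t := by
  rw [Mult.mul_emb G.nonDegenerate_tensor]; rfl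

theorem emb_lTensor_mulRight (G : MultiplierHopfStar A) (p : A) (t : A ⊗[ℂ] A) :
    Mult.emb (lTensor A (mulRight ℂ p) t) = Mult.emb t * Mult.tmul 1 (Mult.emb p) := by
  rw [Mult.emb_mul G.nonDegenerate_tensor]; rfl

theorem emb_lTensor_mulLeft (G : MultiplierHopfStar A) (p : A) (t : A ⊗[ℂ] A) :
    Mult.emb (lTensor A (mulLeft ℂ p) t) = Mult.tmul 1 (Mult.emb p) * Mult.emb t := by
  rw [Mult.mul_emb G.nonDegenerate_tensor]; rfl

theorem emb_L (G : MultiplierHopfStar A) (m : Mult (A ⊗[ℂ] A)) (t : A ⊗[ℂ] A) :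
    Mult.emb (m.L t) = m * Mult.emb t :=
  (Mult.mul_emb G.nonDegenerate_tensor m t).symm

theorem emb_R (G : MultiplierHopfStar A) (m : Mult (A ⊗[ℂ] A)) (t : A ⊗[ℂ] A) :
    Mult.emb (m.R t) = Mult.emb t * m :=
  (Mult.emb_mul G.nonDegenerate_tensor m t).symm

/-- The factors of `p ⊗ q = (p ⊗ 1)(1 ⊗ q)` commute, so `Δ(a)(p ⊗ q)` can be read through `T1` or
through `T2`. Passing between the two readings is the basic move below. -/
theorem comul_L_tmul (a p q : A) :
    (G.comul a).L (p ⊗ₜ q) = lTensor A (mulRight ℂ q) (G.T1 (a ⊗ₜ p)) := by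
  apply G.embAA_injective
  rw [G.emb_L, G.emb_lTensor_mulRight, G.emb_T1, mul_assoc, tmul_emb_one_mul]

theorem comul_L_tmul' (a p q : A) :
    (G.comul a).L (p ⊗ₜ q) = rTensor A (mulRight ℂ p) (G.T2 (a ⊗ₜ q)) := by
  apply G.embAA_injective
  rw [G.emb_L, G.emb_rTensor_mulRight, G.emb_T2, mul_assoc, tmul_one_emb_mul]

theorem comul_R_tmul (a p q : A) :
    (G.comul a).R (p ⊗ₜ q) = lTensor A (mulLeft ℂ q) (G.T3 (a ⊗ₜ p)) := by
  apply G.embAA_injective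
  rw [G.emb_R, G.emb_lTensor_mulLeft, G.emb_T3, ← mul_assoc, tmul_one_emb_mul]

theorem comul_R_tmul' (a p q : A) :
    (G.comul a).R (p ⊗ₜ q) = rTensor A (mulLeft ℂ p) (G.T4 (a ⊗ₜ q)) := by
  apply G.embAA_injective
  rw [G.emb_R, G.emb_rTensor_mulLeft, G.emb_T4, ← mul_assoc, tmul_emb_one_mul]

theorem T1_mul (a b c : A) : G.T1 ((a * b) ⊗ₜ c) = (G.comul a).L (G.T1 (b ⊗ₜ c)) := by
  apply G.embAA_injective
  rw [G.emb_L, G.emb_T1, G.emb_T1, map_mul, mul_assoc]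

theorem T2_mul (a b c : A) : G.T2 ((a * b) ⊗ₜ c) = (G.comul a).L (G.T2 (b ⊗ₜ c)) := by
  apply G.embAA_injective
  rw [G.emb_L, G.emb_T2, G.emb_T2, map_mul, mul_assoc]

/-- Two bracketings of `(1 ⊗ d)Δ(a)(c ⊗ 1)`; the next three lemmas do the same for the other
placements of the two factors. -/
theorem rTensor_mulRight_T4 (a c d : A) :
    rTensor A (mulRight ℂ c) (G.T4 (a ⊗ₜ d)) = lTensor A (mulLeft ℂ d) (G.T1 (a ⊗ₜ c)) := by
  apply G.embAA_injective
  rw [G.emb_rTensor_mulRight, G.emb_lTensor_mulLeft, G.emb_T1, G.emb_T4, mul_assoc]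

theorem rTensor_mulLeft_T2 (a c d : A) :
    rTensor A (mulLeft ℂ c) (G.T2 (a ⊗ₜ d)) = lTensor A (mulRight ℂ d) (G.T3 (a ⊗ₜ c)) := by
  apply G.embAA_injective
  rw [G.emb_rTensor_mulLeft, G.emb_lTensor_mulRight, G.emb_T2, G.emb_T3, mul_assoc]

theorem rTensor_mulLeft_T1 (a c d : A) :
    rTensor A (mulLeft ℂ c) (G.T1 (a ⊗ₜ d)) = rTensor A (mulRight ℂ d) (G.T3 (a ⊗ₜ c)) := by
  apply G.embAA_injective
  rw [G.emb_rTensor_mulLeft, G.emb_rTensor_mulRight, G.emb_T1, G.emb_T3, mul_assoc]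

theorem lTensor_mulLeft_T2 (a c d : A) :
    lTensor A (mulLeft ℂ c) (G.T2 (a ⊗ₜ d)) = lTensor A (mulRight ℂ d) (G.T4 (a ⊗ₜ c)) := by
  apply G.embAA_injective
  rw [G.emb_lTensor_mulLeft, G.emb_lTensor_mulRight, G.emb_T2, G.emb_T4, mul_assoc]

theorem star_T2 (t : A ⊗[ℂ] A) : star (G.T2 t) = G.T4 (star t) := by
  change _ = star (G.T2 (star (star t))); rw [star_star]

theorem star_T3 (t : A ⊗[ℂ] A) : star (G.T3 t) = G.T1 (star t) := by
  change star (star (G.T1 (star t))) = _; rw [star_star]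

theorem star_T4 (t : A ⊗[ℂ] A) : star (G.T4 t) = G.T2 (star t) := by
  change star (star (G.T2 (star t))) = _; rw [star_star]

theorem T4_surjective : Function.Surjective G.T4 := fun t =>
  ⟨star (G.T2.symm (star t)), by rw [← star_T2]; simp⟩

/-! ### Coassociativity in terms of slices -/

/-- `x ↦ (f ⊙ ι)(Δ(x)(p ⊗ 1))` -/
noncomputable def slice1 (f : Module.Dual ℂ A) (p : A) : A →ₗ[ℂ] A :=
  sliceFst f ∘ₗ G.T1.toLinearMap ∘ₗ (TensorProduct.mk ℂ A A).flip p

/-- `x ↦ (ι ⊙ g)(Δ(x)(1 ⊗ d))` -/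
noncomputable def slice2 (g : Module.Dual ℂ A) (d : A) : A →ₗ[ℂ] A :=
  sliceSnd g ∘ₗ G.T2.toLinearMap ∘ₗ (TensorProduct.mk ℂ A A).flip d

/-- `x ↦ (f ⊙ ι)((p ⊗ 1)Δ(x))` -/
noncomputable def slice3 (f : Module.Dual ℂ A) (p : A) : A →ₗ[ℂ] A :=
  sliceFst f ∘ₗ G.T3 ∘ₗ (TensorProduct.mk ℂ A A).flip p

/-- `x ↦ (ι ⊙ g)((1 ⊗ d)Δ(x))` -/
noncomputable def slice4 (g : Module.Dual ℂ A) (d : A) : A →ₗ[ℂ] A :=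
  sliceSnd g ∘ₗ G.T4 ∘ₗ (TensorProduct.mk ℂ A A).flip d

theorem slice1_apply (f : Module.Dual ℂ A) (p x : A) :
    G.slice1 f p x = sliceFst f (G.T1 (x ⊗ₜ p)) := rfl

theorem slice2_apply (g : Module.Dual ℂ A) (d x : A) :
    G.slice2 g d x = sliceSnd g (G.T2 (x ⊗ₜ d)) := rfl

theorem slice3_apply (f : Module.Dual ℂ A) (p x : A) :
    G.slice3 f p x = sliceFst f (G.T3 (x ⊗ₜ p)) := rfl

theorem slice4_apply (g : Module.Dual ℂ A) (d x : A) :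
    G.slice4 g d x = sliceSnd g (G.T4 (x ⊗ₜ d)) := rfl

/-- Non-degeneracy of `Δ` reduces to `s = Δ(x)z`. There `Δ(a)(x ⊗ d) = Δ(a)(1 ⊗ d)(x ⊗ 1)`, and
multiplicativity of `Δ` absorbs `x` into `s`. -/
theorem exists_coassoc_left (a d : A) (W : Mult ((A ⊗[ℂ] A) ⊗[ℂ] A))
    (hW : IsMapFst (G.comul : A →ₗ[ℂ] Mult (A ⊗[ℂ] A)) (G.comul a) W) (s : A ⊗[ℂ] A) :
    W.L (s ⊗ₜ d) = rTensor A (Mult.applyL s ∘ₗ (G.comul : A →ₗ[ℂ] Mult (A ⊗[ℂ] A)))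
      (G.T2 (a ⊗ₜ d)) := by
  have hs : s ∈ Submodule.span ℂ {z : A ⊗[ℂ] A | ∃ x y,
      z = ((G.comul : A →ₗ[ℂ] Mult (A ⊗[ℂ] A)) x).L y} := by
    rw [G.comul_nonDegenerate.1]; trivial
  induction hs using Submodule.span_induction with
  | mem s hs =>
    obtain ⟨x, z, rfl⟩ := hs
    rw [(hW x z d).1, comul_L_tmul', ← LinearMap.comp_apply, ← LinearMap.rTensor_comp]
    congr 2
    refine LinearMap.ext fun u => ?_
    change (G.comul (u * x)).L z = (G.comul u).L ((G.comul x).L z)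
    rw [map_mul]; rfl
  | zero =>
    have : (Mult.applyL (0 : A ⊗[ℂ] A)) = 0 := LinearMap.ext fun m => map_zero m.L
    simp [this]
  | add s t _ _ hs ht =>
    have : Mult.applyL (s + t) = Mult.applyL s + Mult.applyL t :=
      LinearMap.ext fun m => map_add m.L s t
    rw [TensorProduct.add_tmul, map_add, hs, ht, this, LinearMap.add_comp, LinearMap.rTensor_add]
    rfl
  | smul c s _ hs =>
    have : Mult.applyL (c • s) = c • Mult.applyL s :=
      LinearMap.ext fun m => map_smul m.L c s
    rw [← TensorProduct.smul_tmul', map_smul, hs, this, LinearMap.smul_comp,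
      LinearMap.rTensor_smul]
    rfl

theorem exists_coassoc_right (a p : A) (W : Mult (A ⊗[ℂ] (A ⊗[ℂ] A)))
    (hW : IsMapSnd (G.comul : A →ₗ[ℂ] Mult (A ⊗[ℂ] A)) (G.comul a) W) (s : A ⊗[ℂ] A) :
    W.L (p ⊗ₜ s) = lTensor A (Mult.applyL s ∘ₗ (G.comul : A →ₗ[ℂ] Mult (A ⊗[ℂ] A)))
      (G.T1 (a ⊗ₜ p)) := by
  have hs : s ∈ Submodule.span ℂ {z : A ⊗[ℂ] A | ∃ x y,
      z = ((G.comul : A →ₗ[ℂ] Mult (A ⊗[ℂ] A)) x).L y} := by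
    rw [G.comul_nonDegenerate.1]; trivial
  induction hs using Submodule.span_induction with
  | mem s hs =>
    obtain ⟨x, z, rfl⟩ := hs
    rw [(hW x z p).1, comul_L_tmul, ← LinearMap.comp_apply, ← LinearMap.lTensor_comp]
    congr 2
    refine LinearMap.ext fun u => ?_
    change (G.comul (u * x)).L z = (G.comul u).L ((G.comul x).L z)
    rw [map_mul]; rfl
  | zero =>
    have : (Mult.applyL (0 : A ⊗[ℂ] A)) = 0 := LinearMap.ext fun m => map_zero m.L
    simp [this]
  | add s t _ _ hs ht =>
    have : Mult.applyL (s + t) = Mult.applyL s + Mult.applyL t :=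
      LinearMap.ext fun m => map_add m.L s t
    rw [TensorProduct.tmul_add, map_add, hs, ht, this, LinearMap.add_comp, LinearMap.lTensor_add]
    rfl
  | smul c s _ hs =>
    have : Mult.applyL (c • s) = c • Mult.applyL s :=
      LinearMap.ext fun m => map_smul m.L c s
    rw [TensorProduct.tmul_smul, map_smul, hs, this, LinearMap.smul_comp,
      LinearMap.lTensor_smul]
    rfl

/-- This is coassociativity: apply the common multiplier `W` to `p ⊗ q ⊗ d` and slice the outer legs
by `f` and `g`. The two descriptions of `W` give the two sides, each multiplied by `q`. -/
theorem slice1_slice2 (f g : Module.Dual ℂ A) (p d a : A) :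
    G.slice1 f p (G.slice2 g d a) = G.slice2 g d (G.slice1 f p a) := by
  obtain ⟨W, h1, h2⟩ := G.coassoc a
  refine G.nonDegenerate.ext_left fun q => ?_
  have e1 := G.exists_coassoc_left a d W h1 (p ⊗ₜ q)
  have e2 := G.exists_coassoc_right a p W.assoc h2 (q ⊗ₜ d)
  have e3 : W.assoc.L (p ⊗ₜ (q ⊗ₜ d))
      = TensorProduct.assoc ℂ A A A (W.L ((p ⊗ₜ q) ⊗ₜ d)) := by
    simp [Mult.assoc, Mult.congr]
  rw [e2, e1] at e3
  have k1 : sliceSnd g ∘ₗ sliceFst f ∘ₗ (TensorProduct.assoc ℂ A A A).toLinearMap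
      = sliceFst f ∘ₗ sliceSnd g := by
    refine TensorProduct.ext_threefold fun x y z => ?_
    simp [smul_smul, mul_comm]
  have e4 := congrArg (fun t => sliceSnd g (sliceFst f t)) e3
  have k2 := LinearMap.congr_fun k1 (rTensor A (Mult.applyL (p ⊗ₜ[ℂ] q) ∘ₗ
    (G.comul : A →ₗ[ℂ] Mult (A ⊗[ℂ] A))) (G.T2 (a ⊗ₜ d)))
  simp only [LinearMap.comp_apply, LinearEquiv.coe_coe] at k2 e4
  rw [k2, sliceSnd_rTensor, sliceFst_lTensor] at e4
  simp only [LinearMap.comp_apply] at e4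
  have e5 : (G.comul (G.slice1 f p a)).L (q ⊗ₜ d) =
    (G.comul (sliceFst f (G.T1 (a ⊗ₜ[ℂ] p)))).L (q ⊗ₜ d) := rfl
  change sliceSnd g ((G.comul (G.slice1 f p a)).L (q ⊗ₜ d)) =
    sliceFst f ((G.comul (G.slice2 g d a)).L (p ⊗ₜ q)) at e4
  rw [comul_L_tmul', comul_L_tmul, sliceSnd_rTensor, sliceFst_lTensor] at e4
  exact e4.symm

/-- `Δ ρ = (ι ⊙ ρ) Δ` -/
def RightCovariant (ρ : A →ₗ[ℂ] A) : Prop :=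
  ∀ x p, G.T1 (ρ x ⊗ₜ p) = lTensor A ρ (G.T1 (x ⊗ₜ p))

/-- `Δ λ = (λ ⊙ ι) Δ` -/
def LeftCovariant (l : A →ₗ[ℂ] A) : Prop :=
  ∀ x d, G.T2 (l x ⊗ₜ d) = rTensor A l (G.T2 (x ⊗ₜ d))

variable {G}

/-- Multiplying by `z ⊗ 1` on the right turns `T3(x ⊗ c)` into `(c ⊗ 1)T1(x ⊗ z)`, and left
multiplication on the first leg commutes with `ι ⊙ ρ`. -/
theorem RightCovariant.T3 {ρ : A →ₗ[ℂ] A} (h : G.RightCovariant ρ) (x c : A) :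
    G.T3 (ρ x ⊗ₜ c) = lTensor A ρ (G.T3 (x ⊗ₜ c)) := by
  refine G.nonDegenerate.ext_rTensor_mulRight fun z => ?_
  rw [← rTensor_mulLeft_T1, h, rTensor_lTensor, rTensor_lTensor, rTensor_mulLeft_T1]

theorem LeftCovariant.T4 {l : A →ₗ[ℂ] A} (h : G.LeftCovariant l) (x c : A) :
    G.T4 (l x ⊗ₜ c) = rTensor A l (G.T4 (x ⊗ₜ c)) := by
  refine G.nonDegenerate.ext_lTensor_mulRight fun z => ?_
  rw [← lTensor_mulLeft_T2, h, ← rTensor_lTensor, ← rTensor_lTensor, lTensor_mulLeft_T2]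

theorem RightCovariant.slice3 {ρ : A →ₗ[ℂ] A} (h : G.RightCovariant ρ) (f : Module.Dual ℂ A)
    (p x : A) : G.slice3 f p (ρ x) = ρ (G.slice3 f p x) := by
  rw [slice3_apply, h.T3, sliceFst_lTensor]; rfl

theorem LeftCovariant.slice4 {l : A →ₗ[ℂ] A} (h : G.LeftCovariant l) (g : Module.Dual ℂ A)
    (d x : A) : G.slice4 g d (l x) = l (G.slice4 g d x) := by
  rw [slice4_apply, h.T4, sliceSnd_rTensor]; rfl

variable (G)

theorem rightCovariant_slice2 (g : Module.Dual ℂ A) (d : A) : G.RightCovariant (G.slice2 g d) :=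
  fun x p => ext_sliceFst fun f => by
    rw [sliceFst_lTensor]; exact G.slice1_slice2 f g p d x

theorem leftCovariant_slice1 (f : Module.Dual ℂ A) (p : A) : G.LeftCovariant (G.slice1 f p) :=
  fun x d => ext_sliceSnd fun g => by
    rw [sliceSnd_rTensor]; exact (G.slice1_slice2 f g p d x).symm

/-- Right covariance of `slice2`, carried over to `T3`, says that `slice2` commutes with `slice3`;
read for fixed `slice3`, this is left covariance. -/
theorem leftCovariant_slice3 (f : Module.Dual ℂ A) (p : A) : G.LeftCovariant (G.slice3 f p) :=
  fun x d => ext_sliceSnd fun g => by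
    rw [sliceSnd_rTensor]; exact ((G.rightCovariant_slice2 g d).slice3 f p x).symm

theorem rightCovariant_slice4 (g : Module.Dual ℂ A) (d : A) : G.RightCovariant (G.slice4 g d) :=
  fun x p => ext_sliceFst fun f => by
    rw [sliceFst_lTensor]; exact ((G.leftCovariant_slice1 f p).slice4 g d x).symm

end MultiplierHopfStar

namespace StarQuantumGroup

open MultiplierHopfStar
open LinearMap (mulLeft mulRight rTensor lTensor mul')

variable {A : Type*} [NonUnitalRing A] [Module ℂ A] [IsScalarTower ℂ A A]
  [SMulCommClass ℂ A A] [StarRing A] [StarModule ℂ A] (G : StarQuantumGroup A)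

theorem exists_haar_eq_one : ∃ y, G.haar y = 1 := by
  obtain ⟨x, hx⟩ : ∃ x, G.haar x ≠ 0 := by
    by_contra! h
    exact G.haar_ne_zero (LinearMap.ext h)
  exact ⟨(G.haar x)⁻¹ • x, by simp [hx]⟩

/-! ### Slices by the Haar functional span the algebra -/

section Ext

variable {N : Type*} [AddCommGroup N] [Module ℂ N] {h k : A →ₗ[ℂ] N} {f : Module.Dual ℂ A}

/-- Both `T2` and the slice by a non-zero functional are onto, so these slices span `A`. Most
identities for the antipode are tested on them. -/
theorem ext_slice2 (hf : f ≠ 0) (H : ∀ x p, h (G.slice2 f p x) = k (G.slice2 f p x)) : h = k := by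
  refine LinearMap.ext fun y => ?_
  obtain ⟨t, rfl⟩ := sliceSnd_surjective hf y
  obtain ⟨t, rfl⟩ := G.T2.surjective t
  have : h ∘ₗ sliceSnd f ∘ₗ G.T2.toLinearMap = k ∘ₗ sliceSnd f ∘ₗ G.T2.toLinearMap :=
    TensorProduct.ext' H
  exact LinearMap.congr_fun this t

theorem ext_slice3 (hf : f ≠ 0) (H : ∀ x p, h (G.slice3 f p x) = k (G.slice3 f p x)) : h = k := by
  refine LinearMap.ext fun y => ?_
  obtain ⟨t, rfl⟩ := sliceFst_surjective hf y
  obtain ⟨t, rfl⟩ := G.T3_surjective t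
  have : h ∘ₗ sliceFst f ∘ₗ G.T3 = k ∘ₗ sliceFst f ∘ₗ G.T3 := TensorProduct.ext' H
  exact LinearMap.congr_fun this t

theorem ext_slice4 (hf : f ≠ 0) (H : ∀ x p, h (G.slice4 f p x) = k (G.slice4 f p x)) : h = k := by
  refine LinearMap.ext fun y => ?_
  obtain ⟨t, rfl⟩ := sliceSnd_surjective hf y
  obtain ⟨t, rfl⟩ := G.T4_surjective t
  have : h ∘ₗ sliceSnd f ∘ₗ G.T4 = k ∘ₗ sliceSnd f ∘ₗ G.T4 := TensorProduct.ext' H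
  exact LinearMap.congr_fun this t

end Ext

/-! ### The counit -/

/-- By left covariance `slice3 f c ⊙ ι` commutes with `T2`, and `m(slice3 f c ⊙ ι) = (f(c ·) ⊙
ι)T2`. The `T2` therefore cancels against `T2⁻¹`. -/
theorem mul'_T2_symm_slice3 (f : Module.Dual ℂ A) (c q y : A) :
    mul' ℂ A (G.T2.symm (G.slice3 f c q ⊗ₜ y)) = f (c * q) • y := by
  have h1 : G.T2.toLinearMap ∘ₗ rTensor A (G.slice3 f c)
      = rTensor A (G.slice3 f c) ∘ₗ G.T2.toLinearMap :=
    TensorProduct.ext' fun x d => G.leftCovariant_slice3 f c x d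
  have h2 : mul' ℂ A ∘ₗ rTensor A (G.slice3 f c)
      = sliceFst f ∘ₗ rTensor A (mulLeft ℂ c) ∘ₗ G.T2.toLinearMap := by
    refine TensorProduct.ext' fun u v => ?_
    simp only [LinearMap.comp_apply, LinearMap.rTensor_tmul, LinearMap.mul'_apply,
      LinearEquiv.coe_coe]
    rw [G.rTensor_mulLeft_T2, sliceFst_lTensor]; rfl
  have h3 : G.T2.symm (G.slice3 f c q ⊗ₜ y) = rTensor A (G.slice3 f c) (G.T2.symm (q ⊗ₜ y)) := by
    rw [LinearEquiv.symm_apply_eq]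
    have := LinearMap.congr_fun h1 (G.T2.symm (q ⊗ₜ y))
    simpa using this.symm
  have h4 := LinearMap.congr_fun h2 (G.T2.symm (q ⊗ₜ y))
  rw [h3]
  simpa using h4

/-- The linear functional underlying the counit. -/
noncomputable def counitLin : Module.Dual ℂ A :=
  -- Since `m(T2⁻¹(x ⊗ y))` is a multiple of `y`, a `y` with `φ(y) = 1` lets `φ` read off the
  -- scalar.
  G.haar ∘ₗ mul' ℂ A ∘ₗ G.T2.symm.toLinearMap ∘ₗ
    (TensorProduct.mk ℂ A A).flip G.exists_haar_eq_one.choose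

theorem counitLin_slice3 (f : Module.Dual ℂ A) (c x : A) :
    G.counitLin (G.slice3 f c x) = f (c * x) := by
  have h : G.counitLin (G.slice3 f c x) = G.haar (mul' ℂ A (G.T2.symm
    (G.slice3 f c x ⊗ₜ G.exists_haar_eq_one.choose))) := rfl
  rw [h, mul'_T2_symm_slice3, map_smul, G.exists_haar_eq_one.choose_spec, smul_eq_mul, mul_one]

theorem sliceFst_counitLin_T2 (t : A ⊗[ℂ] A) : sliceFst G.counitLin (G.T2 t) = mul' ℂ A t := by
  obtain ⟨t, rfl⟩ := G.T2.symm.surjective t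
  rw [LinearEquiv.apply_symm_apply]
  have : sliceFst G.counitLin = mul' ℂ A ∘ₗ G.T2.symm.toLinearMap := by
    refine TensorProduct.ext ?_
    refine G.ext_slice3 G.haar_ne_zero fun x c => LinearMap.ext fun y => ?_
    change sliceFst G.counitLin (G.slice3 G.haar c x ⊗ₜ y)
      = mul' ℂ A (G.T2.symm (G.slice3 G.haar c x ⊗ₜ y))
    rw [mul'_T2_symm_slice3, sliceFst_tmul, counitLin_slice3]
  exact LinearMap.congr_fun this t

theorem sliceFst_counitLin_comul (a : A) (t : A ⊗[ℂ] A) :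
    sliceFst G.counitLin ((G.comul a).L t) = a * sliceFst G.counitLin t := by
  obtain ⟨t, rfl⟩ := G.T2.surjective t
  have : sliceFst G.counitLin ∘ₗ (G.comul a).L ∘ₗ G.T2.toLinearMap
      = mulLeft ℂ a ∘ₗ sliceFst G.counitLin ∘ₗ G.T2.toLinearMap := by
    refine TensorProduct.ext' fun b c => ?_
    simp only [LinearMap.comp_apply, LinearEquiv.coe_coe, ← G.T2_mul, sliceFst_counitLin_T2,
      LinearMap.mul'_apply, LinearMap.mulLeft_apply, mul_assoc]
  exact LinearMap.congr_fun this t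

/-- Evaluate `(ε ⊙ ι)(Δ(a)(p ⊗ q))` in two ways: `ε ⊙ ι` turns the action of `Δ(a)` into
multiplication by `a`, and `Δ(a)(p ⊗ q)` is `T2(a ⊗ q)(p ⊗ 1)`, where `T2` is onto. -/
theorem counitLin_mul (x p : A) : G.counitLin (x * p) = G.counitLin x * G.counitLin p := by
  obtain ⟨y, hy⟩ := G.exists_haar_eq_one
  have : sliceFst G.counitLin ∘ₗ rTensor A (mulRight ℂ p) ∘ₗ G.T2.toLinearMap
      = G.counitLin p • (sliceFst G.counitLin ∘ₗ G.T2.toLinearMap) := by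
    refine TensorProduct.ext' fun a q => ?_
    simp only [LinearMap.comp_apply, LinearEquiv.coe_coe, ← G.comul_L_tmul', LinearMap.smul_apply,
      sliceFst_counitLin_comul, sliceFst_counitLin_T2]
    simp [mul_smul_comm]
  have h2 := LinearMap.congr_fun this (G.T2.symm (x ⊗ₜ y))
  have h3 := congrArg G.haar h2
  simpa [hy, mul_comm] using h3

/-- The counit. -/
noncomputable def counit : A →ₙₐ[ℂ] ℂ where
  toFun := G.counitLin
  map_smul' c x := by simp
  map_zero' := map_zero _
  map_add' := map_add _
  map_mul' := G.counitLin_mul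

theorem coe_counit : (G.counit : A →ₗ[ℂ] ℂ) = G.counitLin := rfl

theorem counitLin_ne_zero : G.counitLin ≠ 0 := by
  intro h
  obtain ⟨y, hy⟩ := G.exists_haar_eq_one
  have : y = 0 := G.nonDegenerate.left y fun z => by
    have := G.sliceFst_counitLin_T2 (y ⊗ₜ z)
    rw [h] at this
    simpa [sliceFst] using this.symm
  simp [this] at hy

theorem sliceL_counitLin (a : A) : G.sliceL G.counitLin a = Mult.emb a :=
  Mult.ext_L G.nonDegenerate fun b => by
    have := G.sliceFst_counitLin_T2 (a ⊗ₜ b)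
    simpa [MultiplierHopfStar.sliceL] using this

theorem sliceSnd_counitLin_T3 (x c : A) : sliceSnd G.counitLin (G.T3 (x ⊗ₜ c)) = c * x := by
  rw [← sub_eq_zero, ← Module.forall_dual_apply_eq_zero_iff ℂ]
  intro f
  rw [map_sub, slice_slice, sub_eq_zero]
  exact G.counitLin_slice3 f c x

theorem sliceR_counitLin (a : A) : G.sliceR G.counitLin a = Mult.emb a := by
  have hR : ∀ x, (G.sliceR G.counitLin a).R x = (Mult.emb a).R x := fun b => by
    have := G.sliceSnd_counitLin_T3 a b
    simpa [MultiplierHopfStar.sliceR] using this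
  refine Mult.ext_L G.nonDegenerate fun x => G.nonDegenerate.ext_right fun z => ?_
  rw [← Mult.central, ← Mult.central, hR]

theorem sliceFst_counitLin_T4 (x c : A) : sliceFst G.counitLin (G.T4 (x ⊗ₜ c)) = c * x :=
  LinearMap.congr_fun (congrArg Mult.R (G.sliceL_counitLin x)) c

theorem isCounit_counit : G.IsCounit G.counit :=
  ⟨fun h => G.counitLin_ne_zero (by rw [← coe_counit, h]; rfl),
    fun a => ⟨G.sliceL_counitLin a, G.sliceR_counitLin a⟩⟩

theorem IsCounit.eq_counitLin {ε : A →ₙₐ[ℂ] ℂ} (h : G.IsCounit ε) (x : A) :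
    ε x = G.counitLin x := by
  obtain ⟨y, hy⟩ := G.exists_haar_eq_one
  have : sliceFst (ε : A →ₗ[ℂ] ℂ) ∘ₗ G.T2.toLinearMap
      = sliceFst G.counitLin ∘ₗ G.T2.toLinearMap := by
    refine TensorProduct.ext' fun a b => ?_
    have h1 := LinearMap.congr_fun (congrArg Mult.L (h.2 a).1) b
    simp only [LinearMap.comp_apply, LinearEquiv.coe_coe, sliceFst_counitLin_T2]
    exact h1
  have h2 := congrArg G.haar (LinearMap.congr_fun this (G.T2.symm (x ⊗ₜ y)))
  simpa [hy] using h2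

/-- The involution exchanges `T2` and `T4`, which `ε ⊙ ι` sends to the product and the opposite
product, so `ε ⊙ ι` commutes with `*`. -/
theorem counitLin_star (x : A) : G.counitLin (star x) = starRingEnd ℂ (G.counitLin x) := by
  obtain ⟨y, hy⟩ := G.exists_haar_eq_one
  have h (t : A ⊗[ℂ] A) : sliceFst G.counitLin (star (G.T4 (star t)))
      = star (sliceFst G.counitLin (G.T4 (star t))) := by
    rw [star_T4, star_star, sliceFst_counitLin_T2]
    induction t with
    | zero => simp
    | add s t hs ht => rw [map_add, hs, ht]; simp
    | tmul a b => simp [sliceFst_counitLin_T4]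
  obtain ⟨t, ht⟩ := G.T4_surjective (x ⊗ₜ star y)
  have h1 := h (star t)
  rw [star_star, ht] at h1
  have h2 := congrArg G.haar h1
  simpa [hy] using h2

/-- The product equals `(ε ⊙ ι)T2`, a composite of surjections. -/
theorem mul'_surjective (G : StarQuantumGroup A) : Function.Surjective (mul' ℂ A) := fun x => by
  obtain ⟨t, ht⟩ := sliceFst_surjective G.counitLin_ne_zero x
  exact ⟨G.T2.symm t, by rw [← G.sliceFst_counitLin_T2]; simpa using ht⟩

/-- Linear maps that agree on products agree. -/
theorem ext_mul (G : StarQuantumGroup A) {N : Type*} [AddCommGroup N] [Module ℂ N] {h k : A →ₗ[ℂ] N}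
    (H : ∀ x y, h (x * y) = k (x * y)) : h = k := by
  refine LinearMap.ext fun y => ?_
  obtain ⟨t, rfl⟩ := G.mul'_surjective y
  have : h ∘ₗ mul' ℂ A = k ∘ₗ mul' ℂ A := TensorProduct.ext' H
  exact LinearMap.congr_fun this t

/-! ### The antipode -/

theorem sliceSnd_haar_T1 (x c : A) : sliceSnd G.haar (G.T1 (x ⊗ₜ c)) = G.haar x • c :=
  LinearMap.congr_fun (congrArg Mult.L (G.haar_leftInvariant x)) c

theorem star_sliceSnd_haar (t : A ⊗[ℂ] A) :
    star (sliceSnd G.haar t) = sliceSnd G.haar (star t) := by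
  induction t with
  | zero => simp
  | add s t hs ht => simp [hs, ht]
  | tmul a b => simp [G.haar_selfAdjoint]

theorem star_sliceFst_haar {B : Type*} [NonUnitalNonAssocRing B] [Module ℂ B]
    [IsScalarTower ℂ B B] [SMulCommClass ℂ B B] [StarRing B] [StarModule ℂ B]
    (t : A ⊗[ℂ] B) :
    star (sliceFst G.haar t) = sliceFst G.haar (star t) := by
  induction t with
  | zero => simp
  | add s t hs ht => simp [hs, ht]
  | tmul a b => simp [G.haar_selfAdjoint]

theorem slice2_mul (a b c : A) (g : Module.Dual ℂ A) :
    G.slice2 g b a * c = sliceSnd g ((G.comul a).L (c ⊗ₜ b)) := by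
  rw [G.comul_L_tmul', sliceSnd_rTensor]; rfl

theorem mul_slice2 (a b c : A) (g : Module.Dual ℂ A) :
    c * G.slice2 g b a = sliceSnd g (lTensor A (mulRight ℂ b) (G.T3 (a ⊗ₜ c))) := by
  rw [← G.rTensor_mulLeft_T2, sliceSnd_rTensor]; rfl

theorem mul_slice4 (a b c : A) (g : Module.Dual ℂ A) :
    c * G.slice4 g a b = sliceSnd g (lTensor A (mulLeft ℂ a) (G.T3 (b ⊗ₜ c))) := by
  rw [← G.comul_R_tmul, G.comul_R_tmul', sliceSnd_rTensor]; rfl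

theorem slice4_mul (a b c : A) (g : Module.Dual ℂ A) :
    G.slice4 g a b * c = sliceSnd g (lTensor A (mulLeft ℂ a) (G.T1 (b ⊗ₜ c))) := by
  rw [← G.rTensor_mulRight_T4, sliceSnd_rTensor]; rfl

theorem slice3_mul (a b c : A) (f : Module.Dual ℂ A) :
    G.slice3 f a b * c = sliceFst f (rTensor A (mulLeft ℂ a) (G.T2 (b ⊗ₜ c))) := by
  rw [G.rTensor_mulLeft_T2, sliceFst_lTensor]; rfl

theorem mul_slice3 (a b c : A) (f : Module.Dual ℂ A) :
    c * G.slice3 f a b = sliceFst f (rTensor A (mulLeft ℂ a) (G.T4 (b ⊗ₜ c))) := by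
  rw [← G.comul_R_tmul', G.comul_R_tmul, sliceFst_lTensor]; rfl

theorem counitLin_slice2 (g : Module.Dual ℂ A) (a b : A) :
    G.counitLin (G.slice2 g b a) = g (a * b) := by
  rw [slice2_apply, slice_slice, sliceFst_counitLin_T2]; rfl

theorem counitLin_slice4 (g : Module.Dual ℂ A) (a b : A) :
    G.counitLin (G.slice4 g b a) = g (b * a) := by
  rw [slice4_apply, slice_slice, sliceFst_counitLin_T4]

/-- Strong invariance: left invariance produces an explicit preimage under `T2`, to which `ε ⊙ ι` is
then applied. -/
theorem sliceFst_counitLin_T2_symm (a b c : A) :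
    sliceFst G.counitLin (G.T2.symm (G.slice2 G.haar b a ⊗ₜ c)) = G.slice4 G.haar a b * c := by
  let E (a : A) : A ⊗[ℂ] A →ₗ[ℂ] A ⊗[ℂ] A :=
    rTensor A (sliceSnd G.haar ∘ₗ G.T2.toLinearMap ∘ₗ TensorProduct.mk ℂ A A a) ∘ₗ
      (TensorProduct.comm ℂ A A).toLinearMap
  have hE (a p q : A) : E a (p ⊗ₜ q) = G.slice2 G.haar q a ⊗ₜ p := rfl
  have h1 (f : Module.Dual ℂ A) (p : A) (t : A ⊗[ℂ] A) :
      sliceFst f (rTensor A (mulLeft ℂ p) (G.T2 (E a t)))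
        = sliceSnd G.haar ((G.comul (G.slice3 f p a)).L t) := by
    induction t with
    | zero => simp
    | add s t hs ht => simp only [map_add, hs, ht]
    | tmul q r =>
      rw [hE, ← slice3_mul, (G.rightCovariant_slice2 _ _).slice3, slice2_mul]
  -- With `y = slice3 f p a`, `h1` reduces the left side to `(ι ⊙ φ)(Δ(y)Δ(b)(c ⊗ 1))`, and
  -- invariance turns it into `φ(y b)c`.
  have h2 : G.T2 (E a (G.T1 (b ⊗ₜ c))) = G.slice2 G.haar b a ⊗ₜ c := by
    refine G.nonDegenerate.ext_rTensor_mulLeft fun p => ext_sliceFst fun f => ?_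
    rw [h1, ← G.T1_mul, sliceSnd_haar_T1, LinearMap.rTensor_tmul, sliceFst_tmul,
      LinearMap.mulLeft_apply, mul_slice2, slice_slice, sliceFst_lTensor]
    rfl
  have h3 (t : A ⊗[ℂ] A) : sliceFst G.counitLin (E a t)
      = sliceSnd G.haar (lTensor A (mulLeft ℂ a) t) := by
    induction t with
    | zero => simp
    | add s t hs ht => simp only [map_add, hs, ht]
    | tmul q r => rw [hE, sliceFst_tmul, counitLin_slice2]; simp
  rw [← h2, LinearEquiv.symm_apply_apply, h3, slice4_mul]

theorem exists_antipode (x : A) :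
    ∃ y, ∀ c, y * c = sliceFst G.counitLin (G.T2.symm (x ⊗ₜ c)) := by
  obtain ⟨t, rfl⟩ := sliceSnd_surjective G.haar_ne_zero x
  obtain ⟨t, rfl⟩ := G.T2.surjective t
  refine ⟨sliceSnd G.haar (G.T4 (TensorProduct.comm ℂ A A t)), fun c => ?_⟩
  induction t with
  | zero => simp
  | add s t hs ht => simp only [map_add, add_mul, hs, ht, TensorProduct.add_tmul]
  | tmul a b => exact (G.sliceFst_counitLin_T2_symm a b c).symm

/-- The linear map underlying the antipode. -/
noncomputable def antipodeLin : A →ₗ[ℂ] A where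
  toFun x := (G.exists_antipode x).choose
  map_add' x y := G.nonDegenerate.ext_left fun c => by
    rw [add_mul, (G.exists_antipode _).choose_spec, (G.exists_antipode _).choose_spec,
      (G.exists_antipode _).choose_spec, TensorProduct.add_tmul, map_add, map_add]
  map_smul' r x := G.nonDegenerate.ext_left fun c => by
    rw [smul_mul_assoc, (G.exists_antipode _).choose_spec, (G.exists_antipode _).choose_spec,
      ← TensorProduct.smul_tmul', map_smul, map_smul]; rfl

theorem antipodeLin_mul_eq (x c : A) :
    G.antipodeLin x * c = sliceFst G.counitLin (G.T2.symm (x ⊗ₜ c)) :=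
  (G.exists_antipode x).choose_spec c

theorem antipodeLin_slice2 (a b : A) :
    G.antipodeLin (G.slice2 G.haar b a) = G.slice4 G.haar a b :=
  G.nonDegenerate.ext_left fun c => by rw [antipodeLin_mul_eq, sliceFst_counitLin_T2_symm]

/-- As `φ` is self-adjoint, `*` sends a `slice4` of `φ` back to a `slice2` with both arguments
starred, so `S`, `*`, `S`, `*` in turn restore the slice. -/
theorem star_antipodeLin_star (x : A) :
    star (G.antipodeLin (star (G.antipodeLin x))) = x := by
  have : (starLinearEquiv ℂ (A := A)).toLinearMap.comp (G.antipodeLin.comp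
      ((starLinearEquiv ℂ (A := A)).toLinearMap.comp G.antipodeLin)) = LinearMap.id := by
    refine G.ext_slice2 G.haar_ne_zero fun a b => ?_
    have h : star (G.slice4 G.haar a b) = G.slice2 G.haar (star a) (star b) := by
      rw [slice4_apply, star_sliceSnd_haar, star_T4]; simp [slice2_apply]
    change star (G.antipodeLin (star (G.antipodeLin (G.slice2 G.haar b a)))) = _
    rw [antipodeLin_slice2, h, antipodeLin_slice2, slice4_apply, star_sliceSnd_haar, star_T4]
    simp [slice2_apply]
  exact LinearMap.congr_fun this x

/-- The antipode. -/
noncomputable def antipode : A ≃ₗ[ℂ] A :=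
  LinearEquiv.ofLinearMap G.antipodeLin
    ((starLinearEquiv ℂ (A := A)).toLinearMap.comp (G.antipodeLin.comp
      (starLinearEquiv ℂ (A := A)).toLinearMap))
    (LinearMap.ext fun x => by
      have := congrArg star (G.star_antipodeLin_star (star x))
      simpa using this)
    (LinearMap.ext fun x => by
      have := G.star_antipodeLin_star x
      simpa using this)

theorem antipode_mul_eq (x c : A) :
    G.antipode x * c = sliceFst G.counitLin (G.T2.symm (x ⊗ₜ c)) := G.antipodeLin_mul_eq x c

theorem antipode_slice2 (a b : A) :
    G.antipode (G.slice2 G.haar b a) = G.slice4 G.haar a b := G.antipodeLin_slice2 a b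

theorem antipode_star_antipode (x : A) : G.antipode (star (G.antipode x)) = star x := by
  rw [← star_star (G.antipode _)]
  exact congrArg star (G.star_antipodeLin_star x)

theorem mul'_rTensor_antipode_T2 (t : A ⊗[ℂ] A) :
    mul' ℂ A (rTensor A G.antipode.toLinearMap (G.T2 t)) = sliceFst G.counitLin t := by
  obtain ⟨t, rfl⟩ := G.T2.symm.surjective t
  rw [LinearEquiv.apply_symm_apply]
  have : mul' ℂ A ∘ₗ rTensor A G.antipode.toLinearMap
      = sliceFst G.counitLin ∘ₗ G.T2.symm.toLinearMap :=
    TensorProduct.ext' fun x c => G.antipode_mul_eq x c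
  exact LinearMap.congr_fun this t

/-- The functional `m(S ⊙ ι)` absorbs `Δ(a)` into the scalar `ε(a)`. Applied to `Δ(a)(y ⊗ b)`, this
gives `S(y)` times the value at `Δ(a)(1 ⊗ b)`, and `T2` is onto. -/
theorem antipode_mul (x y : A) : G.antipode (x * y) = G.antipode y * G.antipode x := by
  have h (t : A ⊗[ℂ] A) : mul' ℂ A (rTensor A G.antipode.toLinearMap
      (rTensor A (mulRight ℂ y) (G.T2 t))) = G.antipode y * sliceFst G.counitLin t := by
    induction t with
    | zero => simp
    | add s t hs ht => simp only [map_add, hs, ht, mul_add]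
    | tmul a b =>
      obtain ⟨s, hs⟩ := G.T2.surjective (y ⊗ₜ b)
      rw [← G.comul_L_tmul', ← hs]
      have h2 : mul' ℂ A ∘ₗ rTensor A G.antipode.toLinearMap ∘ₗ (G.comul a).L ∘ₗ G.T2.toLinearMap
          = G.counitLin a •
            (mul' ℂ A ∘ₗ rTensor A G.antipode.toLinearMap ∘ₗ G.T2.toLinearMap) := by
        refine TensorProduct.ext' fun p q => ?_
        simp only [LinearMap.comp_apply, LinearEquiv.coe_coe, ← G.T2_mul, LinearMap.smul_apply,
          mul'_rTensor_antipode_T2, sliceFst_tmul, counitLin_mul, smul_smul]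
      have h3 := LinearMap.congr_fun h2 s
      simp only [LinearMap.comp_apply, LinearEquiv.coe_coe, LinearMap.smul_apply] at h3
      rw [h3, hs]
      simp [mul_smul_comm]
  refine G.nonDegenerate.ext_left fun c => ?_
  have h1 := h (G.T2.symm (x ⊗ₜ c))
  rw [← mul'_rTensor_antipode_T2, LinearEquiv.apply_symm_apply] at h1
  simpa [mul_assoc] using h1

theorem mul'_lTensor_antipode_T4 (c b : A) :
    mul' ℂ A (lTensor A G.antipode.toLinearMap (G.T4 (c ⊗ₜ b)))
      = G.counitLin c • G.antipode b := by
  have h (t : A ⊗[ℂ] A) : mul' ℂ A (lTensor A G.antipode.toLinearMap (star t))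
      = G.antipode (star (mul' ℂ A (rTensor A G.antipode.toLinearMap t))) := by
    induction t with
    | zero => simp
    | add s t hs ht => simp only [map_add, star_add, hs, ht]
    | tmul p q => simp [antipode_mul, antipode_star_antipode]
  have h1 := h (G.T2 (star c ⊗ₜ star b))
  rw [mul'_rTensor_antipode_T2, star_T2] at h1
  simpa [counitLin_star] using h1

/-- Right multiplication by `S(d)` changes `(b ⊗ 1)Δ(a)` into `(b ⊗ d)Δ(a)`, where the identity for
`T4`, obtained from the first one by `*`, applies. -/
theorem mul'_lTensor_antipode_T3 (a b : A) :
    mul' ℂ A (lTensor A G.antipode.toLinearMap (G.T3 (a ⊗ₜ b))) = G.counitLin a • b := by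
  refine G.nonDegenerate.ext_left fun d => ?_
  obtain ⟨d, rfl⟩ := G.antipode.surjective d
  have h1 : mulRight ℂ (G.antipode d) ∘ₗ mul' ℂ A ∘ₗ lTensor A G.antipode.toLinearMap
      = mul' ℂ A ∘ₗ lTensor A G.antipode.toLinearMap ∘ₗ lTensor A (mulLeft ℂ d) :=
    TensorProduct.ext' fun p q => by simp [antipode_mul, mul_assoc]
  have h2 : mulLeft ℂ b ∘ₗ mul' ℂ A ∘ₗ lTensor A G.antipode.toLinearMap
      = mul' ℂ A ∘ₗ lTensor A G.antipode.toLinearMap ∘ₗ rTensor A (mulLeft ℂ b) :=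
    TensorProduct.ext' fun p q => by simp [mul_assoc]
  have h3 := LinearMap.congr_fun h1 (G.T3 (a ⊗ₜ b))
  have h4 := LinearMap.congr_fun h2 (G.T4 (a ⊗ₜ d))
  simp only [LinearMap.comp_apply, LinearMap.mulRight_apply, LinearMap.mulLeft_apply,
    ← G.comul_R_tmul, ← G.comul_R_tmul'] at h3 h4
  rw [h3, ← h4, mul'_lTensor_antipode_T4, mul_smul_comm, smul_mul_assoc]

theorem isAntipode_antipode : G.IsAntipode G.antipode :=
  ⟨G.antipode_mul, G.counit, G.isCounit_counit, fun a b =>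
    ⟨by rw [mul'_rTensor_antipode_T2, sliceFst_tmul]; rfl, G.mul'_lTensor_antipode_T3 a b⟩⟩

/-- Since `T2` is onto and the counit is unique, the first antipode identity determines every
`S(x)c`. -/
theorem IsAntipode.eq_antipode {S : A ≃ₗ[ℂ] A} (h : G.IsAntipode S) : S = G.antipode := by
  obtain ⟨-, ε, hε, h⟩ := h
  have h1 : mul' ℂ A ∘ₗ rTensor A S.toLinearMap ∘ₗ G.T2.toLinearMap
      = mul' ℂ A ∘ₗ rTensor A G.antipode.toLinearMap ∘ₗ G.T2.toLinearMap :=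
    TensorProduct.ext' fun a b => by
      have := (h a b).1
      rw [IsCounit.eq_counitLin G hε] at this
      simpa [mul'_rTensor_antipode_T2] using this
  refine LinearEquiv.ext fun x => G.nonDegenerate.ext_left fun c => ?_
  have h2 := LinearMap.congr_fun h1 (G.T2.symm (x ⊗ₜ c))
  simpa using h2

/-! ### The antipode reverses the comultiplication -/

/-- The map `a ⊗ b ↦ S(b) ⊗ S(a)`. -/
noncomputable def antipodeFlip : A ⊗[ℂ] A →ₗ[ℂ] A ⊗[ℂ] A :=
  (TensorProduct.comm ℂ A A).toLinearMap ∘ₗ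
    TensorProduct.map G.antipode.toLinearMap G.antipode.toLinearMap

@[simp] theorem antipodeFlip_tmul (a b : A) :
    G.antipodeFlip (a ⊗ₜ b) = G.antipode b ⊗ₜ G.antipode a := rfl

theorem antipodeFlip_lTensor_mulLeft (c : A) (t : A ⊗[ℂ] A) :
    G.antipodeFlip (lTensor A (mulLeft ℂ c) t)
      = rTensor A (mulRight ℂ (G.antipode c)) (G.antipodeFlip t) := by
  induction t with
  | zero => simp
  | add s t hs ht => simp only [map_add, hs, ht]
  | tmul a b => simp [antipode_mul]

theorem antipodeFlip_rTensor_mulLeft (c : A) (t : A ⊗[ℂ] A) :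
    G.antipodeFlip (rTensor A (mulLeft ℂ c) t)
      = lTensor A (mulRight ℂ (G.antipode c)) (G.antipodeFlip t) := by
  induction t with
  | zero => simp
  | add s t hs ht => simp only [map_add, hs, ht]
  | tmul a b => simp [antipode_mul]

theorem antipodeFlip_lTensor_mulRight (c : A) (t : A ⊗[ℂ] A) :
    G.antipodeFlip (lTensor A (mulRight ℂ c) t)
      = rTensor A (mulLeft ℂ (G.antipode c)) (G.antipodeFlip t) := by
  induction t with
  | zero => simp
  | add s t hs ht => simp only [map_add, hs, ht]
  | tmul a b => simp [antipode_mul]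

theorem antipodeFlip_rTensor_mulRight (c : A) (t : A ⊗[ℂ] A) :
    G.antipodeFlip (rTensor A (mulRight ℂ c) t)
      = lTensor A (mulLeft ℂ (G.antipode c)) (G.antipodeFlip t) := by
  induction t with
  | zero => simp
  | add s t hs ht => simp only [map_add, hs, ht]
  | tmul a b => simp [antipode_mul]

/-- The map with `r ⊗ s ↦ (q ↦ φ(s q) r)`. -/
noncomputable def haarRight : A ⊗[ℂ] A →ₗ[ℂ] A →ₗ[ℂ] A :=
  TensorProduct.lift (LinearMap.mk₂ ℂ (fun r s => (G.haarMul s).smulRight r)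
    (fun r r' s => by ext; simp) (fun c r s => LinearMap.ext fun q => smul_comm _ c r)
    (fun r s s' => by ext; simp [add_smul]) (fun c r s => by ext; simp [mul_smul]))

/-- The map with `p ⊗ q ↦ (s ↦ φ(s q) p)`. -/
noncomputable def haarLeft : A ⊗[ℂ] A →ₗ[ℂ] A →ₗ[ℂ] A :=
  TensorProduct.lift (LinearMap.mk₂ ℂ (fun p q => (G.haarMul.flip q).smulRight p)
    (fun r r' s => by ext; simp) (fun c r s => LinearMap.ext fun q => smul_comm _ c r)
    (fun r s s' => by ext; simp [add_smul])
    (fun c r s => by ext; simp [mul_smul]))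

theorem haarRight_apply (u : A ⊗[ℂ] A) (q : A) :
    G.haarRight u q = sliceSnd G.haar (lTensor A (mulRight ℂ q) u) := by
  induction u with
  | zero => simp
  | add s t hs ht => simp only [map_add, LinearMap.add_apply, hs, ht]
  | tmul a b => simp [haarRight]

theorem haarLeft_apply (t : A ⊗[ℂ] A) (s : A) :
    G.haarLeft t s = sliceSnd G.haar (lTensor A (mulLeft ℂ s) t) := by
  induction t with
  | zero => simp
  | add s t hs ht => simp only [map_add, LinearMap.add_apply, hs, ht]
  | tmul a b => simp [haarLeft]

/-- Both sides pair the second legs of `u` and `t` through `φ(s q)`; only the order of contraction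
differs. -/
theorem lTensor_haarRight (S : A →ₗ[ℂ] A) (t u : A ⊗[ℂ] A) :
    lTensor A (S ∘ₗ G.haarRight u) t
      = TensorProduct.comm ℂ A A (TensorProduct.map S (G.haarLeft t) u) := by
  induction u with
  | zero => simp [LinearMap.comp_zero]
  | add u u' hu hu' => rw [map_add, LinearMap.comp_add, LinearMap.lTensor_add,
      LinearMap.add_apply, hu, hu', map_add, map_add]
  | tmul r s =>
    induction t with
    | zero => simp
    | add t t' ht ht' => rw [map_add, ht, ht', map_add, TensorProduct.map_add_right,
        LinearMap.add_apply, map_add]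
    | tmul p q => simp [haarRight, haarLeft, TensorProduct.smul_tmul']

/-- For `x = slice2 φ b a`, strong invariance gives `S(x) = slice4 φ a b`. By covariance, after left
multiplication by `d`, both sides are the same contraction of `T3(a ⊗ c)` with `T3(b ⊗ d)` through
`φ`. -/
theorem T2_antipode (x c : A) :
    G.T2 (G.antipode x ⊗ₜ G.antipode c) = G.antipodeFlip (G.T3 (x ⊗ₜ c)) := by
  have : G.T2.toLinearMap ∘ₗ (TensorProduct.mk ℂ A A).flip (G.antipode c) ∘ₗ G.antipode.toLinearMap
      = G.antipodeFlip ∘ₗ G.T3 ∘ₗ (TensorProduct.mk ℂ A A).flip c := by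
    refine G.ext_slice2 G.haar_ne_zero fun a b => G.nonDegenerate.ext_rTensor_mulLeft fun d => ?_
    change rTensor A (mulLeft ℂ d) (G.T2 (G.antipode (G.slice2 G.haar b a) ⊗ₜ G.antipode c))
      = rTensor A (mulLeft ℂ d) (G.antipodeFlip (G.T3 (G.slice2 G.haar b a ⊗ₜ c)))
    rw [antipode_slice2, G.rTensor_mulLeft_T2, (G.rightCovariant_slice4 G.haar a).T3,
      (G.rightCovariant_slice2 G.haar b).T3]
    have h1 : mulRight ℂ (G.antipode c) ∘ₗ G.slice4 G.haar a
        = G.antipode.toLinearMap ∘ₗ G.haarRight (G.T3 (a ⊗ₜ c)) := by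
      refine LinearMap.ext fun q => ?_
      simp only [LinearMap.comp_apply, LinearEquiv.coe_coe]
      rw [haarRight_apply, ← mul_slice2, antipode_mul, antipode_slice2]; rfl
    have h2 : rTensor A (mulLeft ℂ d) ∘ₗ G.antipodeFlip ∘ₗ lTensor A (G.slice2 G.haar b)
        = (TensorProduct.comm ℂ A A).toLinearMap ∘ₗ
          TensorProduct.map G.antipode.toLinearMap (G.haarLeft (G.T3 (b ⊗ₜ d))) := by
      refine TensorProduct.ext' fun r s => ?_
      simp only [LinearMap.comp_apply, LinearMap.lTensor_tmul, antipodeFlip_tmul,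
        LinearMap.rTensor_tmul, LinearMap.mulLeft_apply, TensorProduct.map_tmul, haarLeft_apply,
        antipode_slice2, mul_slice4]
      rfl
    have h3 := LinearMap.congr_fun h2 (G.T3 (a ⊗ₜ c))
    simp only [LinearMap.comp_apply, LinearEquiv.coe_coe] at h3
    rw [h3, ← lTensor_haarRight, ← h1, LinearMap.lTensor_comp]; rfl
  exact LinearMap.congr_fun this x

/-- This and the two versions that follow are obtained by multiplying the free leg and switching
between canonical maps. -/
theorem T1_antipode (x c : A) :
    G.T1 (G.antipode x ⊗ₜ G.antipode c) = G.antipodeFlip (G.T4 (x ⊗ₜ c)) := by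
  refine G.nonDegenerate.ext_lTensor_mulRight fun d => ?_
  obtain ⟨d, rfl⟩ := G.antipode.surjective d
  rw [← G.comul_L_tmul, G.comul_L_tmul', T2_antipode, ← antipodeFlip_lTensor_mulLeft,
    ← antipodeFlip_rTensor_mulLeft, ← G.comul_R_tmul, ← G.comul_R_tmul']

theorem T4_antipode (x c : A) :
    G.T4 (G.antipode x ⊗ₜ G.antipode c) = G.antipodeFlip (G.T1 (x ⊗ₜ c)) := by
  refine G.nonDegenerate.ext_rTensor_mulRight fun d => ?_
  obtain ⟨d, rfl⟩ := G.antipode.surjective d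
  rw [G.rTensor_mulRight_T4, T1_antipode, ← antipodeFlip_rTensor_mulRight,
    ← antipodeFlip_lTensor_mulLeft, G.rTensor_mulRight_T4]

theorem T3_antipode (x c : A) :
    G.T3 (G.antipode x ⊗ₜ G.antipode c) = G.antipodeFlip (G.T2 (x ⊗ₜ c)) := by
  refine G.nonDegenerate.ext_lTensor_mulRight fun d => ?_
  obtain ⟨d, rfl⟩ := G.antipode.surjective d
  rw [← G.rTensor_mulLeft_T2, T2_antipode, ← antipodeFlip_lTensor_mulRight,
    ← antipodeFlip_rTensor_mulLeft, G.rTensor_mulLeft_T2]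

/-! ### Exchanging slices -/

/-- Both sides are `(f ⊙ g)((a ⊗ b)Δ(x))`. The next three lemmas place the factors differently
around `Δ(x)`. -/
theorem dual_mul_slice3 (f g : Module.Dual ℂ A) (a b x : A) :
    g (b * G.slice3 f a x) = f (a * G.slice4 g b x) := by
  rw [mul_slice4, slice_slice, sliceFst_lTensor]; rfl

theorem dual_slice1_mul (f g : Module.Dual ℂ A) (p b x : A) :
    g (G.slice1 f p b * x) = f (G.slice2 g x b * p) := by
  rw [slice2_mul, G.comul_L_tmul, slice_slice, sliceFst_lTensor]; rfl

theorem dual_slice3_mul (f g : Module.Dual ℂ A) (a b x : A) :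
    g (G.slice3 f a x * b) = f (a * G.slice2 g b x) := by
  rw [mul_slice2, slice_slice, sliceFst_lTensor]; rfl

theorem dual_mul_slice1 (f g : Module.Dual ℂ A) (d p x : A) :
    g (d * G.slice1 f p x) = f (G.slice4 g d x * p) := by
  rw [slice4_mul, slice_slice, sliceFst_lTensor]; rfl

theorem eq_zero_of_dual {x : A} (h : ∀ f : Module.Dual ℂ A, f x = 0) : x = 0 :=
  (Module.forall_dual_apply_eq_zero_iff ℂ x).1 h

/-! ### The Haar functional is faithful -/

theorem mul'_rTensor_antipode_T1 (v q : A) :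
    mul' ℂ A (rTensor A G.antipode.toLinearMap (G.T1 (v ⊗ₜ q)))
      = G.counitLin v • G.antipode q := by
  refine G.nonDegenerate.ext_left fun d => ?_
  have h1 : mulRight ℂ d ∘ₗ mul' ℂ A ∘ₗ rTensor A G.antipode.toLinearMap
      = mul' ℂ A ∘ₗ rTensor A G.antipode.toLinearMap ∘ₗ lTensor A (mulRight ℂ d) :=
    TensorProduct.ext' fun p q => by simp [mul_assoc]
  have h2 : mulLeft ℂ (G.antipode q) ∘ₗ mul' ℂ A ∘ₗ rTensor A G.antipode.toLinearMap
      = mul' ℂ A ∘ₗ rTensor A G.antipode.toLinearMap ∘ₗ rTensor A (mulRight ℂ q) :=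
    TensorProduct.ext' fun p q => by simp [mul_assoc, antipode_mul]
  have h3 := LinearMap.congr_fun h1 (G.T1 (v ⊗ₜ q))
  have h4 := LinearMap.congr_fun h2 (G.T2 (v ⊗ₜ d))
  simp only [LinearMap.comp_apply, LinearMap.mulRight_apply, LinearMap.mulLeft_apply,
    ← G.comul_L_tmul, ← G.comul_L_tmul'] at h3 h4
  rw [h3, ← h4, mul'_rTensor_antipode_T2, sliceFst_tmul, mul_smul_comm, smul_mul_assoc]

/-- Exchanging slices shows `(ι ⊙ φ)(Δ(c)(1 ⊗ v)) = 0`; strong invariance moves `Δ` from `c` to `v`.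
-/
theorem slice4_haar_eq_zero {v : A} (hv : ∀ c, G.haar (c * v) = 0) (c : A) :
    G.slice4 G.haar c v = 0 := by
  have h : G.slice2 G.haar v c = 0 := G.nonDegenerate.right _ fun p => eq_zero_of_dual fun f => by
    rw [← dual_slice3_mul, hv]
  rw [← antipode_slice2, h, map_zero]

/-- The second leg of `Δ(v)(q ⊗ 1)` is killed by every `φ(s ·)`. Taking `s = d S(p)`, with `p` the
first leg, gives `φ(d m(S ⊙ ι)(Δ(v)(q ⊗ 1))) = ε(v)φ(d S(q))`, and `d`, `q` are chosen to make the
last factor non-zero. -/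
theorem counitLin_eq_zero_of_haar {v : A} (hv : ∀ c, G.haar (c * v) = 0) :
    G.counitLin v = 0 := by
  obtain ⟨d, q, hdq⟩ : ∃ d q, G.haar (d * G.antipode q) ≠ 0 := by
    by_contra! h
    refine G.haar_ne_zero (G.ext_mul fun d q => ?_)
    obtain ⟨q, rfl⟩ := G.antipode.surjective q
    exact h d q
  have h1 : lTensor A G.haarMul.flip (G.T1 (v ⊗ₜ q)) = 0 := by
    refine eq_zero_of_sliceFst _ fun f => LinearMap.ext fun s => ?_
    rw [sliceFst_lTensor]
    change G.haar (s * G.slice1 f q v) = 0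
    rw [dual_mul_slice1, slice4_haar_eq_zero G hv, zero_mul, map_zero]
  have h2 : TensorProduct.lift (LinearMap.applyₗ ∘ₗ mulLeft ℂ d ∘ₗ G.antipode.toLinearMap) ∘ₗ
      lTensor A G.haarMul.flip
        = G.haar ∘ₗ mulLeft ℂ d ∘ₗ mul' ℂ A ∘ₗ rTensor A G.antipode.toLinearMap :=
    TensorProduct.ext' fun p q => by simp [mul_assoc]
  have h3 := LinearMap.congr_fun h2 (G.T1 (v ⊗ₜ q))
  simp only [LinearMap.comp_apply, h1, map_zero, mul'_rTensor_antipode_T1, map_smul,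
    LinearMap.mulLeft_apply, smul_eq_mul] at h3
  exact (mul_eq_zero.1 h3.symm).resolve_right hdq

/-- The hypothesis on `a` passes to its slices `slice3 f p a`, whose counit is `f(p a)`. -/
theorem haar_faithful_right {a : A} (ha : ∀ c, G.haar (c * a) = 0) : a = 0 :=
  G.nonDegenerate.right _ fun p => eq_zero_of_dual fun f => by
    rw [← counitLin_slice3]
    refine G.counitLin_eq_zero_of_haar fun c => ?_
    rw [dual_mul_slice3, slice4_haar_eq_zero G ha, mul_zero, map_zero]

theorem haar_faithful_left {a : A} (ha : ∀ c, G.haar (a * c) = 0) : a = 0 := by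
  rw [← star_eq_zero]
  refine G.haar_faithful_right fun c => ?_
  rw [← star_star c, ← star_mul, G.haar_selfAdjoint, ha, map_zero]

theorem ext_haar_right {a b : A} (h : ∀ c, G.haar (c * a) = G.haar (c * b)) : a = b :=
  sub_eq_zero.1 (G.haar_faithful_right fun c => by rw [mul_sub, map_sub, h, sub_self])

theorem ext_haar_left {a b : A} (h : ∀ c, G.haar (a * c) = G.haar (b * c)) : a = b :=
  sub_eq_zero.1 (G.haar_faithful_left fun c => by rw [sub_mul, map_sub, h, sub_self])

/-! ### The modular automorphism -/

/-- The right invariant functional `φ S`. -/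
noncomputable def rightHaar : Module.Dual ℂ A := G.haar ∘ₗ G.antipode.toLinearMap

theorem rightHaar_apply (x : A) : G.rightHaar x = G.haar (G.antipode x) := rfl

theorem comp_antipode_ne_zero {f : Module.Dual ℂ A} (hf : f ≠ 0) :
    f ∘ₗ G.antipode.toLinearMap ≠ 0 := fun h => hf (LinearMap.ext fun x => by
  obtain ⟨x, rfl⟩ := G.antipode.surjective x
  exact LinearMap.congr_fun h x)

theorem comp_antipode_symm_ne_zero {f : Module.Dual ℂ A} (hf : f ≠ 0) :
    f ∘ₗ G.antipode.symm.toLinearMap ≠ 0 := fun h => hf (LinearMap.ext fun x => by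
  obtain ⟨x, rfl⟩ := G.antipode.symm.surjective x
  exact LinearMap.congr_fun h x)

theorem sliceSnd_antipodeFlip (f : Module.Dual ℂ A) (t : A ⊗[ℂ] A) :
    sliceSnd f (G.antipodeFlip t) = G.antipode (sliceFst (f ∘ₗ G.antipode.toLinearMap) t) := by
  induction t with
  | zero => simp
  | add s t hs ht => simp only [map_add, hs, ht]
  | tmul a b => simp

/-- Strong invariance for `S(a)`, `S(b)`, pulled back through `Δ S = flip (S ⊙ S)Δ`: its mirror
image for `ψ`. -/
theorem antipode_slice3 (a b : A) :
    G.antipode (G.slice3 G.rightHaar b a) = G.slice1 G.rightHaar a b := by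
  have h := G.antipode_slice2 (G.antipode a) (G.antipode b)
  rw [slice2_apply, T2_antipode, slice4_apply, T4_antipode, sliceSnd_antipodeFlip,
    sliceSnd_antipodeFlip] at h
  exact G.antipode.injective h

theorem antipode_symm_mul (x y : A) :
    G.antipode.symm (x * y) = G.antipode.symm y * G.antipode.symm x := by
  apply G.antipode.injective
  simp [antipode_mul]

/-- The element `y` is expanded in slices by `φ S²`, because then exchanging slices and both forms
of strong invariance cancel every antipode. -/
theorem exists_haarMul_eq_rightHaar (y : A) :
    ∃ z, ∀ x, G.haar (y * x) = G.rightHaar (z * x) := by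
  obtain ⟨t, rfl⟩ := sliceFst_surjective
    (G.comp_antipode_ne_zero (G.comp_antipode_ne_zero G.haar_ne_zero)) y
  obtain ⟨t, rfl⟩ := G.T1.surjective t
  induction t with
  | zero => exact ⟨0, by simp⟩
  | add s t hs ht =>
    obtain ⟨z, hz⟩ := hs
    obtain ⟨w, hw⟩ := ht
    exact ⟨z + w, fun x => by simp only [map_add, add_mul, hz, hw]⟩
  | tmul b p =>
    -- With this `z`, both sides equal `ψ(S(p) · slice4 φ b x)`.
    refine ⟨G.slice2 (G.haar ∘ₗ G.antipode.symm.toLinearMap) (G.antipode b) (G.antipode p),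
      fun x => ?_⟩
    rw [← dual_slice1_mul]
    refine (G.dual_slice1_mul _ _ p b x).trans ?_
    simp only [LinearMap.comp_apply, LinearEquiv.coe_coe, antipode_mul, antipode_slice2,
      antipode_symm_mul, LinearEquiv.symm_apply_apply, ← antipode_slice3, dual_mul_slice3]
    rw [rightHaar_apply, antipode_mul]

/-- The same exchange with `y` expanded in slices by `φ S⁻¹`; together with the previous lemma it
carries `φ(a ·)` through `ψ` to `φ(· b)`. -/
theorem exists_rightHaar_eq_haar (y : A) :
    ∃ z, ∀ x, G.rightHaar (y * x) = G.haar (x * z) := by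
  obtain ⟨t, rfl⟩ := sliceSnd_surjective (G.comp_antipode_symm_ne_zero G.haar_ne_zero) y
  obtain ⟨t, rfl⟩ := G.T4_surjective t
  induction t with
  | zero => exact ⟨0, by simp⟩
  | add s t hs ht =>
    obtain ⟨z, hz⟩ := hs
    obtain ⟨w, hw⟩ := ht
    exact ⟨z + w, fun x => by simp only [map_add, add_mul, mul_add, hz, hw]⟩
  | tmul a b =>
    obtain ⟨b, rfl⟩ := G.antipode.surjective b
    refine ⟨G.slice1 G.haar (G.antipode a) b, fun x => ?_⟩
    rw [dual_mul_slice1]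
    refine (G.dual_mul_slice1 _ _ _ _ _).symm.trans ?_
    rw [← antipode_slice3]
    simp only [LinearMap.comp_apply, LinearEquiv.coe_coe]
    rw [antipode_symm_mul, LinearEquiv.symm_apply_apply, LinearEquiv.symm_apply_apply,
      dual_slice3_mul, rightHaar_apply, antipode_mul, antipode_slice2]

theorem exists_haar_mul_comm (a : A) : ∃ b, ∀ x, G.haar (a * x) = G.haar (x * b) := by
  obtain ⟨z, hz⟩ := G.exists_haarMul_eq_rightHaar a
  obtain ⟨b, hb⟩ := G.exists_rightHaar_eq_haar z
  exact ⟨b, fun x => by rw [hz, hb]⟩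

theorem exists_haar_mul_comm' (b : A) : ∃ a, ∀ x, G.haar (a * x) = G.haar (x * b) := by
  obtain ⟨c, hc⟩ := G.exists_haar_mul_comm (star b)
  refine ⟨star c, fun x => ?_⟩
  have := congrArg (starRingEnd ℂ) (hc (star x))
  rw [← G.haar_selfAdjoint, ← G.haar_selfAdjoint] at this
  simpa using this.symm

/-- The modular automorphism `σ`, with `φ(a x) = φ(x σ(a))`. -/
noncomputable def modular : A →ₗ[ℂ] A where
  toFun a := (G.exists_haar_mul_comm a).choose
  map_add' a b := G.ext_haar_right fun c => by
    rw [← (G.exists_haar_mul_comm _).choose_spec, mul_add, map_add,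
      ← (G.exists_haar_mul_comm _).choose_spec, ← (G.exists_haar_mul_comm _).choose_spec,
      add_mul, map_add]
  map_smul' r a := G.ext_haar_right fun c => by
    rw [← (G.exists_haar_mul_comm _).choose_spec, mul_smul_comm, map_smul, RingHom.id_apply,
      ← (G.exists_haar_mul_comm _).choose_spec, smul_mul_assoc, map_smul]

theorem haar_mul_modular (a x : A) : G.haar (x * G.modular a) = G.haar (a * x) :=
  ((G.exists_haar_mul_comm a).choose_spec x).symm

theorem modular_mul (a b : A) : G.modular (a * b) = G.modular a * G.modular b :=
  G.ext_haar_right fun c => by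
    rw [haar_mul_modular, ← mul_assoc, haar_mul_modular, ← mul_assoc, haar_mul_modular, mul_assoc]

theorem mem_range_haarMul (ω : Module.Dual ℂ A) :
    ω ∈ LinearMap.range G.haarMul ↔ ∃ a : A, ∀ x : A, ω x = G.haar (x * a) := by
  constructor
  · rintro ⟨a, rfl⟩
    exact ⟨G.modular a, fun x => (G.haar_mul_modular a x).symm⟩
  · rintro ⟨b, hb⟩
    obtain ⟨a, ha⟩ := G.exists_haar_mul_comm' b
    exact ⟨a, LinearMap.ext fun x => by rw [haarMul_apply, ha, hb]⟩

end StarQuantumGroup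

/-- A linear map that vanishes on the kernel of a surjective linear map factors through it. -/
theorem exists_factor {U V W : Type*} [AddCommGroup U] [Module ℂ U] [AddCommGroup V] [Module ℂ V]
    [AddCommGroup W] [Module ℂ W] (P : U →ₗ[ℂ] V) (F : U →ₗ[ℂ] W)
    (hP : Function.Surjective P) (h : ∀ t, P t = 0 → F t = 0) :
    ∃ k : V →ₗ[ℂ] W, ∀ t, k (P t) = F t := by
  obtain ⟨s, hs⟩ := P.exists_rightInverse_of_surjective (LinearMap.range_eq_top.2 hP)
  refine ⟨F ∘ₗ s, fun t => ?_⟩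
  rw [← sub_eq_zero, LinearMap.comp_apply, ← map_sub]
  refine h _ ?_
  rw [map_sub, ← LinearMap.comp_apply, hs, LinearMap.id_apply, sub_self]

namespace StarQuantumGroup

open MultiplierHopfStar
open LinearMap (mulLeft mulRight rTensor lTensor mul')

variable {A : Type*} [NonUnitalRing A] [Module ℂ A] [IsScalarTower ℂ A A]
  [SMulCommClass ℂ A A] [StarRing A] [StarModule ℂ A] (G : StarQuantumGroup A)

/-! ### Slices by elements of the dual -/

/-- The linear isomorphism `a ↦ φ a` of `A` onto `Â`. -/
noncomputable def dualEquiv : A ≃ₗ[ℂ] G.Dual :=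
  LinearEquiv.ofInjective G.haarMul (by
    rw [injective_iff_map_eq_zero]
    exact fun a ha => G.haar_faithful_left fun c => LinearMap.congr_fun ha c)

theorem dualEquiv_apply (a x : A) : (G.dualEquiv a).1 x = G.haar (a * x) := rfl

theorem coe_dualEquiv (a : A) : (G.dualEquiv a).1 = G.haar ∘ₗ mulLeft ℂ a := rfl

theorem sliceElem_dualEquiv (a x : A) : G.sliceElem (G.dualEquiv a) x = G.slice4 G.haar a x :=
  G.sliceElem_eq _ _ _ fun b => by rw [slice4_mul, sliceSnd_lTensor]; rfl

/-- `(ω, x) ↦ (ω ⊙ ι)Δ(x)`, for `ω ∈ Â`. -/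
noncomputable def leftElem : G.Dual →ₗ[ℂ] A →ₗ[ℂ] A :=
  (TensorProduct.curry (sliceFst G.haar ∘ₗ G.T3)).flip ∘ₗ G.dualEquiv.symm.toLinearMap

theorem leftElem_dualEquiv (a : A) : G.leftElem (G.dualEquiv a) = G.slice3 G.haar a := by
  ext x
  change sliceFst G.haar (G.T3 (x ⊗ₜ G.dualEquiv.symm (G.dualEquiv a))) = _
  rw [LinearEquiv.symm_apply_apply]; rfl

theorem sliceElemLinear_dualEquiv (a : A) :
    G.sliceElemLinear (G.dualEquiv a) = G.slice4 G.haar a :=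
  LinearMap.ext fun x => G.sliceElem_dualEquiv a x

theorem sliceElemLinear_apply (ω : G.Dual) (x : A) :
    G.sliceElemLinear ω x = G.sliceElem ω x := rfl

theorem leftElem_mul (ω : G.Dual) (x b : A) :
    G.leftElem ω x * b = sliceFst ω.1 (G.T2 (x ⊗ₜ b)) := by
  obtain ⟨a, rfl⟩ := G.dualEquiv.surjective ω
  rw [leftElem_dualEquiv, slice3_mul, sliceFst_rTensor, coe_dualEquiv]

theorem mul_leftElem (ω : G.Dual) (x b : A) :
    b * G.leftElem ω x = sliceFst ω.1 (G.T4 (x ⊗ₜ b)) := by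
  obtain ⟨a, rfl⟩ := G.dualEquiv.surjective ω
  rw [leftElem_dualEquiv, mul_slice3, sliceFst_rTensor, coe_dualEquiv]

theorem emb_leftElem (ω : G.Dual) (x : A) : Mult.emb (G.leftElem ω x) = G.sliceL ω.1 x :=
  Mult.ext_L G.nonDegenerate fun b => G.leftElem_mul ω x b

theorem leftElem_eq (ω : G.Dual) (x y : A) (h : ∀ b, y * b = sliceFst ω.1 (G.T2 (x ⊗ₜ b))) :
    G.leftElem ω x = y :=
  G.nonDegenerate.ext_left fun b => by rw [leftElem_mul, h]

/-- Both are `(ω ⊙ η)Δ(x)`, so the product of `Â` can also be computed with left slices. -/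
theorem dual_leftElem (ω η : G.Dual) (x : A) :
    η.1 (G.leftElem ω x) = ω.1 (G.sliceElem η x) := by
  obtain ⟨a, rfl⟩ := G.dualEquiv.surjective ω
  obtain ⟨b, rfl⟩ := G.dualEquiv.surjective η
  rw [leftElem_dualEquiv, sliceElem_dualEquiv, dualEquiv_apply, dualEquiv_apply, dual_mul_slice3]

theorem mul_apply' (ω η : G.Dual) (x : A) : (ω * η).1 x = η.1 (G.leftElem ω x) := by
  rw [dual_leftElem, mul_apply]

theorem rightCovariant_sliceElem (ω : G.Dual) : G.RightCovariant (G.sliceElemLinear ω) := by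
  obtain ⟨a, rfl⟩ := G.dualEquiv.surjective ω
  rw [sliceElemLinear_dualEquiv]
  exact G.rightCovariant_slice4 _ _

theorem leftCovariant_leftElem (ω : G.Dual) : G.LeftCovariant (G.leftElem ω) := by
  obtain ⟨a, rfl⟩ := G.dualEquiv.surjective ω
  rw [leftElem_dualEquiv]
  exact G.leftCovariant_slice3 _ _

theorem leftElem_sliceElem (ω η : G.Dual) (x : A) :
    G.leftElem η (G.sliceElem ω x) = G.sliceElem ω (G.leftElem η x) := by
  obtain ⟨a, rfl⟩ := G.dualEquiv.surjective η
  rw [leftElem_dualEquiv]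
  exact (G.rightCovariant_sliceElem ω).slice3 _ _ _

theorem sliceElem_mul_dual (ω η : G.Dual) (x : A) :
    G.sliceElem (ω * η) x = G.sliceElem ω (G.sliceElem η x) :=
  G.sliceElem_eq _ _ _ fun b => by
    rw [sliceElem_mul, ← sliceElemLinear_apply, G.rightCovariant_sliceElem η, sliceSnd_lTensor]
    rfl

theorem counitLin_sliceElem (ω : G.Dual) (x : A) : G.counitLin (G.sliceElem ω x) = ω.1 x := by
  obtain ⟨a, rfl⟩ := G.dualEquiv.surjective ω
  rw [sliceElem_dualEquiv, counitLin_slice4, dualEquiv_apply]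

theorem ext_sliceElem {N : Type*} [AddCommGroup N] [Module ℂ N] {h k : A →ₗ[ℂ] N}
    (H : ∀ (ω : G.Dual) x, h (G.sliceElem ω x) = k (G.sliceElem ω x)) : h = k :=
  G.ext_slice4 G.haar_ne_zero fun x a => by rw [← sliceElem_dualEquiv, H]

theorem ext_leftElem {N : Type*} [AddCommGroup N] [Module ℂ N] {h k : A →ₗ[ℂ] N}
    (H : ∀ (ω : G.Dual) x, h (G.leftElem ω x) = k (G.leftElem ω x)) : h = k :=
  G.ext_slice3 G.haar_ne_zero fun x a => by rw [← leftElem_dualEquiv, H]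

theorem eq_zero_of_dual_apply {x : A} (h : ∀ ω : G.Dual, ω.1 x = 0) : x = 0 :=
  G.haar_faithful_right fun c => h (G.dualEquiv c)

/-! ### The dual algebra -/

theorem dual_mul_assoc (ω η θ : G.Dual) : ω * η * θ = ω * (η * θ) :=
  Subtype.ext (LinearMap.ext fun x => by
    rw [mul_apply, mul_apply, mul_apply, sliceElem_mul_dual])

noncomputable scoped instance instNonUnitalRingDual : NonUnitalRing G.Dual :=
  { (inferInstance : NonUnitalNonAssocRing G.Dual) with mul_assoc := G.dual_mul_assoc }

/-- If `ω η = 0` for all `η`, then `ω` vanishes on all right slices `(ι ⊙ η)Δ(x)`, which span `A`;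
left slices serve the other side. -/
theorem nonDegenerate_dual : NonDegenerate G.Dual where
  left ω h := Subtype.ext (G.ext_sliceElem fun η x => by
    rw [← mul_apply, h]; rfl)
  right ω h := Subtype.ext (G.ext_leftElem fun η x => by
    rw [← mul_apply', h]; rfl)

/-- The functional `x ↦ conj (ω(S(x)*))`. -/
noncomputable def adjointFunctional (ω : Module.Dual ℂ A) : Module.Dual ℂ A where
  toFun x := starRingEnd ℂ (ω (star (G.antipode x)))
  map_add' x y := by simp
  map_smul' c x := by simp

theorem adjointFunctional_apply (ω : Module.Dual ℂ A) (x : A) :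
    G.adjointFunctional ω x = starRingEnd ℂ (ω (star (G.antipode x))) := rfl

/-- For `ω = φ a` the adjoint is `x ↦ φ(S(x)a*) = ψ(S⁻¹(a*)x)`, a translate of `ψ` and so of `φ`. -/
theorem adjointFunctional_mem (ω : G.Dual) :
    G.adjointFunctional ω.1 ∈ LinearMap.range G.haarMul := by
  obtain ⟨a, rfl⟩ := G.dualEquiv.surjective ω
  obtain ⟨z, hz⟩ := G.exists_rightHaar_eq_haar (G.antipode.symm (star a))
  refine (G.mem_range_haarMul _).2 ⟨z, fun x => ?_⟩
  rw [← hz, rightHaar_apply, antipode_mul, LinearEquiv.apply_symm_apply, adjointFunctional_apply,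
    dualEquiv_apply, ← G.haar_selfAdjoint, star_mul, star_star]

noncomputable scoped instance instStarDual : Star G.Dual := ⟨fun ω => ⟨_, G.adjointFunctional_mem ω⟩⟩

theorem star_dual_apply (ω : G.Dual) (x : A) :
    (star ω).1 x = starRingEnd ℂ (ω.1 (star (G.antipode x))) := rfl

/-- The map `x ↦ S(x)*` reverses `Δ`, so it exchanges right and left slices. This makes `*`
antimultiplicative on `Â`. -/
theorem sliceElem_star_antipode (η : G.Dual) (x : A) :
    G.sliceElem η (star (G.antipode x)) = star (G.antipode (G.leftElem (star η) x)) := by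
  have h (t : A ⊗[ℂ] A) : sliceSnd η.1 (star (G.antipodeFlip t))
      = star (G.antipode (sliceFst (star η).1 t)) := by
    induction t with
    | zero => simp
    | add s t hs ht => simp only [map_add, star_add, hs, ht]
    | tmul p q => simp [star_dual_apply]
  refine G.sliceElem_eq _ _ _ fun b => ?_
  obtain ⟨c, rfl⟩ : ∃ c, b = star (G.antipode c) := ⟨G.antipode.symm (star b), by simp⟩
  have h2 : G.T1 (star (G.antipode x) ⊗ₜ star (G.antipode c))
      = star (G.antipodeFlip (G.T2 (x ⊗ₜ c))) := by
    rw [← T3_antipode, star_T3]; simp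
  rw [h2, h, ← star_mul, ← antipode_mul, leftElem_mul]

theorem leftElem_star_antipode (η : G.Dual) (x : A) :
    G.leftElem (star η) (star (G.antipode x)) = star (G.antipode (G.sliceElem η x)) := by
  have h := G.sliceElem_star_antipode η (star (G.antipode x))
  rw [antipode_star_antipode, star_star] at h
  rw [h, antipode_star_antipode, star_star]

noncomputable scoped instance instStarRingDual : StarRing G.Dual where
  star_involutive ω := Subtype.ext (LinearMap.ext fun x => by
    rw [star_dual_apply, star_dual_apply, antipode_star_antipode, star_star, Complex.conj_conj])
  star_mul ω η := Subtype.ext (LinearMap.ext fun x => by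
    rw [star_dual_apply, mul_apply, sliceElem_star_antipode, mul_apply', star_dual_apply])
  star_add ω η := Subtype.ext (LinearMap.ext fun x => by
    change starRingEnd ℂ (ω.1 _ + η.1 _) = _
    rw [map_add]; rfl)

scoped instance instStarModuleDual : StarModule ℂ G.Dual := ⟨fun c ω => Subtype.ext (LinearMap.ext fun x => by
  change starRingEnd ℂ (c * ω.1 _) = _
  rw [map_mul]; rfl)⟩

/-! ### The multiplier algebra of the dual -/

theorem isImplementedBy_iff (T : Mult G.Dual) (θ : Module.Dual ℂ A) :
    G.IsImplementedBy T θ ↔ (∀ ω x, (T.L ω).1 x = θ (G.sliceElem ω x)) ∧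
      ∀ ω x, (T.R ω).1 x = θ (G.leftElem ω x) := by
  constructor
  · exact fun h => ⟨fun ω x => (h ω x _).1 (G.emb_sliceElem ω x),
      fun ω x => (h ω x _).2 (G.emb_leftElem ω x)⟩
  · refine fun h ω x y => ⟨fun hy => ?_, fun hy => ?_⟩
    · rw [h.1, Mult.emb_injective G.nonDegenerate (hy.trans (G.emb_sliceElem ω x).symm)]
    · rw [h.2, Mult.emb_injective G.nonDegenerate (hy.trans (G.emb_leftElem ω x).symm)]

/-- The functional must send `(ι ⊙ ω)Δ(x)` to `(T ω)(x)`. For well-definedness, `D` collects the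
slices `(ι ⊙ T ω)Δ(x)`: testing with `η` gives `(η T)((ι ⊙ ω)Δ(x))`, so `D` vanishes when the
original slice does, and `ε` recovers `(T ω)(x)` from it. -/
theorem exists_implementing (T : Mult G.Dual) : ∃ θ, G.IsImplementedBy T θ := by
  let F : A ⊗[ℂ] A →ₗ[ℂ] ℂ := TensorProduct.lift
    ((Submodule.subtype _ ∘ₗ T.L ∘ₗ G.dualEquiv.toLinearMap).flip)
  have hF (x b : A) : F (x ⊗ₜ b) = (T.L (G.dualEquiv b)).1 x := rfl
  let D : A ⊗[ℂ] A →ₗ[ℂ] A := TensorProduct.lift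
    ((G.sliceElemLinear ∘ₗ T.L ∘ₗ G.dualEquiv.toLinearMap).flip)
  have hD (x b : A) : D (x ⊗ₜ b) = G.sliceElem (T.L (G.dualEquiv b)) x := rfl
  have h1 (t : A ⊗[ℂ] A) : G.counitLin (D t) = F t := by
    have : G.counitLin ∘ₗ D = F := TensorProduct.ext' fun x b => by
      rw [LinearMap.comp_apply, hD, counitLin_sliceElem, hF]
    exact LinearMap.congr_fun this t
  have h2 (η : G.Dual) (t : A ⊗[ℂ] A) : η.1 (D t) = (T.R η).1 (sliceSnd G.haar (G.T4 t)) := by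
    have : η.1 ∘ₗ D = (T.R η).1 ∘ₗ sliceSnd G.haar ∘ₗ G.T4 := TensorProduct.ext' fun x b => by
      rw [LinearMap.comp_apply, hD, ← mul_apply, ← Mult.central, mul_apply, sliceElem_dualEquiv]
      rfl
    exact LinearMap.congr_fun this t
  obtain ⟨θ, hθ⟩ := exists_factor (sliceSnd G.haar ∘ₗ G.T4) F
    ((sliceSnd_surjective G.haar_ne_zero).comp G.T4_surjective) fun t ht => by
      have h0 : D t = 0 := G.eq_zero_of_dual_apply fun η =>
        (h2 η t).trans ((congrArg (T.R η).1 ht).trans (map_zero _))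
      rw [← h1, h0, map_zero]
  have h3 (ω : G.Dual) (x : A) : (T.L ω).1 x = θ (G.sliceElem ω x) := by
    obtain ⟨b, rfl⟩ := G.dualEquiv.surjective ω
    rw [← hF, ← hθ, sliceElem_dualEquiv]; rfl
  refine ⟨θ, (G.isImplementedBy_iff T θ).2 ⟨h3, fun η => ?_⟩⟩
  refine LinearMap.congr_fun (g := θ ∘ₗ G.leftElem η) (G.ext_sliceElem fun ω x => ?_)
  rw [← mul_apply, Mult.central, mul_apply', h3, LinearMap.comp_apply, leftElem_sliceElem]

theorem IsImplementedBy.unique {T : Mult G.Dual} {θ θ' : Module.Dual ℂ A}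
    (h : G.IsImplementedBy T θ) (h' : G.IsImplementedBy T θ') : θ = θ' :=
  G.ext_sliceElem fun ω x => by
    rw [← ((G.isImplementedBy_iff T θ).1 h).1, ← ((G.isImplementedBy_iff T θ').1 h').1]

/-- By covariance, slicing `Δ` by `θ` at `(ω ⊙ ι)Δ(x)` gives `(ω T ⊙ ι)Δ(x)`, an element of `A`;
such elements span. The right slices use `T ω`. -/
theorem IsImplementedBy.isDualMultiplier {T : Mult G.Dual} {θ : Module.Dual ℂ A}
    (h : G.IsImplementedBy T θ) : G.IsDualMultiplier θ := by
  rw [isImplementedBy_iff] at h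
  have hL (ω : G.Dual) (x : A) : G.sliceL θ (G.leftElem ω x) = Mult.emb (G.leftElem (T.R ω) x) :=
    Mult.ext_L G.nonDegenerate fun b => by
      rw [Mult.L_emb, leftElem_mul]
      change sliceFst θ (G.T2 (G.leftElem ω x ⊗ₜ b)) = _
      rw [G.leftCovariant_leftElem, sliceFst_rTensor]
      congr 2
      exact LinearMap.ext fun y => (h.2 ω y).symm
  have hR (ω : G.Dual) (x : A) :
      G.sliceR θ (G.sliceElem ω x) = Mult.emb (G.sliceElem (T.L ω) x) :=
    Mult.ext_L G.nonDegenerate fun b => by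
      rw [Mult.L_emb, sliceElem_mul]
      change sliceSnd θ (G.T1 (G.sliceElemLinear ω x ⊗ₜ b)) = _
      rw [G.rightCovariant_sliceElem, sliceSnd_lTensor]
      congr 2
      exact LinearMap.ext fun y => (h.1 ω y).symm
  refine fun a => ⟨?_, ?_⟩
  · obtain ⟨t, rfl⟩ := sliceFst_surjective G.haar_ne_zero a
    obtain ⟨t, rfl⟩ := G.T3_surjective t
    induction t with
    | zero => exact ⟨0, Mult.ext_L G.nonDegenerate fun b => by
        simp [MultiplierHopfStar.sliceL]; rfl⟩
    | add s t hs ht =>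
      obtain ⟨y, hy⟩ := hs
      obtain ⟨z, hz⟩ := ht
      refine ⟨y + z, ?_⟩
      rw [map_add, hy, hz]
      exact Mult.ext_L G.nonDegenerate fun b => by
        simp [MultiplierHopfStar.sliceL]
    | tmul x b =>
      refine ⟨_, (hL (G.dualEquiv b) x).symm.trans ?_⟩
      rw [leftElem_dualEquiv]; rfl
  · obtain ⟨t, rfl⟩ := sliceSnd_surjective G.haar_ne_zero a
    obtain ⟨t, rfl⟩ := G.T4_surjective t
    induction t with
    | zero => exact ⟨0, Mult.ext_L G.nonDegenerate fun b => by
        simp [MultiplierHopfStar.sliceR]; rfl⟩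
    | add s t hs ht =>
      obtain ⟨y, hy⟩ := hs
      obtain ⟨z, hz⟩ := ht
      refine ⟨y + z, ?_⟩
      rw [map_add, hy, hz]
      exact Mult.ext_L G.nonDegenerate fun b => by
        simp [MultiplierHopfStar.sliceR]
    | tmul x b =>
      refine ⟨_, (hR (G.dualEquiv b) x).symm.trans ?_⟩
      rw [sliceElem_dualEquiv]; rfl

variable {G}

/-- By strong invariance, for `ω = φ b` the functional is `x ↦ φ(w x)` with `w = (θ S ⊙ ι)Δ(b) =
S⁻¹((ι ⊙ θ)Δ(S(b)))`, which the hypothesis places in `A`. -/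
theorem IsDualMultiplier.comp_sliceElem_mem {θ : Module.Dual ℂ A} (h : G.IsDualMultiplier θ)
    (ω : G.Dual) : θ ∘ₗ G.sliceElemLinear ω ∈ LinearMap.range G.haarMul := by
  obtain ⟨b, rfl⟩ := G.dualEquiv.surjective ω
  obtain ⟨y, hy⟩ := (h (G.antipode b)).2
  have hw (c : A) : G.antipode.symm y * c
      = sliceFst (θ ∘ₗ G.antipode.toLinearMap) (G.T2 (b ⊗ₜ c)) := by
    apply G.antipode.injective
    rw [antipode_mul, LinearEquiv.apply_symm_apply, ← sliceSnd_antipodeFlip, ← T3_antipode]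
    exact LinearMap.congr_fun (congrArg Mult.R hy) (G.antipode c)
  refine ⟨G.antipode.symm y, LinearMap.ext fun x => ?_⟩
  rw [haarMul_apply, hw, ← slice_slice, LinearMap.comp_apply, LinearMap.comp_apply,
    sliceElemLinear_dualEquiv, ← antipode_slice2]
  rfl

/-- The mirror argument: `φ a` is rewritten as `ψ z`, since strong invariance for `slice3` is
available for `ψ`. -/
theorem IsDualMultiplier.comp_leftElem_mem {θ : Module.Dual ℂ A} (h : G.IsDualMultiplier θ)
    (ω : G.Dual) : θ ∘ₗ G.leftElem ω ∈ LinearMap.range G.haarMul := by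
  obtain ⟨a, rfl⟩ := G.dualEquiv.surjective ω
  obtain ⟨z, hz⟩ := G.exists_haarMul_eq_rightHaar a
  obtain ⟨y, hy⟩ := (h (G.antipode.symm z)).1
  have hw (c : A) : G.antipode y * c
      = sliceSnd (θ ∘ₗ G.antipode.symm.toLinearMap) (G.T1 (z ⊗ₜ c)) := by
    obtain ⟨c, rfl⟩ := G.antipode.surjective c
    have h1 := T1_antipode G (G.antipode.symm z) c
    rw [LinearEquiv.apply_symm_apply] at h1
    rw [← antipode_mul, h1, sliceSnd_antipodeFlip]
    congr 1
    refine (LinearMap.congr_fun (congrArg Mult.R hy) c).trans ?_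
    change sliceFst θ _ = sliceFst _ _
    congr 2
    exact LinearMap.ext fun x => by simp
  have hl (x : A) : G.leftElem (G.dualEquiv a) x = G.slice3 G.rightHaar z x :=
    G.leftElem_eq _ _ _ fun b => by
      rw [slice3_mul, sliceFst_rTensor]
      congr 2
      exact LinearMap.ext fun y => (hz y).symm
  obtain ⟨w, hw'⟩ := G.exists_rightHaar_eq_haar (G.antipode y)
  refine (G.mem_range_haarMul _).2 ⟨w, fun x => ?_⟩
  rw [← hw', hw, slice_slice, LinearMap.comp_apply, hl]
  change _ = θ (G.antipode.symm (G.slice1 G.rightHaar x z))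
  rw [← antipode_slice3, LinearEquiv.symm_apply_apply]

theorem IsDualMultiplier.exists_mult {θ : Module.Dual ℂ A} (h : G.IsDualMultiplier θ) :
    ∃ T : Mult G.Dual, G.IsImplementedBy T θ := by
  let l : G.Dual →ₗ[ℂ] G.Dual :=
    { toFun := fun ω => ⟨_, h.comp_sliceElem_mem ω⟩
      map_add' := fun ω η => Subtype.ext (by
        change θ ∘ₗ G.sliceElemLinear (ω + η) = θ ∘ₗ _ + θ ∘ₗ _
        rw [map_add, LinearMap.comp_add])
      map_smul' := fun c ω => Subtype.ext (by
        change θ ∘ₗ G.sliceElemLinear (c • ω) = c • (θ ∘ₗ _)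
        rw [map_smul, LinearMap.comp_smul]) }
  let r : G.Dual →ₗ[ℂ] G.Dual :=
    { toFun := fun ω => ⟨_, h.comp_leftElem_mem ω⟩
      map_add' := fun ω η => Subtype.ext (by
        change θ ∘ₗ G.leftElem (ω + η) = θ ∘ₗ _ + θ ∘ₗ _
        rw [map_add, LinearMap.comp_add])
      map_smul' := fun c ω => Subtype.ext (by
        change θ ∘ₗ G.leftElem (c • ω) = c • (θ ∘ₗ _)
        rw [map_smul, LinearMap.comp_smul]) }
  refine ⟨Mult.mk l r fun ω η => Subtype.ext (LinearMap.ext fun x => ?_),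
    (G.isImplementedBy_iff _ _).2 ⟨fun ω x => rfl, fun ω x => rfl⟩⟩
  rw [mul_apply, mul_apply']
  exact congrArg θ (G.leftElem_sliceElem η ω x)

theorem IsImplementedBy.eq {T T' : Mult G.Dual} {θ : Module.Dual ℂ A}
    (h : G.IsImplementedBy T θ) (h' : G.IsImplementedBy T' θ) : T = T' := by
  rw [isImplementedBy_iff] at h h'
  exact Mult.ext_L G.nonDegenerate_dual fun ω => Subtype.ext (LinearMap.ext fun x => by
    rw [h.1, h'.1])

theorem IsImplementedBy.star_apply {T : Mult G.Dual} {θ θ' : Module.Dual ℂ A}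
    (h : G.IsImplementedBy T θ) (h' : G.IsImplementedBy (star T) θ') (x : A) :
    θ' x = starRingEnd ℂ (θ (star (G.antipode x))) := by
  rw [isImplementedBy_iff] at h h'
  suffices θ' = G.adjointFunctional θ from LinearMap.congr_fun this x
  refine G.ext_sliceElem fun ω x => ?_
  rw [← h'.1, Mult.L_star, star_dual_apply, h.2, leftElem_star_antipode, adjointFunctional_apply]

end StarQuantumGroup

/-! ### Multipliers commute with one-sided module maps. -/

namespace Mult

variable {X : Type*} [NonUnitalRing X] [Module ℂ X] [IsScalarTower ℂ X X]
  [SMulCommClass ℂ X X]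

theorem L_comm (hX : NonDegenerate X) (m : Mult X) (h : X →ₗ[ℂ] X)
    (hh : ∀ s t, s * h t = h (s * t)) (t : X) : m.L (h t) = h (m.L t) :=
  hX.ext_right fun s => by rw [← central, hh, hh, central]

theorem R_comm (hX : NonDegenerate X) (m : Mult X) (h : X →ₗ[ℂ] X)
    (hh : ∀ s t, h s * t = h (s * t)) (t : X) : m.R (h t) = h (m.R t) :=
  hX.ext_left fun s => by rw [central, hh, hh, central]

end Mult

section Tensor

open LinearMap (mulLeft mulRight rTensor lTensor mul')

variable {X Y : Type*} [NonUnitalRing X] [Module ℂ X] [IsScalarTower ℂ X X]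
  [SMulCommClass ℂ X X] [NonUnitalRing Y] [Module ℂ Y] [IsScalarTower ℂ Y Y]
  [SMulCommClass ℂ Y Y]

theorem mul_rTensor_mulRight (c : X) (s t : X ⊗[ℂ] Y) :
    s * rTensor Y (mulRight ℂ c) t = rTensor Y (mulRight ℂ c) (s * t) := by
  induction s with
  | zero => simp
  | add s s' hs hs' => simp only [add_mul, map_add, hs, hs']
  | tmul x y =>
    induction t with
    | zero => simp
    | add t t' ht ht' => simp only [mul_add, map_add, ht, ht']
    | tmul x' y' => simp [mul_assoc]

theorem rTensor_mulLeft_mul (c : X) (s t : X ⊗[ℂ] Y) :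
    rTensor Y (mulLeft ℂ c) s * t = rTensor Y (mulLeft ℂ c) (s * t) := by
  induction s with
  | zero => simp
  | add s s' hs hs' => simp only [add_mul, map_add, hs, hs']
  | tmul x y =>
    induction t with
    | zero => simp
    | add t t' ht ht' => simp only [mul_add, map_add, ht, ht']
    | tmul x' y' => simp [mul_assoc]

theorem Mult.L_rTensor (h : NonDegenerate (X ⊗[ℂ] Y)) (V : Mult (X ⊗[ℂ] Y)) (c : X)
    (t : X ⊗[ℂ] Y) :
    V.L (rTensor Y (mulRight ℂ c) t) = rTensor Y (mulRight ℂ c) (V.L t) :=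
  V.L_comm h _ (mul_rTensor_mulRight c) t

theorem Mult.R_rTensor (h : NonDegenerate (X ⊗[ℂ] Y)) (V : Mult (X ⊗[ℂ] Y)) (c : X)
    (t : X ⊗[ℂ] Y) :
    V.R (rTensor Y (mulLeft ℂ c) t) = rTensor Y (mulLeft ℂ c) (V.R t) :=
  V.R_comm h _ (rTensor_mulLeft_mul c) t

theorem tmul_mul_eq (x : X) (y : Y) (t : X ⊗[ℂ] Y) :
    (x ⊗ₜ y) * t = rTensor Y (mulLeft ℂ x) (lTensor X (mulLeft ℂ y) t) := by
  induction t with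
  | zero => simp
  | add t t' ht ht' => simp only [mul_add, map_add, ht, ht']
  | tmul x' y' => simp

theorem mul_tmul_eq (x : X) (y : Y) (t : X ⊗[ℂ] Y) :
    t * (x ⊗ₜ y) = rTensor Y (mulRight ℂ x) (lTensor X (mulRight ℂ y) t) := by
  induction t with
  | zero => simp
  | add t t' ht ht' => simp only [add_mul, map_add, ht, ht']
  | tmul x' y' => simp

end Tensor

namespace StarQuantumGroup

open MultiplierHopfStar
open LinearMap (mulLeft mulRight rTensor lTensor mul')

variable {A : Type*} [NonUnitalRing A] [Module ℂ A] [IsScalarTower ℂ A A]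
  [SMulCommClass ℂ A A] [StarRing A] [StarModule ℂ A] (G : StarQuantumGroup A)

/-- The linear isomorphism `a ↦ a φ` of `A` onto `Â`. -/
noncomputable def dualEquivRight : A ≃ₗ[ℂ] G.Dual :=
  LinearEquiv.ofBijective
    (LinearMap.codRestrict _ G.haarMul.flip fun a => (G.mem_range_haarMul _).2 ⟨a, fun _ => rfl⟩) (by
      constructor
      · rw [injective_iff_map_eq_zero]
        exact fun a ha => G.haar_faithful_right fun c =>
          LinearMap.congr_fun (congrArg Subtype.val ha) c
      · intro ω
        obtain ⟨a, ha⟩ := (G.mem_range_haarMul _).1 ω.2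
        exact ⟨a, Subtype.ext (LinearMap.ext fun x => (ha x).symm)⟩)

theorem dualEquivRight_apply (a x : A) : (G.dualEquivRight a).1 x = G.haar (x * a) := rfl

theorem coe_dualEquivRight (a : A) : (G.dualEquivRight a).1 = G.haar ∘ₗ mulRight ℂ a := rfl

theorem modular_surjective : Function.Surjective G.modular := fun b => by
  obtain ⟨a, ha⟩ := G.exists_haar_mul_comm' b
  exact ⟨a, G.ext_haar_right fun x => by rw [haar_mul_modular, ha]⟩

/-! ### The map `π_V` and its injectivity. -/

section Slice

variable {B : Type*} [NonUnitalRing B] [Module ℂ B] [IsScalarTower ℂ B B]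
  [SMulCommClass ℂ B B]

theorem ext_sliceFst_dual {Y : Type*} [AddCommGroup Y] [Module ℂ Y] {s t : A ⊗[ℂ] Y}
    (h : ∀ ω : G.Dual, sliceFst ω.1 s = sliceFst ω.1 t) : s = t :=
  ext_sliceSnd fun g => sub_eq_zero.1 (G.eq_zero_of_dual_apply fun ω => by
    rw [map_sub, slice_slice, slice_slice, h, sub_self])

theorem sliceFst_haar_mulLeft {Y : Type*} [AddCommGroup Y] [Module ℂ Y] (e : A) (t : A ⊗[ℂ] Y) :
    sliceFst G.haar (rTensor Y (mulLeft ℂ e) t)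
      = sliceFst G.haar (rTensor Y (mulRight ℂ (G.modular e)) t) := by
  rw [sliceFst_rTensor, sliceFst_rTensor]
  congr 2
  exact LinearMap.ext fun x => (G.haar_mul_modular e x).symm

/-- The two formulas must define one multiplier. As `A² = A`, take `c = e f`; moving `e` and `f`
across `φ` by `σ` turns both sides into `(φ ⊙ ι)` of `(f ⊗ b)V(σ(e) ⊗ b')`. -/
theorem exists_isSlice (hB : NonDegenerate B) (V : Mult (A ⊗[ℂ] B)) (ω : G.Dual) :
    ∃ m, G.IsSlice V ω m := by
  have hAB := G.nonDegenerate.tensor hB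
  obtain ⟨c, rfl⟩ := G.dualEquiv.surjective ω
  have key (b b' : B) : mulRight ℂ b' ∘ₗ sliceFst G.haar ∘ₗ V.R ∘ₗ (TensorProduct.mk ℂ A B).flip b
      = mulLeft ℂ b ∘ₗ sliceFst G.haar ∘ₗ V.L ∘ₗ (TensorProduct.mk ℂ A B).flip b' ∘ₗ
        G.modular := by
    refine G.ext_mul fun e f => ?_
    change sliceFst G.haar (V.R ((e * f) ⊗ₜ b)) * b'
      = b * sliceFst G.haar (V.L (G.modular (e * f) ⊗ₜ b'))
    have h1 : (e * f) ⊗ₜ[ℂ] b = rTensor B (mulLeft ℂ e) (f ⊗ₜ b) := by simp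
    have h2 : G.modular (e * f) ⊗ₜ[ℂ] b'
      = rTensor B (mulRight ℂ (G.modular f)) (G.modular e ⊗ₜ b') := by simp [modular_mul]
    rw [h1, h2, V.R_rTensor hAB, V.L_rTensor hAB, G.sliceFst_haar_mulLeft e,
      ← G.sliceFst_haar_mulLeft f]
    have h3 := congrArg (sliceFst G.haar) (V.central (f ⊗ₜ b) (G.modular e ⊗ₜ b'))
    rw [mul_tmul_eq, tmul_mul_eq, rTensor_lTensor, sliceFst_lTensor, rTensor_lTensor,
      sliceFst_lTensor] at h3
    exact h3
  refine ⟨Mult.mk (sliceFst G.haar ∘ₗ V.L ∘ₗ TensorProduct.mk ℂ A B (G.modular c))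
    (sliceFst G.haar ∘ₗ V.R ∘ₗ TensorProduct.mk ℂ A B c)
    fun b b' => LinearMap.congr_fun (key b b') c, fun a ha b => ?_, fun a ha b => ?_⟩
  · rw [G.ext_haar_right (a := a) (b := G.modular c) fun x => by
      rw [← ha, haar_mul_modular, dualEquiv_apply]]
    rfl
  · rw [G.ext_haar_left (a := a) (b := c) fun x => by rw [← ha, dualEquiv_apply]]
    rfl

theorem isSlice_pi (hB : NonDegenerate B) (V : Mult (A ⊗[ℂ] B)) (ω : G.Dual) :
    G.IsSlice V ω (G.pi V ω) := by
  have h := G.exists_isSlice hB V ω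
  rw [pi, dif_pos h]
  exact h.choose_spec

theorem pi_L (hB : NonDegenerate B) (V : Mult (A ⊗[ℂ] B)) (a : A) (b : B) :
    (G.pi V (G.dualEquivRight a)).L b = sliceFst G.haar (V.L (a ⊗ₜ b)) :=
  (G.isSlice_pi hB V _).1 a (fun _ => rfl) b

theorem pi_R (hB : NonDegenerate B) (V : Mult (A ⊗[ℂ] B)) (a : A) (b : B) :
    (G.pi V (G.dualEquiv a)).R b = sliceFst G.haar (V.R (a ⊗ₜ b)) :=
  (G.isSlice_pi hB V _).2 a (fun _ => rfl) b

theorem pi_L_of_apply (hB : NonDegenerate B) (V : Mult (A ⊗[ℂ] B)) {ω ω' : G.Dual} {p : A}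
    (h : ∀ y, ω'.1 y = ω.1 (y * p)) (b : B) :
    (G.pi V ω').L b = sliceFst ω.1 (V.L (p ⊗ₜ b)) := by
  obtain ⟨a, rfl⟩ := G.dualEquivRight.surjective ω
  have h1 : ω' = G.dualEquivRight (p * a) := Subtype.ext (LinearMap.ext fun y => by
    rw [h, dualEquivRight_apply, dualEquivRight_apply, mul_assoc])
  have h2 : (p * a) ⊗ₜ[ℂ] b = rTensor B (mulRight ℂ a) (p ⊗ₜ b) := by simp
  rw [h1, pi_L G hB, h2, V.L_rTensor (G.nonDegenerate.tensor hB), sliceFst_rTensor,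
    coe_dualEquivRight]

/-- `π_V` as a linear map. -/
noncomputable def piLinear (hB : NonDegenerate B) (V : Mult (A ⊗[ℂ] B)) :
    G.Dual →ₗ[ℂ] Mult B where
  toFun := G.pi V
  map_add' ω η := Mult.ext_L hB fun b => by
    obtain ⟨a, rfl⟩ := G.dualEquivRight.surjective ω
    obtain ⟨c, rfl⟩ := G.dualEquivRight.surjective η
    rw [← map_add, Mult.L_add, LinearMap.add_apply, pi_L G hB, pi_L G hB, pi_L G hB,
      TensorProduct.add_tmul, map_add, map_add]
  map_smul' r ω := Mult.ext_L hB fun b => by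
    obtain ⟨a, rfl⟩ := G.dualEquivRight.surjective ω
    rw [← map_smul, Mult.L_smul, LinearMap.smul_apply, pi_L G hB, RingHom.id_apply, pi_L G hB,
      ← TensorProduct.smul_tmul', map_smul, map_smul]

/-- For `ω ∈ Â` the slice `(ω ⊙ ι)(V(a ⊗ b))` is `π_V(ω(· a))b`, and `Â` separates points because
`φ` is faithful. -/
theorem pi_injective (hB : NonDegenerate B) {V W : Mult (A ⊗[ℂ] B)} (h : G.pi V = G.pi W) :
    V = W := by
  refine Mult.ext_L (G.nonDegenerate.tensor hB) fun t =>
    LinearMap.congr_fun (f := V.L) (TensorProduct.ext' fun a b => ?_) t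
  refine G.ext_sliceFst_dual fun ω => ?_
  have hmem : ω.1 ∘ₗ mulRight ℂ a ∈ LinearMap.range G.haarMul := by
    obtain ⟨c, rfl⟩ := G.dualEquivRight.surjective ω
    exact (G.mem_range_haarMul _).2 ⟨a * c, fun x => by
      rw [LinearMap.comp_apply, dualEquivRight_apply]; simp [mul_assoc]⟩
  rw [← G.pi_L_of_apply hB V (ω' := ⟨_, hmem⟩) fun y => rfl,
    ← G.pi_L_of_apply hB W (ω' := ⟨_, hmem⟩) fun y => rfl, h]

theorem star_pi [StarRing B] [StarModule ℂ B] (hB : NonDegenerate B) (V : Mult (A ⊗[ℂ] B))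
    (c : A) : star (G.pi V (G.dualEquiv c)) = G.pi (star V) (G.dualEquivRight (star c)) :=
  Mult.ext_L hB fun b => by
    rw [Mult.L_star, pi_R G hB, pi_L G hB, Mult.L_star, TensorProduct.star_tmul, star_star,
      star_sliceFst_haar]

/-- The span of `π_V(Â)B` contains `(φ ⊙ ι)(V t)` for all `t`, and invertibility makes every tensor
of the form `V t`; likewise on the right. -/
theorem isNonDegenerate_pi (hB : NonDegenerate B) (V : Mult (A ⊗[ℂ] B)) (hV : IsUnit V) :
    IsNonDegenerate (G.piLinear hB V) := by
  obtain ⟨⟨V, W, h1, h2⟩, rfl⟩ := hV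
  refine ⟨eq_top_iff.2 fun z _ => ?_, eq_top_iff.2 fun z _ => ?_⟩
  · obtain ⟨t, rfl⟩ := sliceFst_surjective G.haar_ne_zero z
    have h3 : t = V.L (W.L t) := by rw [← Mult.L_mul, h1, Mult.L_one]
    rw [h3]
    induction W.L t with
    | zero => simp
    | add s t hs ht => rw [map_add, map_add]; exact add_mem hs ht
    | tmul a b => exact Submodule.subset_span ⟨G.dualEquivRight a, b, (G.pi_L hB V a b).symm⟩
  · obtain ⟨t, rfl⟩ := sliceFst_surjective G.haar_ne_zero z
    have h3 : t = V.R (W.R t) := by rw [← Mult.R_mul, h2, Mult.R_one]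
    rw [h3]
    induction W.R t with
    | zero => simp
    | add s t hs ht => rw [map_add, map_add]; exact add_mem hs ht
    | tmul a b => exact Submodule.subset_span ⟨G.dualEquiv a, b, (G.pi_R hB V a b).symm⟩

end Slice

end StarQuantumGroup

namespace Mult

variable {X : Type*} [NonUnitalRing X] [Module ℂ X] [IsScalarTower ℂ X X]
  [SMulCommClass ℂ X X]

theorem applyL_apply (x : X) (m : Mult X) : applyL x m = m.L x := rfl

theorem applyR_apply (x : X) (m : Mult X) : applyR x m = m.R x := rfl

end Mult

/-! ### One-sided characterisation of `(π ⊙ ι)(V)`. -/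

section MapFst

open LinearMap (mulLeft mulRight rTensor lTensor mul')

variable {X Y Z : Type*} [NonUnitalRing X] [Module ℂ X] [IsScalarTower ℂ X X]
  [SMulCommClass ℂ X X] [NonUnitalRing Y] [Module ℂ Y] [IsScalarTower ℂ Y Y]
  [SMulCommClass ℂ Y Y] [NonUnitalRing Z] [Module ℂ Z] [IsScalarTower ℂ Z Z]
  [SMulCommClass ℂ Z Z]

/-- For multiplicative non-degenerate `π`, the left half of `IsMapFst` implies the right half. -/
theorem isMapFst_of_L (hZY : NonDegenerate (Z ⊗[ℂ] Y)) {π : X →ₗ[ℂ] Mult Z}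
    (hπ : ∀ x x', π (x * x') = π x * π x') (hπ' : IsNonDegenerate π) {V : Mult (X ⊗[ℂ] Y)}
    {W : Mult (Z ⊗[ℂ] Y)} (h : ∀ (x : X) (z : Z) (y : Y),
      W.L ((π x).L z ⊗ₜ[ℂ] y) = rTensor Y (Mult.applyL z ∘ₗ π) (V.L (x ⊗ₜ[ℂ] y))) :
    IsMapFst π V W := by
  refine fun x z y => ⟨h x z y, ?_⟩
  -- After pairing with `π(x')z' ⊗ y'`, both candidates for the right action become `Θ` of `(x ⊗
  -- y)V(x' ⊗ y')`.
  let Θ (z z' : Z) : X ⊗[ℂ] Y →ₗ[ℂ] Z ⊗[ℂ] Y := rTensor Y (mulLeft ℂ z ∘ₗ Mult.applyL z' ∘ₗ π)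
  have h1 (z' : Z) (v : X ⊗[ℂ] Y) :
      ((π x).R z ⊗ₜ y) * rTensor Y (Mult.applyL z' ∘ₗ π) v = Θ z z' ((x ⊗ₜ y) * v) := by
    induction v with
    | zero => simp
    | add s t hs ht => simp only [map_add, mul_add, hs, ht]
    | tmul u w =>
      have : (π x).R z * (π u).L z' = z * (π (x * u)).L z' := by
        rw [hπ, Mult.central]; rfl
      simp [Θ, Mult.applyL_apply, this]
  have h2 (x' : X) (z' : Z) (y' : Y) (v : X ⊗[ℂ] Y) :
      rTensor Y (Mult.applyR z ∘ₗ π) v * ((π x').L z' ⊗ₜ y') = Θ z z' (v * (x' ⊗ₜ y')) := by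
    induction v with
    | zero => simp
    | add s t hs ht => simp only [map_add, add_mul, hs, ht]
    | tmul u w =>
      have : (π u).R z * (π x').L z' = z * (π (u * x')).L z' := by
        rw [hπ, Mult.central]; rfl
      simp [Θ, Mult.applyL_apply, Mult.applyR_apply, this]
  refine hZY.ext_left fun t => ?_
  suffices LinearMap.mulLeft ℂ (W.R ((π x).R z ⊗ₜ[ℂ] y))
      = LinearMap.mulLeft ℂ (rTensor Y (Mult.applyR z ∘ₗ π) (V.R (x ⊗ₜ[ℂ] y))) from
    LinearMap.congr_fun this t
  refine TensorProduct.ext' fun w y' => ?_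
  have hw : w ∈ Submodule.span ℂ {z : Z | ∃ x y, z = (π x).L y} := by rw [hπ'.1]; trivial
  induction hw using Submodule.span_induction with
  | mem w hw =>
    obtain ⟨x', z', rfl⟩ := hw
    rw [LinearMap.mulLeft_apply, LinearMap.mulLeft_apply, Mult.central, h, h1, h2, Mult.central]
  | zero => simp
  | add s t _ _ hs ht => rw [TensorProduct.add_tmul, map_add, map_add, hs, ht]
  | smul c s _ hs => rw [← TensorProduct.smul_tmul', map_smul, map_smul, hs]

end MapFst

namespace StarQuantumGroup

open MultiplierHopfStar
open LinearMap (mulLeft mulRight rTensor lTensor mul')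

variable {A : Type*} [NonUnitalRing A] [Module ℂ A] [IsScalarTower ℂ A A]
  [SMulCommClass ℂ A A] [StarRing A] [StarModule ℂ A] (G : StarQuantumGroup A)
  {B : Type*} [NonUnitalRing B] [Module ℂ B] [IsScalarTower ℂ B B] [SMulCommClass ℂ B B]

theorem leg13_L_tmul {X Y Z : Type*} [NonUnitalRing X] [Module ℂ X] [IsScalarTower ℂ X X]
    [SMulCommClass ℂ X X] [NonUnitalRing Y] [Module ℂ Y] [IsScalarTower ℂ Y Y]
    [SMulCommClass ℂ Y Y] [NonUnitalRing Z] [Module ℂ Z] [IsScalarTower ℂ Z Z]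
    [SMulCommClass ℂ Z Z] (V : Mult (X ⊗[ℂ] Z)) (x : X) (y : Y) (z : Z) :
    (leg13 V : Mult ((X ⊗[ℂ] Y) ⊗[ℂ] Z)).L ((x ⊗ₜ y) ⊗ₜ z)
      = TensorProduct.rightComm ℂ X Z Y (V.L (x ⊗ₜ z) ⊗ₜ y) := by
  simp [leg13, Mult.congr]

theorem leg23_L_tmul {X Y Z : Type*} [NonUnitalRing X] [Module ℂ X] [IsScalarTower ℂ X X]
    [SMulCommClass ℂ X X] [NonUnitalRing Y] [Module ℂ Y] [IsScalarTower ℂ Y Y]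
    [SMulCommClass ℂ Y Y] [NonUnitalRing Z] [Module ℂ Z] [IsScalarTower ℂ Z Z]
    [SMulCommClass ℂ Z Z] (V : Mult (Y ⊗[ℂ] Z)) (x : X) (y : Y) (z : Z) :
    (leg23 V : Mult ((X ⊗[ℂ] Y) ⊗[ℂ] Z)).L ((x ⊗ₜ y) ⊗ₜ z)
      = (TensorProduct.assoc ℂ X Y Z).symm (x ⊗ₜ V.L (y ⊗ₜ z)) := by
  simp [leg23, Mult.congr]

/-! ### Corepresentations -/

/-- The corepresentation identity `V₁₃ V₂₃ (T₂ ⊙ ι) = (T₂ ⊙ ι) V₁₃`. -/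
def PentagonL (V : Mult (A ⊗[ℂ] B)) : Prop :=
  ∀ x d b, (leg13 V : Mult ((A ⊗[ℂ] A) ⊗[ℂ] B)).L ((leg23 V).L (G.T2 (x ⊗ₜ d) ⊗ₜ b))
    = rTensor B (G.T2.toLinearMap ∘ₗ (TensorProduct.mk ℂ A A).flip d) (V.L (x ⊗ₜ b))

theorem rTensor_T2_mul (hB : NonDegenerate B) (V : Mult (A ⊗[ℂ] B)) (x e d : A) (b : B) :
    rTensor B (G.T2.toLinearMap ∘ₗ (TensorProduct.mk ℂ A A).flip d) (V.L ((x * e) ⊗ₜ b))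
      = rTensor B (Mult.applyL (G.T2 (e ⊗ₜ d)) ∘ₗ (G.comul : A →ₗ[ℂ] Mult (A ⊗[ℂ] A)))
        (V.L (x ⊗ₜ b)) := by
  have h : (x * e) ⊗ₜ[ℂ] b = rTensor B (mulRight ℂ e) (x ⊗ₜ b) := by simp
  rw [h, V.L_rTensor (G.nonDegenerate.tensor hB), ← LinearMap.comp_apply, ← LinearMap.rTensor_comp]
  congr 2
  exact LinearMap.ext fun u => G.T2_mul u e d

/-- As `A² = A`, it suffices to treat `x e`, where `T2(x e ⊗ d) = Δ(x)T2(e ⊗ d)` is exactly of the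
form on which the extension `(Δ ⊙ ι)(V)` is prescribed. -/
theorem IsCorep.pentagonL (hB : NonDegenerate B) {V : Mult (A ⊗[ℂ] B)} (h : G.IsCorep V) :
    G.PentagonL V := by
  intro x d b
  suffices ((leg13 V * leg23 V : Mult ((A ⊗[ℂ] A) ⊗[ℂ] B)).L ∘ₗ (TensorProduct.mk ℂ _ B).flip b ∘ₗ
      G.T2.toLinearMap ∘ₗ (TensorProduct.mk ℂ A A).flip d)
      = rTensor B (G.T2.toLinearMap ∘ₗ (TensorProduct.mk ℂ A A).flip d) ∘ₗ V.L ∘ₗ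
        (TensorProduct.mk ℂ A B).flip b from LinearMap.congr_fun this x
  refine G.ext_mul fun x e => ?_
  refine Eq.trans ?_ ((h x (G.T2 (e ⊗ₜ d)) b).1.trans (G.rTensor_T2_mul hB V x e d b).symm)
  change (leg13 V * leg23 V : Mult ((A ⊗[ℂ] A) ⊗[ℂ] B)).L (G.T2 ((x * e) ⊗ₜ d) ⊗ₜ b) = _
  rw [G.T2_mul]; rfl

theorem PentagonL.isCorep (hB : NonDegenerate B) {V : Mult (A ⊗[ℂ] B)} (h : G.PentagonL V) :
    G.IsCorep V := by
  refine isMapFst_of_L ((G.nonDegenerate.tensor G.nonDegenerate).tensor hB)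
    (fun x y => map_mul G.comul x y) G.comul_nonDegenerate fun x z b => ?_
  obtain ⟨t, rfl⟩ := G.T2.surjective z
  induction t with
  | zero =>
    have : (Mult.applyL (0 : A ⊗[ℂ] A)) = 0 := LinearMap.ext fun m => map_zero m.L
    simp [this]
  | add s t hs ht =>
    have : Mult.applyL (G.T2 s + G.T2 t) = Mult.applyL (G.T2 s) + Mult.applyL (G.T2 t) :=
      LinearMap.ext fun m => map_add m.L _ _
    rw [map_add, map_add, TensorProduct.add_tmul, map_add, hs, ht, this, LinearMap.add_comp,
      LinearMap.rTensor_add]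
    rfl
  | tmul e d =>
    rw [← G.rTensor_T2_mul hB, ← h, G.T2_mul]; rfl

/-- `(φ ⊙ φ ⊙ ι)` applied to `V₁₃ V₂₃`. -/
theorem sliceFst_leg13_leg23 (V : Mult (A ⊗[ℂ] B)) (a a' : A) (b : B) :
    sliceFst (G.haar ∘ₗ sliceSnd G.haar)
      ((leg13 V : Mult ((A ⊗[ℂ] A) ⊗[ℂ] B)).L ((leg23 V).L ((a ⊗ₜ a') ⊗ₜ b)))
      = sliceFst G.haar (V.L (a ⊗ₜ sliceFst G.haar (V.L (a' ⊗ₜ b)))) := by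
  have h1 (u : A ⊗[ℂ] B) (q : A) : sliceFst (G.haar ∘ₗ sliceSnd G.haar)
      (TensorProduct.rightComm ℂ A B A (u ⊗ₜ q)) = G.haar q • sliceFst G.haar u := by
    induction u with
    | zero => simp
    | add s t hs ht => simp only [TensorProduct.add_tmul, map_add, hs, ht, smul_add]
    | tmul p b => simp [mul_smul]
  have h2 (u : A ⊗[ℂ] B) : sliceFst (G.haar ∘ₗ sliceSnd G.haar)
      ((leg13 V : Mult ((A ⊗[ℂ] A) ⊗[ℂ] B)).L ((TensorProduct.assoc ℂ A A B).symm (a ⊗ₜ u)))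
      = sliceFst G.haar (V.L (a ⊗ₜ sliceFst G.haar u)) := by
    induction u with
    | zero => simp
    | add s t hs ht => simp only [TensorProduct.tmul_add, map_add, hs, ht]
    | tmul q b => rw [TensorProduct.assoc_symm_tmul, leg13_L_tmul, h1]; simp
  rw [leg23_L_tmul, h2]

/-- The map `Ω(a ⊗ a') = (a φ)(a' φ)` satisfies `Ω(Δ(x)z) = Ω(z)(· x)`. Hence on `Δ(x)z` the
corepresentation identity equates `π_V(Ω(s))b` with `(φ ⊙ φ ⊙ ι)(V₁₃V₂₃(s ⊗ b))`, and non-degeneracy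
of `Δ` extends this to all `s`. -/
theorem pi_mul (hB : NonDegenerate B) {V : Mult (A ⊗[ℂ] B)} (h : G.IsCorep V) (ω η : G.Dual) :
    G.pi V (ω * η) = G.pi V ω * G.pi V η := by
  let Ω : A ⊗[ℂ] A →ₗ[ℂ] G.Dual := TensorProduct.lift
    ((LinearMap.mul ℂ G.Dual).compl₁₂ G.dualEquivRight.toLinearMap G.dualEquivRight.toLinearMap)
  have hΩ' (p q : A) : Ω (p ⊗ₜ q) = G.dualEquivRight p * G.dualEquivRight q := rfl
  have hΩ (s : A ⊗[ℂ] A) (y : A) : (Ω s).1 y = G.haar (sliceSnd G.haar ((G.comul y).L s)) := by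
    induction s with
    | zero => simp
    | add s t hs ht =>
      simp only [map_add]
      rw [← hs, ← ht]; rfl
    | tmul p q =>
      rw [hΩ', mul_apply, dualEquivRight_apply, sliceElem_mul, G.comul_L_tmul, sliceSnd_lTensor,
        coe_dualEquivRight]
  refine Mult.ext_L hB fun b => ?_
  have key (s : A ⊗[ℂ] A) : (G.piLinear hB V (Ω s)).L b
      = sliceFst (G.haar ∘ₗ sliceSnd G.haar)
        ((leg13 V * leg23 V : Mult ((A ⊗[ℂ] A) ⊗[ℂ] B)).L (s ⊗ₜ b)) := by
    have hs : s ∈ Submodule.span ℂ {z : A ⊗[ℂ] A | ∃ x y,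
        z = ((G.comul : A →ₗ[ℂ] Mult (A ⊗[ℂ] A)) x).L y} := by
      rw [G.comul_nonDegenerate.1]; trivial
    induction hs using Submodule.span_induction with
    | mem s hs =>
      obtain ⟨x, z, rfl⟩ := hs
      rw [(h x z b).1, sliceFst_rTensor]
      have h1 (y : A) : (Ω ((G.comul x).L z)).1 y = (Ω z).1 (y * x) := by
        rw [hΩ, hΩ, map_mul]; rfl
      refine (G.pi_L_of_apply hB V h1 b).trans ?_
      congr 2
      exact LinearMap.ext fun y => hΩ z y
    | zero => simp; rfl
    | add s t _ _ hs ht =>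
      rw [TensorProduct.add_tmul, map_add, map_add, map_add, map_add, ← hs, ← ht]; rfl
    | smul c s _ hs =>
      rw [← TensorProduct.smul_tmul', map_smul, map_smul, map_smul, map_smul, ← hs]; rfl
  obtain ⟨a, rfl⟩ := G.dualEquivRight.surjective ω
  obtain ⟨a', rfl⟩ := G.dualEquivRight.surjective η
  rw [Mult.L_mul, pi_L G hB, pi_L G hB, ← sliceFst_leg13_leg23, ← hΩ']
  exact key _

/-- `(ε ⊙ ι)(V) = 1` for an invertible corepresentation. -/
theorem sliceFst_counitLin_corep (hB : NonDegenerate B) {V : Mult (A ⊗[ℂ] B)} (h : G.IsCorep V)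
    (hV : IsUnit V) (x : A) (b : B) :
    sliceFst G.counitLin (V.L (x ⊗ₜ b)) = G.counitLin x • b := by
  have hp := h.pentagonL G hB
  obtain ⟨⟨V, W, hVW, hWV⟩, rfl⟩ := hV
  change sliceFst G.counitLin (V.L (x ⊗ₜ b)) = G.counitLin x • b
  change G.PentagonL V at hp
  obtain ⟨e, he⟩ : ∃ e, G.counitLin e = 1 := by
    obtain ⟨y, hy⟩ := G.exists_haar_eq_one
    obtain ⟨e, he⟩ : ∃ e, G.counitLin e ≠ 0 := by
      by_contra! h
      exact G.counitLin_ne_zero (LinearMap.ext h)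
    exact ⟨(G.counitLin e)⁻¹ • e, by simp [he]⟩
  -- The candidate for `(ε ⊙ ι)(V)`, to be shown equal to the identity.
  let n : B →ₗ[ℂ] B := sliceFst G.counitLin ∘ₗ V.L ∘ₗ TensorProduct.mk ℂ A B e
  have h1 (c : B) (t : A ⊗[ℂ] B) : sliceFst G.counitLin ((e ⊗ₜ c) * t)
      = c * sliceFst G.counitLin t := by
    induction t with
    | zero => simp
    | add s t hs ht => simp only [map_add, mul_add, hs, ht]
    | tmul p q => simp [counitLin_mul, he, mul_smul_comm]
  have h2 (x : A) (b : B) (t : A ⊗[ℂ] B) : sliceFst G.counitLin (t * (x ⊗ₜ b))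
      = G.counitLin x • (sliceFst G.counitLin t * b) := by
    induction t with
    | zero => simp
    | add s t hs ht => simp only [map_add, add_mul, hs, ht, smul_add]
    | tmul p q => simp [counitLin_mul, smul_mul_assoc, smul_smul, mul_comm]
  have h3 (x : A) (b : B) : sliceFst G.counitLin (V.L (x ⊗ₜ b)) = G.counitLin x • n b := by
    refine hB.ext_right fun c => ?_
    have h4 : c * n b = sliceFst G.counitLin (V.R (e ⊗ₜ c)) * b := by
      change c * sliceFst G.counitLin (V.L (e ⊗ₜ b)) = _
      rw [← h1, ← Mult.central, h2, he, one_smul]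
    rw [← h1, ← Mult.central, h2, mul_smul_comm, h4]
  let E : (A ⊗[ℂ] A) ⊗[ℂ] B →ₗ[ℂ] A ⊗[ℂ] B := rTensor B (sliceFst G.counitLin)
  have hE13 (s : (A ⊗[ℂ] A) ⊗[ℂ] B) : E ((leg13 V).L s) = lTensor A n (E s) := by
    have : E ∘ₗ (leg13 V).L = lTensor A n ∘ₗ E := by
      refine TensorProduct.ext_threefold fun p q b => ?_
      have h5 (u : A ⊗[ℂ] B) : E (TensorProduct.rightComm ℂ A B A (u ⊗ₜ q))
          = q ⊗ₜ sliceFst G.counitLin u := by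
        induction u with
        | zero => simp
        | add s t hs ht => simp only [TensorProduct.add_tmul, map_add, hs, ht,
            TensorProduct.tmul_add]
        | tmul p b => simp [E, TensorProduct.smul_tmul]
      rw [LinearMap.comp_apply, leg13_L_tmul, h5, h3]
      simp [E, TensorProduct.smul_tmul']
    exact LinearMap.congr_fun this s
  have hE23 (s : (A ⊗[ℂ] A) ⊗[ℂ] B) : E ((leg23 V).L s) = V.L (E s) := by
    have : E ∘ₗ (leg23 V).L = V.L ∘ₗ E := by
      refine TensorProduct.ext_threefold fun p q b => ?_
      have h5 (u : A ⊗[ℂ] B) : E ((TensorProduct.assoc ℂ A A B).symm (p ⊗ₜ u))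
          = G.counitLin p • u := by
        induction u with
        | zero => simp
        | add s t hs ht => simp only [map_add, hs, ht, TensorProduct.tmul_add, smul_add]
        | tmul p b => simp [E, TensorProduct.smul_tmul']
      rw [LinearMap.comp_apply, leg23_L_tmul, h5]
      simp [E, ← TensorProduct.smul_tmul']
    exact LinearMap.congr_fun this s
  -- Applying `ε` to the first leg of the pentagon identity gives `(1 ⊗ n)V = V`; invertibility of
  -- `V` then forces `n = 1`.
  have h6 : lTensor A n ∘ₗ V.L = V.L := by
    refine TensorProduct.ext' fun x b => ?_
    suffices (lTensor A n ∘ₗ V.L) ∘ₗ (TensorProduct.mk ℂ A B).flip b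
        = V.L ∘ₗ (TensorProduct.mk ℂ A B).flip b from LinearMap.congr_fun this x
    refine G.ext_mul fun x d => ?_
    change lTensor A n (V.L ((x * d) ⊗ₜ b)) = V.L ((x * d) ⊗ₜ b)
    have h7 := congrArg E (hp x d b)
    rw [hE13, hE23] at h7
    have h8 : E (G.T2 (x ⊗ₜ d) ⊗ₜ b) = (x * d) ⊗ₜ b := by
      change sliceFst G.counitLin (G.T2 (x ⊗ₜ d)) ⊗ₜ[ℂ] b = _
      rw [sliceFst_counitLin_T2]; rfl
    have h9 (t : A ⊗[ℂ] B) : E (rTensor B (G.T2.toLinearMap ∘ₗ (TensorProduct.mk ℂ A A).flip d) t)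
        = rTensor B (mulRight ℂ d) t := by
      rw [← LinearMap.comp_apply, ← LinearMap.rTensor_comp]
      congr 2
      refine LinearMap.ext fun u => ?_
      change sliceFst G.counitLin (G.T2 (u ⊗ₜ d)) = _
      rw [sliceFst_counitLin_T2]; rfl
    rw [h8, h9, ← V.L_rTensor (G.nonDegenerate.tensor hB)] at h7
    simpa using h7
  have h10 (t : A ⊗[ℂ] B) : lTensor A n t = t := by
    have := LinearMap.congr_fun h6 (W.L t)
    rwa [LinearMap.comp_apply, ← Mult.L_mul, hVW, Mult.L_one] at this
  have h11 := congrArg (sliceFst G.counitLin) (h10 (e ⊗ₜ b))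
  rw [LinearMap.lTensor_tmul, sliceFst_tmul, sliceFst_tmul, he, one_smul, one_smul] at h11
  rw [h3, h11]

variable {A : Type*} [NonUnitalRing A] [Module ℂ A] [IsScalarTower ℂ A A]
  [SMulCommClass ℂ A A] [StarRing A] [StarModule ℂ A] (G : StarQuantumGroup A)
  {B : Type*} [NonUnitalRing B] [Module ℂ B] [IsScalarTower ℂ B B] [SMulCommClass ℂ B B]

/-- `(S ⊙ ι)(V) = V⁻¹`: here `(S ⊙ ι)(V (p ⊗ b)) (q ⊗ 1) = (S(p) ⊗ 1) V⁻¹ (q ⊗ b)`. -/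
theorem antipode_corep (hB : NonDegenerate B) {V W : Mult (A ⊗[ℂ] B)} (h : G.IsCorep V)
    (hVW : V * W = 1) (hWV : W * V = 1) (p q : A) (b : B) :
    rTensor B (mulRight ℂ q ∘ₗ G.antipode.toLinearMap) (V.L (p ⊗ₜ b))
      = rTensor B (mulLeft ℂ (G.antipode p)) (W.L (q ⊗ₜ b)) := by
  have hp := h.pentagonL G hB
  have hε := G.sliceFst_counitLin_corep hB h ⟨⟨V, W, hVW, hWV⟩, rfl⟩
  -- On the first two legs `E` is `p ⊗ q ↦ S(p)q`. In the pentagon identity it cancels `T2` and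
  -- leaves `(ε ⊙ ι)(V) = 1`.
  let E : (A ⊗[ℂ] A) ⊗[ℂ] B →ₗ[ℂ] A ⊗[ℂ] B :=
    rTensor B (sliceFst G.counitLin ∘ₗ G.T2.symm.toLinearMap)
  have h1 (p q : A) (b : B) : E ((leg13 V).L ((leg23 V).L ((p ⊗ₜ q) ⊗ₜ b)))
      = (G.antipode p * q) ⊗ₜ b := by
    have h2 (s : A ⊗[ℂ] A) : E ((leg13 V).L ((leg23 V).L (G.T2 s ⊗ₜ b)))
        = sliceFst G.counitLin s ⊗ₜ b := by
      induction s with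
      | zero => simp
      | add s t hs ht => simp only [map_add, TensorProduct.add_tmul, hs, ht]
      | tmul x d =>
        rw [hp]
        have h3 (t : A ⊗[ℂ] B) :
            E (rTensor B (G.T2.toLinearMap ∘ₗ (TensorProduct.mk ℂ A A).flip d) t)
              = d ⊗ₜ sliceFst G.counitLin t := by
          induction t with
          | zero => simp
          | add s t hs ht => simp only [map_add, TensorProduct.tmul_add, hs, ht]
          | tmul u b => simp [E, TensorProduct.smul_tmul]
        rw [h3, hε, sliceFst_tmul, TensorProduct.smul_tmul]
    have h4 := h2 (G.T2.symm (p ⊗ₜ q))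
    rwa [LinearEquiv.apply_symm_apply, ← antipode_mul_eq] at h4
  have h5 (u : A ⊗[ℂ] B) : E ((leg13 V).L ((TensorProduct.assoc ℂ A A B).symm (p ⊗ₜ V.L u)))
      = rTensor B (mulLeft ℂ (G.antipode p)) u := by
    induction u with
    | zero => simp
    | add s t hs ht => simp only [map_add, TensorProduct.tmul_add, hs, ht]
    | tmul q b => rw [← leg23_L_tmul, h1]; rfl
  have h6 (t : A ⊗[ℂ] B) : E (TensorProduct.rightComm ℂ A B A (t ⊗ₜ q))
      = rTensor B (mulRight ℂ q ∘ₗ G.antipode.toLinearMap) t := by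
    induction t with
    | zero => simp
    | add s t hs ht => simp only [map_add, TensorProduct.add_tmul, hs, ht]
    | tmul u b =>
      rw [TensorProduct.rightComm_tmul]
      change sliceFst G.counitLin (G.T2.symm (u ⊗ₜ q)) ⊗ₜ[ℂ] b = _
      rw [← antipode_mul_eq]; rfl
  rw [← h5, ← Mult.L_mul, hVW, Mult.L_one, TensorProduct.assoc_symm_tmul, leg13_L_tmul, h6]

theorem star_dualEquiv_star_apply (a x : A) :
    (star (G.dualEquiv (star a))).1 x = G.haar (G.antipode x * a) := by
  rw [star_dual_apply, dualEquiv_apply, ← star_mul, G.haar_selfAdjoint, Complex.conj_conj]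

/-- The functional on the left is `(a φ)S`, so this is `(S ⊙ ι)(V) = V⁻¹` integrated by `φ`. Writing
`a = q σ(S(p))` lets `σ` carry the factor `S(p)` of `antipode_corep` across `φ`. -/
theorem pi_star_eq_inv (hB : NonDegenerate B) {V W : Mult (A ⊗[ℂ] B)} (h : G.IsCorep V)
    (hVW : V * W = 1) (hWV : W * V = 1) (a : A) :
    G.pi V (star (G.dualEquiv (star a))) = G.pi W (G.dualEquivRight a) := by
  let k : A →ₗ[ℂ] G.Dual :=
    { toFun := fun a => star (G.dualEquiv (star a))
      map_add' := by simp
      map_smul' := by simp }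
  refine Mult.ext_L hB fun b => ?_
  suffices Mult.applyL b ∘ₗ G.piLinear hB V ∘ₗ k
      = Mult.applyL b ∘ₗ G.piLinear hB W ∘ₗ G.dualEquivRight.toLinearMap from
    LinearMap.congr_fun this a
  refine G.ext_mul fun q r => ?_
  obtain ⟨r, rfl⟩ := G.modular_surjective r
  obtain ⟨p, rfl⟩ := G.antipode.surjective r
  have h1 := congrArg (sliceFst G.haar) (G.antipode_corep hB h hVW hWV p q b)
  rw [sliceFst_rTensor, sliceFst_rTensor] at h1
  have h2 : (star (G.dualEquiv (star q))).1
      = G.haar ∘ₗ mulRight ℂ q ∘ₗ G.antipode.toLinearMap :=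
    LinearMap.ext fun x => G.star_dualEquiv_star_apply q x
  rw [← h2, ← coe_dualEquiv, ← G.pi_L_of_apply hB V
    (ω' := star (G.dualEquiv (star (q * G.modular (G.antipode p))))), ← G.pi_L_of_apply hB W
    (ω' := G.dualEquivRight (q * G.modular (G.antipode p)))] at h1
  · exact h1
  · intro y
    rw [dualEquivRight_apply, dualEquiv_apply, ← mul_assoc, haar_mul_modular]
  · intro y
    rw [star_dualEquiv_star_apply, star_dualEquiv_star_apply, antipode_mul, ← mul_assoc,
      haar_mul_modular, mul_assoc]

variable [StarRing B] [StarModule ℂ B]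

/-- An invertible corepresentation `V` is unitary if and only if `π_V` preserves adjoints. -/
theorem mem_unitary_iff (hB : NonDegenerate B) {V : Mult (A ⊗[ℂ] B)} (h : G.IsCorep V)
    (hV : IsUnit V) :
    V ∈ unitary (Mult (A ⊗[ℂ] B)) ↔ ∀ ω, G.pi V (star ω) = star (G.pi V ω) := by
  obtain ⟨⟨V, W, hVW, hWV⟩, rfl⟩ := hV
  change G.IsCorep V at h
  change V ∈ unitary _ ↔ ∀ ω, G.pi V (star ω) = star (G.pi V ω)
  -- At `ω = φ a*` the left side is `π_{V⁻¹}(a φ)` and the right side is `π_{V*}(a φ)`.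
  have h1 : (∀ ω, G.pi V (star ω) = star (G.pi V ω)) ↔ G.pi W = G.pi (star V) := by
    constructor
    · refine fun H => funext fun ω => ?_
      obtain ⟨a, rfl⟩ := G.dualEquivRight.surjective ω
      rw [← G.pi_star_eq_inv hB h hVW hWV, H, star_pi G hB, star_star]
    · intro H ω
      obtain ⟨c, rfl⟩ := G.dualEquiv.surjective ω
      rw [star_pi G hB, ← H, ← G.pi_star_eq_inv hB h hVW hWV, star_star]
  rw [h1]
  constructor
  · intro hu
    have : W = star V := by
      rw [← mul_one W, ← (Unitary.mem_iff.1 hu).2, ← mul_assoc, hWV, one_mul]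
    rw [this]
  · intro hpi
    have : W = star V := G.pi_injective hB hpi
    subst this
    exact Unitary.mem_iff.2 ⟨hWV, hVW⟩

/-- `π_V` as a `*`-homomorphism. -/
noncomputable def piStarHom (hB : NonDegenerate B) {V : Mult (A ⊗[ℂ] B)} (h : G.IsCorep V)
    (hs : ∀ ω, G.pi V (star ω) = star (G.pi V ω)) : G.Dual →⋆ₙₐ[ℂ] Mult B where
  toFun := G.pi V
  map_smul' := map_smul (G.piLinear hB V)
  map_zero' := map_zero (G.piLinear hB V)
  map_add' := map_add (G.piLinear hB V)
  map_mul' := G.pi_mul hB h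
  map_star' := hs

theorem mem_unitary_iff_exists (hB : NonDegenerate B) {V : Mult (A ⊗[ℂ] B)} (h : G.IsCorep V)
    (hV : IsUnit V) :
    V ∈ unitary (Mult (A ⊗[ℂ] B)) ↔ ∃ g : G.Dual →⋆ₙₐ[ℂ] Mult B, ⇑g = G.pi V := by
  rw [G.mem_unitary_iff hB h hV]
  refine ⟨fun hs => ⟨G.piStarHom hB h hs, rfl⟩, ?_⟩
  rintro ⟨g, hg⟩ ω
  rw [← hg, map_star]

end StarQuantumGroup

/-- A multiplier whose two actions are bijective is invertible. -/
theorem Mult.isUnit_of_bijective {X : Type*} [NonUnitalRing X] [Module ℂ X] [IsScalarTower ℂ X X]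
    [SMulCommClass ℂ X X] (m : Mult X) (l r : X ≃ₗ[ℂ] X) (hl : m.L = l.toLinearMap)
    (hr : m.R = r.toLinearMap) : IsUnit m := by
  have hL (x : X) : m.L (l.symm x) = x := by rw [hl]; simp
  have hR (x : X) : m.R (r.symm x) = x := by rw [hr]; simp
  refine ⟨⟨m, Mult.mk l.symm.toLinearMap r.symm.toLinearMap fun x y => ?_, ?_, ?_⟩, rfl⟩
  · change r.symm x * y = x * l.symm y
    conv_lhs => rw [← hL y]
    conv_rhs => rw [← hR x]
    rw [Mult.central]
  · refine Mult.ext (LinearMap.ext fun x => hL x) (LinearMap.ext fun x => ?_)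
    change r.symm (m.R x) = x
    rw [hr]; simp
  · refine Mult.ext (LinearMap.ext fun x => ?_) (LinearMap.ext fun x => hR x)
    change l.symm (m.L x) = x
    rw [hl]; simp

/-! ### Transport of multipliers along a non-degenerate homomorphism. -/

section MapSnd

open LinearMap (mulLeft mulRight rTensor lTensor mul')

variable {X Y Z : Type*} [NonUnitalRing X] [Module ℂ X] [IsScalarTower ℂ X X]
  [SMulCommClass ℂ X X] [NonUnitalRing Y] [Module ℂ Y] [IsScalarTower ℂ Y Y]
  [SMulCommClass ℂ Y Y] [NonUnitalRing Z] [Module ℂ Z] [IsScalarTower ℂ Z Z]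
  [SMulCommClass ℂ Z Z]

theorem lTensor_surjective_of_span {N : Type*} [AddCommGroup N] [Module ℂ N]
    (F : (Y ⊗[ℂ] X) ⊗[ℂ] Z →ₗ[ℂ] Y ⊗[ℂ] N) {S : Set N} (hS : Submodule.span ℂ S = ⊤)
    (h : ∀ y, ∀ w ∈ S, ∃ t, F t = y ⊗ₜ w) : Function.Surjective F := by
  rw [← LinearMap.range_eq_top, eq_top_iff]
  rintro t -
  induction t with
  | zero => exact zero_mem _
  | add s t hs ht => exact add_mem hs ht
  | tmul y w =>
    have hw : w ∈ Submodule.span ℂ S := by rw [hS]; trivial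
    induction hw using Submodule.span_induction with
    | mem w hw => exact h y w hw
    | zero => rw [TensorProduct.tmul_zero]; exact zero_mem _
    | add s t _ _ hs ht => rw [TensorProduct.tmul_add]; exact add_mem hs ht
    | smul c s _ hs => rw [TensorProduct.tmul_smul]; exact Submodule.smul_mem _ _ hs

/-- Existence of `(ι ⊙ π)(V)` for a non-degenerate homomorphism `π`. -/
theorem exists_isMapSnd (hYZ : NonDegenerate (Y ⊗[ℂ] Z)) {π : X →ₗ[ℂ] Mult Z}
    (hπ : ∀ x x', π (x * x') = π x * π x') (hπ' : IsNonDegenerate π) (V : Mult (Y ⊗[ℂ] X)) :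
    ∃ W : Mult (Y ⊗[ℂ] Z), IsMapSnd π V W := by
  let actL : Z →ₗ[ℂ] X →ₗ[ℂ] Z := LinearMap.mk₂ ℂ (fun z x => (π x).L z) (by simp) (by simp)
    (by simp) (by simp)
  let actR : Z →ₗ[ℂ] X →ₗ[ℂ] Z := LinearMap.mk₂ ℂ (fun z x => (π x).R z) (by simp) (by simp)
    (by simp) (by simp)
  let NL : (Y ⊗[ℂ] X) ⊗[ℂ] Z →ₗ[ℂ] Y ⊗[ℂ] Z :=
    lTensor Y (TensorProduct.lift actL.flip) ∘ₗ (TensorProduct.assoc ℂ Y X Z).toLinearMap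
  let NR : (Y ⊗[ℂ] X) ⊗[ℂ] Z →ₗ[ℂ] Y ⊗[ℂ] Z :=
    lTensor Y (TensorProduct.lift actR.flip) ∘ₗ (TensorProduct.assoc ℂ Y X Z).toLinearMap
  have hNL (v : Y ⊗[ℂ] X) (z : Z) : NL (v ⊗ₜ z) = lTensor Y (Mult.applyL z ∘ₗ π) v := by
    induction v with
    | zero => simp
    | add s t hs ht => simp only [map_add, TensorProduct.add_tmul, hs, ht]
    | tmul y x => rfl
  have hNR (v : Y ⊗[ℂ] X) (z : Z) : NR (v ⊗ₜ z) = lTensor Y (Mult.applyR z ∘ₗ π) v := by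
    induction v with
    | zero => simp
    | add s t hs ht => simp only [map_add, TensorProduct.add_tmul, hs, ht]
    | tmul y x => rfl
  have hLs : Function.Surjective NL := lTensor_surjective_of_span NL hπ'.1 (by
    rintro y _ ⟨x, z, rfl⟩
    exact ⟨(y ⊗ₜ x) ⊗ₜ z, rfl⟩)
  have hRs : Function.Surjective NR := lTensor_surjective_of_span NR hπ'.2 (by
    rintro y _ ⟨x, z, rfl⟩
    exact ⟨(y ⊗ₜ x) ⊗ₜ z, rfl⟩)
  have pair (v v' : Y ⊗[ℂ] X) (z z' : Z) : NR (v ⊗ₜ z) * NL (v' ⊗ₜ z')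
      = lTensor Y (mulLeft ℂ z ∘ₗ Mult.applyL z' ∘ₗ π) (v * v') := by
    rw [hNL, hNR]
    induction v with
    | zero => simp
    | add s t hs ht => simp only [map_add, add_mul, hs, ht]
    | tmul y x =>
      induction v' with
      | zero => simp
      | add s t hs ht => simp only [map_add, mul_add, hs, ht]
      | tmul y' x' =>
        have : (π x).R z * (π x').L z' = z * (π (x * x')).L z' := by
          rw [hπ, Mult.central]; rfl
        simp [Mult.applyL_apply, Mult.applyR_apply, this]
  -- `NR s * NL t` depends only on products taken in `Y ⊗ X`, where `V` is central. So the action of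
  -- `V` preserves the kernels of the surjections `NL` and `NR` and descends through them.
  have key (s t : (Y ⊗[ℂ] X) ⊗[ℂ] Z) :
      NR s * NL (rTensor Z V.L t) = NR (rTensor Z V.R s) * NL t := by
    induction s with
    | zero => simp
    | add s s' hs hs' => simp only [map_add, add_mul, hs, hs']
    | tmul v z =>
      induction t with
      | zero => simp
      | add t t' ht ht' => simp only [map_add, mul_add, ht, ht']
      | tmul v' z' =>
        rw [LinearMap.rTensor_tmul, LinearMap.rTensor_tmul, pair, pair, Mult.central]
  obtain ⟨l, hl⟩ := exists_factor NL (NL ∘ₗ rTensor Z V.L) hLs fun t ht =>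
    hYZ.right _ fun s => by
      obtain ⟨s, rfl⟩ := hRs s
      exact (key s t).trans (by rw [ht, mul_zero])
  obtain ⟨r, hr⟩ := exists_factor NR (NR ∘ₗ rTensor Z V.R) hRs fun t ht =>
    hYZ.left _ fun s => by
      obtain ⟨s, rfl⟩ := hLs s
      exact (key t s).symm.trans (by rw [ht, zero_mul])
  refine ⟨Mult.mk l r fun s t => ?_, fun x z y => ⟨?_, ?_⟩⟩
  · obtain ⟨s, rfl⟩ := hRs s
    obtain ⟨t, rfl⟩ := hLs t
    rw [hr, hl]
    exact (key s t).symm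
  · rw [← hNL]
    exact hl ((y ⊗ₜ x) ⊗ₜ z)
  · rw [← hNR]
    exact hr ((y ⊗ₜ x) ⊗ₜ z)

theorem IsMapSnd.L_lTensor {π : X →ₗ[ℂ] Mult Z} {V : Mult (Y ⊗[ℂ] X)} {W : Mult (Y ⊗[ℂ] Z)}
    (h : IsMapSnd π V W) (z : Z) (t : Y ⊗[ℂ] X) :
    W.L (lTensor Y (Mult.applyL z ∘ₗ π) t) = lTensor Y (Mult.applyL z ∘ₗ π) (V.L t) := by
  induction t with
  | zero => simp
  | add s t hs ht => simp only [map_add, hs, ht]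
  | tmul y x => exact (h x z y).1

/-- Maps on `Y ⊗ Z` agree if they agree on the elements `y ⊗ π(x) z`. -/
theorem IsNonDegenerate.ext_tmul {N : Type*} [AddCommGroup N] [Module ℂ N] {π : X →ₗ[ℂ] Mult Z}
    (hπ : IsNonDegenerate π) {h k : Z →ₗ[ℂ] N}
    (H : ∀ x z, h ((π x).L z) = k ((π x).L z)) : h = k := by
  refine LinearMap.ext fun w => ?_
  have hw : w ∈ Submodule.span ℂ {z : Z | ∃ x y, z = (π x).L y} := by rw [hπ.1]; trivial
  induction hw using Submodule.span_induction with
  | mem w hw =>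
    obtain ⟨x, z, rfl⟩ := hw
    exact H x z
  | zero => simp
  | add s t _ _ hs ht => rw [map_add, map_add, hs, ht]
  | smul c s _ hs => rw [map_smul, map_smul, hs]

theorem IsMapSnd.mul_eq_one (hYZ : NonDegenerate (Y ⊗[ℂ] Z)) {π : X →ₗ[ℂ] Mult Z}
    (hπ : IsNonDegenerate π) {V V' : Mult (Y ⊗[ℂ] X)} {W W' : Mult (Y ⊗[ℂ] Z)}
    (h : IsMapSnd π V W) (h' : IsMapSnd π V' W') (hV : V * V' = 1) : W * W' = 1 := by
  refine Mult.ext_L hYZ fun t => LinearMap.congr_fun (g := (1 : Mult (Y ⊗[ℂ] Z)).L)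
    (TensorProduct.ext (LinearMap.ext fun y => hπ.ext_tmul fun x z => ?_)) t
  change W.L (W'.L (lTensor Y (Mult.applyL z ∘ₗ π) (y ⊗ₜ x))) = y ⊗ₜ (π x).L z
  rw [h'.L_lTensor, h.L_lTensor, ← Mult.L_mul, hV]; rfl

end MapSnd

namespace StarQuantumGroup

open MultiplierHopfStar
open LinearMap (mulLeft mulRight rTensor lTensor mul')

variable {A : Type*} [NonUnitalRing A] [Module ℂ A] [IsScalarTower ℂ A A]
  [SMulCommClass ℂ A A] [StarRing A] [StarModule ℂ A] (G : StarQuantumGroup A)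

/-! ### The universal corepresentation -/

/-- Evaluation of the elements of `Â` at `y`. -/
noncomputable def evalDual (y : A) : Module.Dual ℂ G.Dual :=
  LinearMap.applyₗ y ∘ₗ Submodule.subtype _

theorem evalDual_apply (y : A) (ω : G.Dual) : G.evalDual y ω = ω.1 y := rfl

theorem toOperator_apply (t : A ⊗[ℂ] G.Dual) (y : A) :
    G.toOperator t y = sliceSnd (G.evalDual y) t := by
  induction t with
  | zero => simp
  | add s t hs ht => simp only [map_add, LinearMap.add_apply, hs, ht]
  | tmul x ω => simp [toOperator, evalDual_apply]

theorem toOperator_tmul (x : A) (ω : G.Dual) (y : A) :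
    G.toOperator (x ⊗ₜ ω) y = ω.1 y • x := by
  rw [toOperator_apply, sliceSnd_tmul, evalDual_apply]

theorem ext_evalDual {X : Type*} [AddCommGroup X] [Module ℂ X] {s t : X ⊗[ℂ] G.Dual}
    (h : ∀ y, sliceSnd (G.evalDual y) s = sliceSnd (G.evalDual y) t) : s = t :=
  ext_sliceFst fun f => Subtype.ext (LinearMap.ext fun y => by
    rw [← evalDual_apply, ← evalDual_apply, ← slice_slice, ← slice_slice, h])

theorem ext_toOperator {s t : A ⊗[ℂ] G.Dual}
    (h : ∀ y, G.toOperator s y = G.toOperator t y) : s = t :=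
  G.ext_evalDual fun y => by rw [← toOperator_apply, ← toOperator_apply, h]

theorem toOperator_mul_tmul (s : A ⊗[ℂ] G.Dual) (x : A) (ω : G.Dual) (y : A) :
    G.toOperator (s * (x ⊗ₜ ω)) y = G.toOperator s (G.sliceElem ω y) * x := by
  induction s with
  | zero => simp
  | add s t hs ht => simp only [map_add, LinearMap.add_apply, add_mul, hs, ht]
  | tmul x' ω' =>
    rw [Algebra.TensorProduct.tmul_mul_tmul, toOperator_tmul, toOperator_tmul, mul_apply,
      smul_mul_assoc]

theorem toOperator_tmul_mul (t : A ⊗[ℂ] G.Dual) (x : A) (ω : G.Dual) (y : A) :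
    G.toOperator ((x ⊗ₜ ω) * t) y = x * G.toOperator t (G.leftElem ω y) := by
  induction t with
  | zero => simp
  | add s t hs ht => simp only [map_add, LinearMap.add_apply, mul_add, hs, ht]
  | tmul x' ω' =>
    rw [Algebra.TensorProduct.tmul_mul_tmul, toOperator_tmul, toOperator_tmul, mul_apply',
      mul_smul_comm]

theorem sliceElem_dualEquivRight (a x : A) :
    G.sliceElem (G.dualEquivRight a) x = G.slice2 G.haar a x :=
  G.sliceElem_eq _ _ _ fun b => by
    rw [slice2_mul, G.comul_L_tmul, sliceSnd_lTensor, coe_dualEquivRight]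

theorem rightHaar_faithful {z : A} (h : ∀ x, G.rightHaar (z * x) = 0) : z = 0 := by
  apply G.antipode.injective
  rw [map_zero]
  refine G.haar_faithful_right fun c => ?_
  obtain ⟨c, rfl⟩ := G.antipode.surjective c
  rw [← antipode_mul]
  exact h c

/-- The linear isomorphism `a ↦ ψ a` of `A` onto `Â`, for the right Haar functional `ψ = φ S`. -/
noncomputable def dualEquivRightHaar : A ≃ₗ[ℂ] G.Dual :=
  LinearEquiv.ofBijective
    (LinearMap.codRestrict _ ((LinearMap.mul ℂ A).compr₂ G.rightHaar) fun a => by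
      obtain ⟨z, hz⟩ := G.exists_rightHaar_eq_haar a
      exact (G.mem_range_haarMul _).2 ⟨z, hz⟩) (by
      constructor
      · rw [injective_iff_map_eq_zero]
        exact fun a ha => G.rightHaar_faithful fun c =>
          LinearMap.congr_fun (congrArg Subtype.val ha) c
      · intro ω
        obtain ⟨a, rfl⟩ := G.dualEquiv.surjective ω
        obtain ⟨z, hz⟩ := G.exists_haarMul_eq_rightHaar a
        exact ⟨z, Subtype.ext (LinearMap.ext fun x => (hz x).symm)⟩)

theorem coe_dualEquivRightHaar (a : A) :
    (G.dualEquivRightHaar a).1 = G.rightHaar ∘ₗ mulLeft ℂ a := rfl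

theorem leftElem_dualEquivRightHaar (a x : A) :
    G.leftElem (G.dualEquivRightHaar a) x = G.slice3 G.rightHaar a x :=
  G.leftElem_eq _ _ _ fun b => by
    rw [slice3_mul, sliceFst_rTensor, coe_dualEquivRightHaar]

/-- `T3` as a linear isomorphism. -/
noncomputable def equivT3 : A ⊗[ℂ] A ≃ₗ[ℂ] A ⊗[ℂ] A :=
  LinearEquiv.ofBijective G.T3 ⟨fun s t h => by
    have h1 := congrArg star h
    rw [star_T3, star_T3] at h1
    exact star_injective (G.T1.injective h1), G.T3_surjective⟩

/-- `x ⊗ ω ↦ U (x ⊗ ω)` -/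
noncomputable def universalL : A ⊗[ℂ] G.Dual ≃ₗ[ℂ] A ⊗[ℂ] G.Dual :=
  TensorProduct.congr G.antipode G.dualEquivRight.symm ≪≫ₗ TensorProduct.comm ℂ A A ≪≫ₗ
    G.equivT3 ≪≫ₗ TensorProduct.congr G.antipode.symm G.dualEquivRight

/-- `x ⊗ ω ↦ (x ⊗ ω) U` -/
noncomputable def universalR : A ⊗[ℂ] G.Dual ≃ₗ[ℂ] A ⊗[ℂ] G.Dual :=
  TensorProduct.congr G.antipode G.dualEquivRightHaar.symm ≪≫ₗ TensorProduct.comm ℂ A A ≪≫ₗ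
    G.T2 ≪≫ₗ TensorProduct.comm ℂ A A ≪≫ₗ
      TensorProduct.congr G.antipode.symm G.dualEquivRightHaar

/-- By strong invariance, `((ι ⊙ a φ)Δ(y))x` is `S⁻¹((ι ⊙ φ)((1 ⊗ y)T3(a ⊗ S(x))))`. This explains
the shape of `universalL`: the operator lies in `A ⊗ Â`, and bijectivity comes from `T3`. -/
theorem toOperator_universalL (x : A) (ω : G.Dual) (y : A) :
    G.toOperator (G.universalL (x ⊗ₜ ω)) y = G.sliceElem ω y * x := by
  obtain ⟨a, rfl⟩ := G.dualEquivRight.surjective ω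
  have h1 (t : A ⊗[ℂ] A) :
      G.toOperator (TensorProduct.congr G.antipode.symm G.dualEquivRight t) y
        = G.antipode.symm (sliceSnd G.haar (lTensor A (mulLeft ℂ y) t)) := by
    induction t with
    | zero => simp
    | add s t hs ht => simp only [map_add, LinearMap.add_apply, hs, ht]
    | tmul p q =>
      rw [TensorProduct.congr_tmul, toOperator_tmul, dualEquivRight_apply]; simp
  have h2 : G.universalL (x ⊗ₜ G.dualEquivRight a)
      = TensorProduct.congr G.antipode.symm G.dualEquivRight (G.T3 (a ⊗ₜ G.antipode x)) := by
    simp [universalL, equivT3]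
    rfl
  rw [h2, h1, ← mul_slice4, antipode_symm_mul, LinearEquiv.symm_apply_apply, ← antipode_slice2,
    LinearEquiv.symm_apply_apply, sliceElem_dualEquivRight]

/-- Mirror image with `ω = ψ a`: here `x · slice3 ψ a y` is `S⁻¹` of `(ψ ⊙ ι)(T2(a ⊗ S(x))(y ⊗ 1))`.
-/
theorem toOperator_universalR (x : A) (ω : G.Dual) (y : A) :
    G.toOperator (G.universalR (x ⊗ₜ ω)) y = x * G.leftElem ω y := by
  obtain ⟨a, rfl⟩ := G.dualEquivRightHaar.surjective ω
  have h1 (t : A ⊗[ℂ] A) :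
      G.toOperator (TensorProduct.congr G.antipode.symm G.dualEquivRightHaar
        (TensorProduct.comm ℂ A A t)) y
        = G.antipode.symm (sliceFst G.rightHaar (rTensor A (mulRight ℂ y) t)) := by
    induction t with
    | zero => simp
    | add s t hs ht => simp only [map_add, LinearMap.add_apply, hs, ht]
    | tmul p q =>
      rw [TensorProduct.comm_tmul, TensorProduct.congr_tmul, toOperator_tmul,
        coe_dualEquivRightHaar]
      simp
  have h2 : G.universalR (x ⊗ₜ G.dualEquivRightHaar a)
      = TensorProduct.congr G.antipode.symm G.dualEquivRightHaar
        (TensorProduct.comm ℂ A A (G.T2 (a ⊗ₜ G.antipode x))) := by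
    simp [universalR]
  have h3 : sliceFst G.rightHaar (lTensor A (mulRight ℂ (G.antipode x)) (G.T1 (a ⊗ₜ y)))
      = G.slice1 G.rightHaar y a * G.antipode x := by rw [sliceFst_lTensor]; rfl
  rw [h2, h1, ← G.comul_L_tmul', G.comul_L_tmul, h3, antipode_symm_mul,
    LinearEquiv.symm_apply_apply, ← antipode_slice3, LinearEquiv.symm_apply_apply,
    leftElem_dualEquivRightHaar]

/-- The universal corepresentation `U`. -/
noncomputable def universal : Mult (A ⊗[ℂ] G.Dual) :=
  Mult.mk G.universalL.toLinearMap G.universalR.toLinearMap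
    (Mult.bilin_central _ _ LinearMap.id LinearMap.id fun x ω x' ω' =>
      G.ext_toOperator fun y => by
        simp only [LinearEquiv.coe_coe, LinearMap.id_apply]
        rw [toOperator_mul_tmul, toOperator_tmul_mul, toOperator_universalL,
          toOperator_universalR, leftElem_sliceElem, mul_assoc])

theorem isUnit_universal : IsUnit G.universal :=
  Mult.isUnit_of_bijective _ G.universalL G.universalR rfl rfl

theorem isUniversal_universal : G.IsUniversal G.universal := fun x ω y =>
  ⟨(G.toOperator_universalL x ω y).trans (G.sliceElem_mul ω y x),
    (G.toOperator_universalR x ω y).trans (G.mul_leftElem ω y x)⟩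

theorem IsUniversal.eq_universal {U : Mult (A ⊗[ℂ] G.Dual)} (h : G.IsUniversal U) :
    U = G.universal :=
  Mult.ext (TensorProduct.ext' fun x ω => G.ext_toOperator fun y => by
      rw [(h x ω y).1, (G.isUniversal_universal x ω y).1])
    (TensorProduct.ext' fun x ω => G.ext_toOperator fun y => by
      rw [(h x ω y).2, (G.isUniversal_universal x ω y).2])

theorem toOperator_universal (x : A) (ω : G.Dual) (y : A) :
    G.toOperator (G.universal.L (x ⊗ₜ ω)) y = G.sliceElem ω y * x :=
  G.toOperator_universalL x ω y

/-- Evaluating the last leg at `y`, `V₁₃V₂₃(s ⊗ ω)` becomes `Δ((ι ⊙ ω)Δ(y))s` by covariance of right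
slices. For `s = T2(x ⊗ d)` this is `T2(((ι ⊙ ω)Δ(y))x ⊗ d)`. -/
theorem pentagonL_universal : G.PentagonL G.universal := by
  intro x d ω
  refine G.ext_evalDual fun y => ?_
  have h1 (p : A) (u : A ⊗[ℂ] G.Dual) : sliceSnd (G.evalDual y)
      ((leg13 G.universal).L ((TensorProduct.assoc ℂ A A G.Dual).symm (p ⊗ₜ u)))
      = lTensor A (G.toOperator u) (G.T1 (y ⊗ₜ p)) := by
    induction u with
    | zero => simp
    | add s t hs ht =>
      simp only [TensorProduct.tmul_add, map_add, LinearMap.lTensor_add, LinearMap.add_apply,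
        hs, ht]
    | tmul q η =>
      have h2 (t : A ⊗[ℂ] G.Dual) :
          sliceSnd (G.evalDual y) (TensorProduct.rightComm ℂ A G.Dual A (t ⊗ₜ q))
            = sliceSnd (G.evalDual y) t ⊗ₜ q := by
        induction t with
        | zero => simp
        | add s t hs ht => simp only [TensorProduct.add_tmul, map_add, hs, ht]
        | tmul a b => simp [TensorProduct.smul_tmul']
      have h3 (t : A ⊗[ℂ] A) : lTensor A (G.toOperator (q ⊗ₜ η)) t = sliceSnd η.1 t ⊗ₜ q := by
        induction t with
        | zero => simp
        | add s t hs ht => simp only [map_add, TensorProduct.add_tmul, hs, ht]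
        | tmul a b => rw [LinearMap.lTensor_tmul, toOperator_tmul]; simp [TensorProduct.smul_tmul']
      rw [TensorProduct.assoc_symm_tmul, leg13_L_tmul, h2, h3, ← toOperator_apply,
        toOperator_universal, sliceElem_mul]
  have h4 (s : A ⊗[ℂ] A) : sliceSnd (G.evalDual y)
      ((leg13 G.universal).L ((leg23 G.universal).L (s ⊗ₜ ω)))
      = (G.comul (G.sliceElem ω y)).L s := by
    induction s with
    | zero => simp
    | add s t hs ht => simp only [TensorProduct.add_tmul, map_add, hs, ht]
    | tmul p q =>
      have h5 : G.toOperator (G.universal.L (q ⊗ₜ ω)) = mulRight ℂ q ∘ₗ G.sliceElemLinear ω :=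
        LinearMap.ext fun y => G.toOperator_universal q ω y
      rw [leg23_L_tmul, h1, h5, LinearMap.lTensor_comp, LinearMap.comp_apply,
        ← G.rightCovariant_sliceElem ω, G.comul_L_tmul]
      rfl
  rw [h4, ← G.T2_mul, sliceSnd_rTensor, ← toOperator_apply, toOperator_universal]
  rfl

theorem pi_universal_L (ω η : G.Dual) : (G.pi G.universal ω).L η = ω * η := by
  obtain ⟨a, rfl⟩ := G.dualEquivRight.surjective ω
  refine Subtype.ext (LinearMap.ext fun y => ?_)
  rw [pi_L G G.nonDegenerate_dual, ← evalDual_apply, ← slice_slice, ← toOperator_apply,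
    toOperator_universal, mul_apply, dualEquivRight_apply]

theorem pi_universal (ω : G.Dual) : G.pi G.universal ω = Mult.emb ω :=
  Mult.ext_L G.nonDegenerate_dual fun η => G.pi_universal_L ω η

theorem isCorep_universal : G.IsCorep G.universal :=
  G.pentagonL_universal.isCorep G G.nonDegenerate_dual

theorem isUnitaryCorep_universal : G.IsUnitaryCorep G.universal :=
  ⟨G.isCorep_universal, (G.mem_unitary_iff G.nonDegenerate_dual G.isCorep_universal
    G.isUnit_universal).2 fun ω => by rw [pi_universal, pi_universal, emb_star]⟩

theorem isSlice_pi_universal (ω : G.Dual) : G.IsSlice G.universal ω (G.pi G.universal ω) :=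
  G.isSlice_pi G.nonDegenerate_dual _ ω

/-! ### Unitary corepresentations and representations of the dual -/

variable {B : Type*} [NonUnitalRing B] [Module ℂ B] [IsScalarTower ℂ B B] [SMulCommClass ℂ B B]

/-- On vectors `π(ω)z` the multiplier `V` is the image of `U` under `γ = π(·)z` on the last leg.
That map commutes with operations on the other legs, so the identity for `U` transports. -/
theorem IsMapSnd.pentagonL {π : G.Dual →ₗ[ℂ] Mult B} (hπ : IsNonDegenerate π)
    {V : Mult (A ⊗[ℂ] B)} (h : IsMapSnd π G.universal V) : G.PentagonL V := by
  intro x d b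
  suffices (leg13 V * leg23 V : Mult ((A ⊗[ℂ] A) ⊗[ℂ] B)).L ∘ₗ
        TensorProduct.mk ℂ _ B (G.T2 (x ⊗ₜ d))
      = rTensor B (G.T2.toLinearMap ∘ₗ (TensorProduct.mk ℂ A A).flip d) ∘ₗ V.L ∘ₗ
        TensorProduct.mk ℂ A B x from LinearMap.congr_fun this b
  refine hπ.ext_tmul fun ω z => ?_
  let γ := Mult.applyL z ∘ₗ π
  have hγ (t : A ⊗[ℂ] G.Dual) : V.L (lTensor A γ t) = lTensor A γ (G.universal.L t) :=
    h.L_lTensor z t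
  have h13 (t : (A ⊗[ℂ] A) ⊗[ℂ] G.Dual) : (leg13 V).L (lTensor (A ⊗[ℂ] A) γ t)
      = lTensor (A ⊗[ℂ] A) γ ((leg13 G.universal).L t) := by
    have : (leg13 V : Mult ((A ⊗[ℂ] A) ⊗[ℂ] B)).L ∘ₗ lTensor (A ⊗[ℂ] A) γ
        = lTensor (A ⊗[ℂ] A) γ ∘ₗ
          (leg13 G.universal : Mult ((A ⊗[ℂ] A) ⊗[ℂ] G.Dual)).L := by
      refine TensorProduct.ext_threefold fun p q ω => ?_
      have h1 (t : A ⊗[ℂ] G.Dual) : TensorProduct.rightComm ℂ A B A (lTensor A γ t ⊗ₜ q)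
          = lTensor (A ⊗[ℂ] A) γ (TensorProduct.rightComm ℂ A G.Dual A (t ⊗ₜ q)) := by
        induction t with
        | zero => simp
        | add s t hs ht => simp only [TensorProduct.add_tmul, map_add, hs, ht]
        | tmul a b => simp
      rw [LinearMap.comp_apply, LinearMap.comp_apply, LinearMap.lTensor_tmul, leg13_L_tmul,
        leg13_L_tmul, ← h1, ← hγ, LinearMap.lTensor_tmul]
    exact LinearMap.congr_fun this t
  have h23 (t : (A ⊗[ℂ] A) ⊗[ℂ] G.Dual) : (leg23 V).L (lTensor (A ⊗[ℂ] A) γ t)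
      = lTensor (A ⊗[ℂ] A) γ ((leg23 G.universal).L t) := by
    have : (leg23 V : Mult ((A ⊗[ℂ] A) ⊗[ℂ] B)).L ∘ₗ lTensor (A ⊗[ℂ] A) γ
        = lTensor (A ⊗[ℂ] A) γ ∘ₗ
          (leg23 G.universal : Mult ((A ⊗[ℂ] A) ⊗[ℂ] G.Dual)).L := by
      refine TensorProduct.ext_threefold fun p q ω => ?_
      have h1 (t : A ⊗[ℂ] G.Dual) : (TensorProduct.assoc ℂ A A B).symm (p ⊗ₜ lTensor A γ t)
          = lTensor (A ⊗[ℂ] A) γ ((TensorProduct.assoc ℂ A A G.Dual).symm (p ⊗ₜ t)) := by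
        induction t with
        | zero => simp
        | add s t hs ht => simp only [TensorProduct.tmul_add, map_add, hs, ht]
        | tmul a b => simp
      rw [LinearMap.comp_apply, LinearMap.comp_apply, LinearMap.lTensor_tmul, leg23_L_tmul,
        leg23_L_tmul, ← h1, ← hγ, LinearMap.lTensor_tmul]
    exact LinearMap.congr_fun this t
  change (leg13 V).L ((leg23 V).L (lTensor (A ⊗[ℂ] A) γ (G.T2 (x ⊗ₜ d) ⊗ₜ ω)))
    = rTensor B _ (V.L (lTensor A γ (x ⊗ₜ ω)))
  rw [h23, h13, G.pentagonL_universal, hγ]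
  generalize G.universal.L (x ⊗ₜ ω) = w
  exact LinearMap.congr_fun ((LinearMap.lTensor_comp_rTensor ..).trans
    (LinearMap.rTensor_comp_lTensor ..).symm) w

/-- On `π(η)z` one gets `π_V(ω)π(η)z = π(π_U(ω)η)z = π(ω η)z`, and such vectors span `B`. -/
theorem IsMapSnd.pi_eq (hB : NonDegenerate B) {π : G.Dual →ₗ[ℂ] Mult B}
    (hπ : IsNonDegenerate π) (hm : ∀ ω η, π (ω * η) = π ω * π η)
    {V : Mult (A ⊗[ℂ] B)} (h : IsMapSnd π G.universal V) (ω : G.Dual) : G.pi V ω = π ω := by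
  obtain ⟨a, rfl⟩ := G.dualEquivRight.surjective ω
  refine Mult.ext_L hB fun b => LinearMap.congr_fun (hπ.ext_tmul fun η z => ?_) b
  rw [pi_L G hB]
  refine (congrArg (sliceFst G.haar) (h.L_lTensor z (a ⊗ₜ η))).trans ?_
  rw [sliceFst_lTensor, ← pi_L G G.nonDegenerate_dual, pi_universal_L, LinearMap.comp_apply, hm]
  rfl

/-- Transporting `U⁻¹` along `π` gives the inverse. -/
theorem IsMapSnd.isUnit (hB : NonDegenerate B) {π : G.Dual →ₗ[ℂ] Mult B}
    (hπ : IsNonDegenerate π) (hm : ∀ ω η, π (ω * η) = π ω * π η)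
    {V : Mult (A ⊗[ℂ] B)} (h : IsMapSnd π G.universal V) : IsUnit V := by
  have hAB := G.nonDegenerate.tensor hB
  obtain ⟨⟨U, U', h1, h2⟩, hU : U = G.universal⟩ := G.isUnit_universal
  rw [← hU] at h
  obtain ⟨V', h'⟩ := exists_isMapSnd hAB hm hπ U'
  exact ⟨⟨V, V', h.mul_eq_one hAB hπ h' h1, h'.mul_eq_one hAB hπ h h2⟩, rfl⟩

variable [StarRing B] [StarModule ℂ B]

/-- Every non-degenerate `*`-homomorphism `g : Â → M(B)` is `π_V` for the unitary corepresentation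
`V = (ι ⊙ g)(U)`. -/
theorem exists_isUnitaryCorep (hB : NonDegenerate B) (g : G.Dual →⋆ₙₐ[ℂ] Mult B)
    (hg : IsNonDegenerate (g : G.Dual →ₗ[ℂ] Mult B)) :
    ∃ V : Mult (A ⊗[ℂ] B), IsMapSnd (g : G.Dual →ₗ[ℂ] Mult B) G.universal V ∧
      G.IsUnitaryCorep V ∧ G.pi V = g := by
  have hm (ω η : G.Dual) : (g : G.Dual →ₗ[ℂ] Mult B) (ω * η)
      = (g : G.Dual →ₗ[ℂ] Mult B) ω * (g : G.Dual →ₗ[ℂ] Mult B) η := map_mul g ω η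
  obtain ⟨V, hV⟩ := exists_isMapSnd (G.nonDegenerate.tensor hB) hm hg G.universal
  have hpi : G.pi V = g := funext fun ω => IsMapSnd.pi_eq G hB hg hm hV ω
  have hc : G.IsCorep V := (IsMapSnd.pentagonL G hg hV).isCorep G hB
  exact ⟨V, hV, ⟨hc, (G.mem_unitary_iff_exists hB hc (IsMapSnd.isUnit G hB hg hm hV)).2
    ⟨g, hpi.symm⟩⟩, hpi⟩

theorem isUnit_of_mem_unitary {R : Type*} [Ring R] [StarRing R] {u : R} (h : u ∈ unitary R) :
    IsUnit u :=
  ⟨⟨u, star u, (Unitary.mem_iff.1 h).2, (Unitary.mem_iff.1 h).1⟩, rfl⟩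

theorem bijOn_pi (hB : NonDegenerate B) :
    Set.BijOn (fun V : Mult (A ⊗[ℂ] B) => G.pi V) {V | G.IsUnitaryCorep V}
      {f | ∃ g : G.Dual →⋆ₙₐ[ℂ] Mult B, ⇑g = f ∧
        IsNonDegenerate (g : G.Dual →ₗ[ℂ] Mult B)} := by
  refine ⟨fun V hV => ?_, fun V _ W _ h => G.pi_injective hB h, ?_⟩
  · have hu := isUnit_of_mem_unitary hV.2
    obtain ⟨g, hg⟩ := (G.mem_unitary_iff_exists hB hV.1 hu).1 hV.2
    refine ⟨g, hg, ?_⟩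
    have h1 : (g : G.Dual →ₗ[ℂ] Mult B) = G.piLinear hB V :=
      LinearMap.ext fun ω => congrFun hg ω
    rw [h1]
    exact G.isNonDegenerate_pi hB V hu
  · rintro _ ⟨g, rfl, hg⟩
    obtain ⟨V, -, hV, hpi⟩ := G.exists_isUnitaryCorep hB g hg
    exact ⟨V, hV, hpi⟩

/-- The transport of `U` along `π_V` has the same associated homomorphism as `V`, so injectivity of
`V ↦ π_V` identifies it with `V`. -/
theorem IsUnitaryCorep.isMapSnd (hB : NonDegenerate B) {V : Mult (A ⊗[ℂ] B)}
    (hV : G.IsUnitaryCorep V) {g : G.Dual →⋆ₙₐ[ℂ] Mult B} (hg : ⇑g = G.pi V) :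
    IsMapSnd (g : G.Dual →ₗ[ℂ] Mult B) G.universal V := by
  have h1 : (g : G.Dual →ₗ[ℂ] Mult B) = G.piLinear hB V :=
    LinearMap.ext fun ω => congrFun hg ω
  have h2 : IsNonDegenerate (g : G.Dual →ₗ[ℂ] Mult B) := by
    rw [h1]; exact G.isNonDegenerate_pi hB V (isUnit_of_mem_unitary hV.2)
  obtain ⟨V', h, -, hpi⟩ := G.exists_isUnitaryCorep hB g h2
  rwa [G.pi_injective hB (hpi.trans hg)] at h

end StarQuantumGroup

end QuantumGroup

theorem mainTheorem8 {A : Type*} [NonUnitalRing A] [Module ℂ A] [IsScalarTower ℂ A A]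
    [SMulCommClass ℂ A A] [StarRing A] [StarModule ℂ A]
    (G : QuantumGroup.StarQuantumGroup A) :
    -- the antipode exists and is unique
    (∃! S : A ≃ₗ[ℂ] A, G.IsAntipode S) ∧ ∀ S : A ≃ₗ[ℂ] A, G.IsAntipode S →
    -- the dual is `{φ a} = {a φ}`, and it is a non-degenerate associative `*`-algebra
    (∀ ω : Module.Dual ℂ A,
      ω ∈ LinearMap.range G.haarMul ↔ ∃ a : A, ∀ x : A, ω x = G.haar (x * a)) ∧
    QuantumGroup.NonDegenerate G.Dual ∧
    (∀ ω₁ ω₂ ω₃ : G.Dual, ω₁ * ω₂ * ω₃ = ω₁ * (ω₂ * ω₃)) ∧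
    ∃ (_ : StarRing G.Dual) (_ : StarModule ℂ G.Dual),
      (∀ (ω : G.Dual) (x : A), (star ω).1 x = starRingEnd ℂ (ω.1 (star (S x)))) ∧
      -- the multiplier algebra of the dual as a space of functionals, and its adjoint
      (∀ T : QuantumGroup.Mult G.Dual,
        ∃! θ : Module.Dual ℂ A, G.IsDualMultiplier θ ∧ G.IsImplementedBy T θ) ∧
      (∀ θ : Module.Dual ℂ A, G.IsDualMultiplier θ →
        ∃! T : QuantumGroup.Mult G.Dual, G.IsImplementedBy T θ) ∧
      (∀ (T : QuantumGroup.Mult G.Dual) (θ θ' : Module.Dual ℂ A),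
        G.IsImplementedBy T θ → G.IsImplementedBy (star T) θ' →
          ∀ x : A, θ' x = starRingEnd ℂ (θ (star (S x)))) ∧
      -- a non-degenerate corepresentation `V` is unitary iff `π_V` is a `*`-homomorphism
      (∀ {B : Type*} [NonUnitalRing B] [Module ℂ B] [IsScalarTower ℂ B B] [SMulCommClass ℂ B B]
        [StarRing B] [StarModule ℂ B], QuantumGroup.NonDegenerate B →
        ∀ V : QuantumGroup.Mult (A ⊗[ℂ] B),
          (∀ ω : G.Dual, G.IsSlice V ω (G.pi V ω)) ∧
          (G.IsCorep V → IsUnit V →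
            (V ∈ unitary (QuantumGroup.Mult (A ⊗[ℂ] B)) ↔
              ∃ g : G.Dual →⋆ₙₐ[ℂ] QuantumGroup.Mult B, ⇑g = G.pi V))) ∧
      -- the universal corepresentation `U` is a unitary corepresentation, with `π_U = ι`
      (∃! U : QuantumGroup.Mult (A ⊗[ℂ] G.Dual), G.IsUniversal U) ∧
      ∀ U : QuantumGroup.Mult (A ⊗[ℂ] G.Dual), G.IsUniversal U →
        G.IsUnitaryCorep U ∧
        (∀ ω : G.Dual, G.IsSlice U ω (G.pi U ω) ∧
          ∀ η : G.Dual, (G.pi U ω).L η = ω * η ∧ (G.pi U ω).R η = η * ω) ∧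
        -- `V ↦ π_V` is a bijection from unitary corepresentations to non-degenerate
        -- `*`-homomorphisms of the dual, and `V = (ι ⊙ π_V)(U)`
        ∀ {B : Type*} [NonUnitalRing B] [Module ℂ B] [IsScalarTower ℂ B B] [SMulCommClass ℂ B B]
          [StarRing B] [StarModule ℂ B], QuantumGroup.NonDegenerate B →
          Set.BijOn (fun V : QuantumGroup.Mult (A ⊗[ℂ] B) => G.pi V)
            {V | G.IsUnitaryCorep V}
            {f | ∃ g : G.Dual →⋆ₙₐ[ℂ] QuantumGroup.Mult B, ⇑g = f ∧
              QuantumGroup.IsNonDegenerate (g : G.Dual →ₗ[ℂ] QuantumGroup.Mult B)} ∧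
          ∀ (V : QuantumGroup.Mult (A ⊗[ℂ] B)) (g : G.Dual →⋆ₙₐ[ℂ] QuantumGroup.Mult B),
            G.IsUnitaryCorep V → ⇑g = G.pi V →
            QuantumGroup.IsMapSnd (g : G.Dual →ₗ[ℂ] QuantumGroup.Mult B) U V := by
  refine ⟨⟨G.antipode, G.isAntipode_antipode, fun S hS =>
    QuantumGroup.StarQuantumGroup.IsAntipode.eq_antipode G hS⟩, fun S hS => ?_⟩
  -- By uniqueness `S` is the constructed antipode, so the involution built from it is the required
  -- one.
  obtain rfl := QuantumGroup.StarQuantumGroup.IsAntipode.eq_antipode G hS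
  refine ⟨G.mem_range_haarMul, G.nonDegenerate_dual, G.dual_mul_assoc, G.instStarRingDual, G.instStarModuleDual,
    G.star_dual_apply, fun T => ?_, fun θ hθ => ?_, fun T θ θ' h h' => h.star_apply h', ?_,
    ⟨G.universal, G.isUniversal_universal, fun U hU => hU.eq_universal G⟩, ?_⟩
  · obtain ⟨θ, hθ⟩ := G.exists_implementing T
    exact ⟨θ, ⟨hθ.isDualMultiplier G, hθ⟩, fun θ' hθ' => hθ'.2.unique G hθ⟩
  · obtain ⟨T, hT⟩ := hθ.exists_mult
    exact ⟨T, hT, fun T' hT' => hT'.eq hT⟩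
  · intro B _ _ _ _ _ _ hB V
    exact ⟨G.isSlice_pi hB V, G.mem_unitary_iff_exists hB⟩
  · intro U hU
    obtain rfl := hU.eq_universal G
    refine ⟨G.isUnitaryCorep_universal, fun ω => ⟨G.isSlice_pi_universal ω,
      fun η => ?_⟩, ?_⟩
    · rw [G.pi_universal]
      exact ⟨rfl, rfl⟩
    · intro B _ _ _ _ _ _ hB
      exact ⟨G.bijOn_pi hB, fun V g hV hg => hV.isMapSnd G hB hg⟩
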